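/- Let $k$ be an algebraically closed field of characteristic zero. Let $X$ be a smooth irreducible projective variety of dimension $n$ over $k$, and let $\varphi_D : X \hookrightarrow \mathbb{P}^N$ be the embedding given by the complete linear system of a very ample divisor $D$ on $X$. For a linear subvariety $W \subseteq \mathbb{P}^N$ of dimension $N-n-1$ that is disjoint from $\varphi_D(X)$, let $f_W = \pi_W \circ \varphi_D : X \to \mathbb{P}^n$ be the restriction to $X$ of the linear projection with center $W$. One says that $X$ possesses a Galois embedding with Galois group $G$ if there are such $D$ and $W$ for which the field extension $f_W^* k(\mathbb{P}^n) \subseteq k(X)$ is Galois with Galois group isomorphic to $G$. Corollary. Let $C$ be a smooth projective curve over $k$ that possesses a Galois embedding with Galois group $G$, and let $d \geq 0$. Then the $d$-fold product $C^d$ (a smooth projective variety of dimension $d$) possesses a Galois embedding with Galois group $G^d \rtimes S_d$, where the symmetric group $S_d$ acts on $G^d$ by permuting the factors. -/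

import Mathlib

open AlgebraicGeometry CategoryTheory CategoryTheory.Limits

universe u

namespace GaloisEmbedding

noncomputable section

attribute [local instance] MvPolynomial.gradedAlgebra

/-! ## Projective space -/

/-- The standard grading of `k[x₀, …, x_N]`; its piece of degree one is the space of linear
forms. -/
abbrev grading (k : Type u) [Field k] (N : ℕ) :
    ℕ → Submodule k (MvPolynomial (Fin (N + 1)) k) :=
  MvPolynomial.homogeneousSubmodule (Fin (N + 1)) k

/-- The space of linear forms in `x₀, …, x_N`. -/
abbrev LinearForm (k : Type u) [Field k] (N : ℕ) : Type u := grading k N 1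

/-- The coordinate `x_i` as a linear form. -/
def coord (k : Type u) [Field k] (N : ℕ) (i : Fin (N + 1)) : LinearForm k N :=
  ⟨MvPolynomial.X i, MvPolynomial.isHomogeneous_X k i⟩

/-- Projective space `ℙ^N = Proj k[x₀, …, x_N]`. -/
abbrev projectiveSpace (k : Type u) [Field k] (N : ℕ) : Scheme.{u} := Proj (grading k N)

/-- The structure morphism `ℙ^N ⟶ Spec k`. -/
def structureMap (k : Type u) [Field k] (N : ℕ) : projectiveSpace k N ⟶ Spec (.of k) :=
  Proj.toSpecZero (grading k N) ≫ Spec.map (CommRingCat.ofHom (algebraMap k (grading k N 0)))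

/-- The open subset `D₊(b) = {b ≠ 0}` of `ℙ^N`, for a linear form `b`. -/
def nonvanishing {k : Type u} [Field k] {N : ℕ} (b : LinearForm k N) :
    (projectiveSpace k N).Opens :=
  Proj.basicOpen (grading k N) b.1

/-- The regular function `a / b` on `D₊(b)`, for linear forms `a` and `b`. -/
def ratio {k : Type u} [Field k] {N : ℕ} (a b : LinearForm k N) :
    Γ(projectiveSpace k N, nonvanishing b) :=
  (Proj.awayToSection (grading k N) b.1).hom
    (HomogeneousLocalization.Away.mk (grading k N) b.2 1 a.1 (by simp))

/-! ## Linear projections -/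

/-- The linear subvariety `W = {ℓ₀ = … = ℓ_n = 0}` of `ℙ^N`. If `ℓ₀, …, ℓ_n` are linearly
independent then `W` has dimension `N - n - 1` (it is empty if `n = N`), and every linear
subvariety of that dimension has this form. -/
def center {k : Type u} [Field k] {N n : ℕ} (ℓ : Fin (n + 1) → LinearForm k N) :
    Set (projectiveSpace k N) :=
  {x | ∀ j, x ∉ nonvanishing (ℓ j)}

/-- The substitution `y_j ↦ ℓ_j` from `k[y₀, …, y_n]` to `k[x₀, …, x_N]`. -/
def substitution {k : Type u} [Field k] {N n : ℕ} (ℓ : Fin (n + 1) → LinearForm k N) :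
    grading k n →+*ᵍ grading k N where
  __ := (MvPolynomial.aeval (fun j ↦ (ℓ j).1) :
    MvPolynomial (Fin (n + 1)) k →ₐ[k] MvPolynomial (Fin (N + 1)) k).toRingHom
  map_mem {i x} hx := by
    have := MvPolynomial.IsHomogeneous.aeval (S := k) (n := 1) (φ := x) (m := i) hx
      (fun j ↦ (ℓ j).1) (fun j ↦ (ℓ j).2)
    rw [one_mul] at this
    exact this

lemma substitution_X {k : Type u} [Field k] {N n : ℕ} (ℓ : Fin (n + 1) → LinearForm k N)
    (j : Fin (n + 1)) : substitution ℓ (MvPolynomial.X j) = (ℓ j).1 :=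
  MvPolynomial.aeval_X _ j

/-- For homogeneous `s` of positive degree, the morphism `D₊(s(ℓ₀, …, ℓ_n)) ⟶ ℙ^n`
given in homogeneous coordinates by `(ℓ₀ : … : ℓ_n)`; it is the map induced on spectra by
`p / s ^ m ↦ p(ℓ₀, …, ℓ_n) / s(ℓ₀, …, ℓ_n) ^ m`. -/
def localProjection {k : Type u} [Field k] {N n : ℕ} (ℓ : Fin (n + 1) → LinearForm k N)
    (s : MvPolynomial (Fin (n + 1)) k) {m : ℕ} (hs : s ∈ grading k n m) (hm : 0 < m) :
    (Proj.basicOpen (grading k N) (substitution ℓ s)).toScheme ⟶ projectiveSpace k n :=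
  Proj.basicOpenToSpec (grading k N) (substitution ℓ s) ≫
    Spec.map (CommRingCat.ofHom (HomogeneousLocalization.Away.map (substitution ℓ) s)) ≫
      Proj.awayι (grading k n) s hs hm

lemma awayMap_map {k : Type u} [Field k] {N n : ℕ} (ℓ : Fin (n + 1) → LinearForm k N)
    {s t p : MvPolynomial (Fin (n + 1)) k} {m m' : ℕ} (hs : s ∈ grading k n m)
    (ht : t ∈ grading k n m') (hp : p = s * t) (hp' : substitution ℓ p =
      substitution ℓ s * substitution ℓ t) :
    (HomogeneousLocalization.awayMap (grading k N) ((substitution ℓ).map_mem ht) hp').comp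
      (HomogeneousLocalization.Away.map (substitution ℓ) s) =
    (HomogeneousLocalization.Away.map (substitution ℓ) p).comp
      (HomogeneousLocalization.awayMap (grading k n) ht hp) := by
  subst hp
  ext x
  obtain ⟨i, a, ha, rfl⟩ := x.mk_surjective _ hs
  simp [HomogeneousLocalization.awayMap_mk]

lemma homOfLE_localProjection {k : Type u} [Field k] {N n : ℕ} (ℓ : Fin (n + 1) → LinearForm k N)
    {s t p : MvPolynomial (Fin (n + 1)) k} {m m' m'' : ℕ} (hs : s ∈ grading k n m)
    (ht : t ∈ grading k n m') (hm : 0 < m) (hp : p = s * t) (hpm : p ∈ grading k n m'')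
    (hm'' : 0 < m'')
    (hle : Proj.basicOpen (grading k N) (substitution ℓ p) ≤
      Proj.basicOpen (grading k N) (substitution ℓ s)) :
    (projectiveSpace k N).homOfLE hle ≫ localProjection ℓ s hs hm =
      localProjection ℓ p hpm hm'' := by
  have hp' : substitution ℓ p = substitution ℓ s * substitution ℓ t := by rw [hp, map_mul]
  have h1 := Proj.basicOpenToSpec_SpecMap_awayMap (grading k N) (f := substitution ℓ s)
    ((substitution ℓ).map_mem ht) hp'
  have h2 := Proj.SpecMap_awayMap_awayι (grading k n) hs hm ht hp
  unfold localProjection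
  rw [← Category.assoc, ← h1, Category.assoc, ← Category.assoc (Spec.map _) (Spec.map _),
    ← Spec.map_comp, ← CommRingCat.ofHom_comp, awayMap_map ℓ hs ht hp hp', CommRingCat.ofHom_comp,
    Spec.map_comp, Category.assoc]
  congr 2

/-- The complement `ℙ^N ∖ W` of the center, as the union of the open sets `D₊(ℓ_j)`. -/
def centerCompl {k : Type u} [Field k] {N n : ℕ} (ℓ : Fin (n + 1) → LinearForm k N) :
    (projectiveSpace k N).Opens :=
  ⨆ j : Fin (n + 1), Proj.basicOpen (grading k N) (substitution ℓ (MvPolynomial.X j))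

lemma coe_centerCompl {k : Type u} [Field k] {N n : ℕ} (ℓ : Fin (n + 1) → LinearForm k N) :
    (centerCompl ℓ : Set (projectiveSpace k N)) = (center ℓ)ᶜ := by
  ext x
  simp only [centerCompl, center, substitution_X, nonvanishing, SetLike.mem_coe,
    Set.mem_compl_iff, Set.mem_ofPred_eq, not_forall, not_not]
  exact TopologicalSpace.Opens.mem_iSup

/-- The linear projection `π_W = (ℓ₀ : … : ℓ_n) : ℙ^N ∖ W ⟶ ℙ^n` with center `W`, glued from
its restrictions to the open sets `D₊(ℓ_j)`. -/
def linearProjection {k : Type u} [Field k] {N n : ℕ} (ℓ : Fin (n + 1) → LinearForm k N) :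
    (centerCompl ℓ).toScheme ⟶ projectiveSpace k n :=
  (Scheme.Opens.iSupOpenCover (X := projectiveSpace k N) fun j : Fin (n + 1) ↦
      Proj.basicOpen (grading k N) (substitution ℓ (MvPolynomial.X j))).glueMorphisms
    (fun j ↦ localProjection ℓ (MvPolynomial.X j) (MvPolynomial.isHomogeneous_X k j) one_pos)
    (by
      intro (i : Fin (n + 1)) (j : Fin (n + 1))
      have hX := MvPolynomial.isHomogeneous_X (σ := Fin (n + 1)) k
      have hU : Proj.basicOpen (grading k N) (substitution ℓ (MvPolynomial.X i * MvPolynomial.X j))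
          = Proj.basicOpen (grading k N) (substitution ℓ (MvPolynomial.X i)) ⊓
            Proj.basicOpen (grading k N) (substitution ℓ (MvPolynomial.X j)) := by
        rw [map_mul, Proj.basicOpen_mul]
      let e := (isPullback_opens_inf_le (X := projectiveSpace k N)
        (le_iSup (fun j : Fin (n + 1) ↦
          Proj.basicOpen (grading k N) (substitution ℓ (MvPolynomial.X j))) i)
        (le_iSup (fun j : Fin (n + 1) ↦
          Proj.basicOpen (grading k N) (substitution ℓ (MvPolynomial.X j))) j)).isoPullback
      have h1 : e.hom ≫ pullback.fst _ _ = (projectiveSpace k N).homOfLE inf_le_left :=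
        IsPullback.isoPullback_hom_fst _
      have h2 : e.hom ≫ pullback.snd _ _ = (projectiveSpace k N).homOfLE inf_le_right :=
        IsPullback.isoPullback_hom_snd _
      have key : (projectiveSpace k N).homOfLE inf_le_left ≫
          localProjection ℓ (MvPolynomial.X i) (hX i) one_pos =
          (projectiveSpace k N).homOfLE inf_le_right ≫
          localProjection ℓ (MvPolynomial.X j) (hX j) one_pos := by
        have : IsIso ((projectiveSpace k N).homOfLE hU.le) := by
          rw [← Scheme.isoOfEq_hom _ hU]
          infer_instance
        rw [← cancel_epi ((projectiveSpace k N).homOfLE hU.le)]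
        simp only [← Category.assoc, Scheme.homOfLE_homOfLE]
        rw [homOfLE_localProjection ℓ (hX i) (hX j) one_pos rfl ((hX i).mul (hX j)) two_pos,
          homOfLE_localProjection ℓ (hX j) (hX i) one_pos (mul_comm _ _) ((hX i).mul (hX j))
            two_pos]
      apply (cancel_epi e.hom).mp
      refine (Category.assoc _ _ _).symm.trans (Eq.trans ?_ (Category.assoc _ _ _))
      exact (congrArg (· ≫ localProjection ℓ (MvPolynomial.X i) (hX i) one_pos) h1).trans
        (key.trans (congrArg (· ≫ localProjection ℓ (MvPolynomial.X j) (hX j) one_pos) h2).symm))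

/-- The restriction `f_W = π_W ∘ φ : X ⟶ ℙ^n` to `X` of the linear projection with center `W`, when
`W` is disjoint from the image of `φ : X ⟶ ℙ^N`. -/
def projectFrom {k : Type u} [Field k] {N n : ℕ} (ℓ : Fin (n + 1) → LinearForm k N)
    {X : Scheme.{u}} (φ : X ⟶ projectiveSpace k N) (hφ : Disjoint (Set.range φ) (center ℓ)) :
    X ⟶ projectiveSpace k n :=
  IsOpenImmersion.lift (centerCompl ℓ).ι φ
      (by
        rw [Scheme.Opens.range_ι, coe_centerCompl]
        exact Set.disjoint_left.mp hφ) ≫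
    linearProjection ℓ

/-! ## Smooth projective varieties and very ample divisors -/

/-- `X` is a smooth irreducible projective variety of dimension `n` over `k` (the field `k` is
algebraically closed in all uses). -/
structure IsSmoothProjectiveVariety (k : Type u) [Field k] (n : ℕ) (X : Over (Spec (.of k))) :
    Prop where
  isIntegral : IsIntegral X.left
  smooth : SmoothOfRelativeDimension n X.hom
  projective : ∃ (N : ℕ) (φ : X.left ⟶ projectiveSpace k N),
    IsClosedImmersion φ ∧ φ ≫ structureMap k N = X.hom

/-- A global section of the line bundle `φ^* 𝒪(1)`, written in the trivializations over the open
sets `φ⁻¹ D₊(x_i)` that are given by the sections `x_i`: regular functions `s_i` on `φ⁻¹ D₊(x_i)`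
with `s_i = (x_j / x_i) s_j` on the overlaps. -/
def IsTwistSection {k : Type u} [Field k] {N : ℕ} {X : Scheme.{u}}
    (φ : X ⟶ projectiveSpace k N)
    (s : ∀ i, Γ(X, φ ⁻¹ᵁ nonvanishing (coord k N i))) : Prop :=
  ∀ i j,
    TopCat.Presheaf.restrictOpen (s i)
      (φ ⁻¹ᵁ nonvanishing (coord k N i) ⊓ φ ⁻¹ᵁ nonvanishing (coord k N j))
      inf_le_left =
    TopCat.Presheaf.restrictOpen (φ.app _ (ratio (coord k N j) (coord k N i)))
      (φ ⁻¹ᵁ nonvanishing (coord k N i) ⊓ φ ⁻¹ᵁ nonvanishing (coord k N j))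
      inf_le_left *
    TopCat.Presheaf.restrictOpen (s j)
      (φ ⁻¹ᵁ nonvanishing (coord k N i) ⊓ φ ⁻¹ᵁ nonvanishing (coord k N j))
      inf_le_right

/-- `φ` is the embedding `φ_D : X ↪ ℙ^N` given by (a basis of sections of) a very ample divisor
`D`: it is a closed immersion over `k`, and the linear forms on `ℙ^N` restrict isomorphically onto
the space `H⁰(X, φ^* 𝒪(1)) = H⁰(X, 𝒪_X(D))` of all global sections. -/
structure IsVeryAmpleEmbedding {k : Type u} [Field k] {N : ℕ} {X : Over (Spec (.of k))}
    (φ : X.left ⟶ projectiveSpace k N) : Prop where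
  comp_structureMap : φ ≫ structureMap k N = X.hom
  isClosedImmersion : IsClosedImmersion φ
  complete : ∀ s : (∀ i, Γ(X.left, φ ⁻¹ᵁ nonvanishing (coord k N i))), IsTwistSection φ s →
    ∃! a : LinearForm k N, ∀ i, s i = φ.app _ (ratio a (coord k N i))

/-! ## Galois embeddings -/

/-- The subfield `f^* k(Y)` of the function field `k(X)`, for a dominant morphism `f : X ⟶ Y` of
integral schemes. Such an `f` maps the generic point of `X` to that of `Y`, so `f^* k(Y)` is the
image of the map which `f` induces on the local rings of these points (the closure below only
records that this image is a subfield). -/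
def pulledBackFunctionField {X Y : Scheme.{u}} [IsIntegral X] (f : X ⟶ Y) :
    Subfield X.functionField :=
  Subfield.closure (Set.range (f.stalkMap (genericPoint X)).hom)

/-- `f : X ⟶ Y` is a Galois cover with Galois group isomorphic to `G`: it is dominant and
`k(X) / f^* k(Y)` is a Galois extension whose Galois group is isomorphic to `G`. -/
structure IsGaloisCover {X Y : Scheme.{u}} [IsIntegral X] (f : X ⟶ Y) (G : Type*) [Group G] :
    Prop where
  isDominant : IsDominant f
  isGalois : IsGalois (pulledBackFunctionField f) X.functionField
  galoisGroup : Nonempty (G ≃* (X.functionField ≃ₐ[pulledBackFunctionField f] X.functionField))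

/-- The `n`-dimensional smooth projective variety `X` possesses a Galois embedding with Galois
group `G`: there are an embedding `φ = φ_D : X ↪ ℙ^N` given by a very ample divisor and a linear
subvariety `W = {ℓ₀ = … = ℓ_n = 0}` of `ℙ^N` of dimension `N - n - 1`, disjoint from `φ(X)`, such
that the projection `f_W : X ⟶ ℙ^n` from `W` is a Galois cover with Galois group `G`. -/
def HasGaloisEmbedding {k : Type u} [Field k] {n : ℕ} {X : Over (Spec (.of k))}
    (hX : IsSmoothProjectiveVariety k n X) (G : Type*) [Group G] : Prop :=
  have := hX.isIntegral
  ∃ (N : ℕ) (φ : X.left ⟶ projectiveSpace k N) (ℓ : Fin (n + 1) → LinearForm k N)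
    (hφ : Disjoint (Set.range φ) (center ℓ)),
    IsVeryAmpleEmbedding φ ∧ LinearIndependent k ℓ ∧ IsGaloisCover (projectFrom ℓ φ hφ) G

/-- The `d`-fold self-product `X^d = X ×_k ⋯ ×_k X`. -/
abbrev power {k : Type u} [Field k] (X : Over (Spec (.of k))) (d : ℕ) : Over (Spec (.of k)) :=
  ∏ᶜ fun _ : Fin d ↦ X

/-- The semidirect product `G^d ⋊ S_d`, with `S_d` permuting the factors of `G^d`. -/
abbrev WreathProduct (G : Type*) [Group G] (d : ℕ) : Type _ :=
  (Fin d → G) ⋊[mulAutArrow] Equiv.Perm (Fin d)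

end

end GaloisEmbedding

/-! Let `L = k(C)`, let `f = (ℓ₀ : ℓ₁) : C → ℙ¹` be the given Galois projection and put `t = ℓ₁ /
ℓ₀`, so that `L / k(t)` is Galois with group `G`. The morphism wanted on `C^d` is `C^d → (ℙ¹)^d →
ℙ^d`, where the second map is the quotient by `S_d`: it sends the points `(a_i : b_i)` to the
coefficients of `∏ (a_i + b_i T)`. On function fields this is `K = k(C^d)` over the field generated
by the elementary symmetric functions of the copies `t_1, …, t_d` of `t`.

This morphism is a linear projection of the Segre product of `d` copies of `φ`. The coefficients are
sums of products of linear forms, one on each factor, hence restrictions of linear forms of the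
Segre space (`IsSegrePower.exists_symmetricForms`). They have no common zero: at a point `z` with `S
= {i | ℓ₁(z_i) ≠ 0}`, exactly one summand of the coefficient of index `|S|` survives. The Segre
embedding is again given by a complete linear system, by the Künneth formula for `H⁰`
(`mem_span_of_forall_mem_mul`, `exists_isLinearlyNormal_product`), and induction on `d` gives
`exists_isSegrePower`.

Geometry is carried out inside function fields. A morphism from an integral scheme to projective
space is encoded by homogeneous coordinates at the generic point (`IsCoordinates`), and a complete
linear system by a basis of a space of rational functions (`IsLinearlyNormal`). Since `k` is
algebraically closed, tensor products of coordinate rings are domains, so `L ⊗ ⋯ ⊗ L` embeds in `K`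
with fraction field `K`; this is what `IsFreeCompositum` records.

For the Galois group (`nonempty_mulEquiv_symmetricField`): an automorphism of `K` over the symmetric
functions permutes the roots `t_i` of `∏ (X - t_i)`, hence carries the `i`-th copy of `L` onto
another one, up to an element of `G` by normality. Conversely each permutation and each family in
`G^d` extends to `K` by the universal property of the fraction field of the tensor power. The same
argument with embeddings into an algebraic closure gives normality, and characteristic zero gives
separability. Dominance holds because the elementary symmetric functions of the `t_i` are
algebraically independent. -/

namespace GaloisEmbedding

noncomputable section

attribute [local instance] MvPolynomial.gradedAlgebra

/-! ## Rational functions on integral schemes over a field -/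

section FunctionField

variable {k : Type u} [Field k]

/-- The germ at the generic point of a regular function. -/
def toFunctionField (X : Scheme.{u}) [IsIntegral X] (U : X.Opens) (h : genericPoint X ∈ U) :
    Γ(X, U) →+* X.functionField :=
  (X.presheaf.germ U (genericPoint X) h).hom

lemma toFunctionField_injective (X : Scheme.{u}) [IsIntegral X] (U : X.Opens)
    (h : genericPoint X ∈ U) : Function.Injective (toFunctionField X U h) :=
  germ_injective_of_isIntegral X _ h

lemma toFunctionField_map {X : Scheme.{u}} [IsIntegral X] {U V : X.Opens} (i : V ≤ U)
    (h : genericPoint X ∈ V) (s : Γ(X, U)) :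
    toFunctionField X V h (X.presheaf.map (homOfLE i).op s) = toFunctionField X U (i h) s :=
  X.presheaf.germ_res_apply (homOfLE i) (genericPoint X) h s

lemma genericPoint_mem_of_mem {X : Scheme.{u}} [IsIntegral X] {U : X.Opens} {x : X} (hx : x ∈ U) :
    genericPoint X ∈ U :=
  ((genericPoint_spec X).mem_open_set_iff U.isOpen).mpr ⟨x, trivial, hx⟩

lemma toFunctionField_isFractionRing {X : Scheme.{u}} [IsIntegral X] {U : X.Opens}
    (hU : IsAffineOpen U) (h : genericPoint X ∈ U) :
    let := (toFunctionField X U h).toAlgebra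
    IsFractionRing Γ(X, U) X.functionField :=
  have : Nonempty U := ⟨⟨_, h⟩⟩
  functionField_isFractionRing_of_isAffineOpen X U hU

lemma exists_div_of_isAffineOpen {X : Scheme.{u}} [IsIntegral X] {U : X.Opens}
    (hU : IsAffineOpen U) (h : genericPoint X ∈ U) (x : X.functionField) :
    ∃ a b : Γ(X, U), toFunctionField X U h b ≠ 0 ∧
      x = toFunctionField X U h a / toFunctionField X U h b := by
  let := (toFunctionField X U h).toAlgebra
  have : Nonempty U := ⟨⟨_, h⟩⟩
  have := toFunctionField_isFractionRing hU h
  obtain ⟨a, b, hb, e⟩ := IsFractionRing.div_surjective (A := Γ(X, U)) x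
  refine ⟨a, b, ?_, e.symm⟩
  have := toFunctionField_injective X U h
  exact fun h0 ↦ nonZeroDivisors.ne_zero hb (this (h0.trans (map_zero _).symm))

/-- The constants, as regular functions on an open set. -/
def constants (X : Scheme.{u}) [X.Over (Spec (.of k))] (U : X.Opens) : k →+* Γ(X, U) :=
  ((X ↘ Spec (.of k)).appLE ⊤ U (fun _ _ ↦ trivial)).hom.comp (Scheme.ΓSpecIso (.of k)).inv.hom

lemma map_constants (X : Scheme.{u}) [X.Over (Spec (.of k))] {U V : X.Opens} (i : V ≤ U) (c : k) :
    X.presheaf.map (homOfLE i).op (constants X U c) = constants X V c := by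
  simp only [constants, RingHom.comp_apply]
  erw [← CommRingCat.comp_apply, Scheme.Hom.appLE_map]

lemma appLE_constants {Z X : Scheme.{u}} [Z.Over (Spec (.of k))] [X.Over (Spec (.of k))]
    (p : Z ⟶ X) [p.IsOver (Spec (.of k))] (U : X.Opens) (V : Z.Opens)
    (i : V ≤ p ⁻¹ᵁ U) (c : k) : p.appLE U V i (constants X U c) = constants Z V c := by
  simp only [constants, RingHom.comp_apply]
  erw [← CommRingCat.comp_apply, Scheme.Hom.appLE_comp_appLE]
  have h (g : Z ⟶ Spec (.of k)) (hg : g = Z ↘ Spec (.of k)) (e e') :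
      g.appLE ⊤ V e = (Z ↘ Spec (.of k)).appLE ⊤ V e' := by subst hg; rfl
  rw [h _ (comp_over p _) _ (fun _ _ ↦ trivial)]

instance (X : Scheme.{u}) [X.Over (Spec (.of k))] [IsIntegral X] : Algebra k X.functionField :=
  ((toFunctionField X ⊤ (TopologicalSpace.Opens.mem_top _)).comp (constants X ⊤)).toAlgebra

lemma toFunctionField_constants (X : Scheme.{u}) [X.Over (Spec (.of k))] [IsIntegral X]
    (U : X.Opens) (h : genericPoint X ∈ U) (c : k) :
    toFunctionField X U h (constants X U c) = algebraMap k X.functionField c := by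
  rw [← map_constants X (U := ⊤) le_top, toFunctionField_map]
  rfl

/-- The regular functions on `U`, as rational functions on `X`. -/
def regularFunctions (X : Scheme.{u}) [X.Over (Spec (.of k))] [IsIntegral X] (U : X.Opens)
    (h : genericPoint X ∈ U) : Subalgebra k X.functionField where
  __ := (toFunctionField X U h).range
  algebraMap_mem' c := ⟨constants X U c, toFunctionField_constants X U h c⟩

lemma toFunctionField_mem {X : Scheme.{u}} [X.Over (Spec (.of k))] [IsIntegral X] (U : X.Opens)
    (h : genericPoint X ∈ U) (s) :
    toFunctionField X U h s ∈ regularFunctions (k := k) X U h := ⟨s, rfl⟩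

lemma map_genericPoint {Z X : Scheme.{u}} [IsIntegral Z] [IsIntegral X] (p : Z ⟶ X)
    [IsDominant p] : p (genericPoint Z) = genericPoint X := by
  refine (((genericPoint_spec Z).image p.continuous).eq ?_)
  have := p.denseRange.closure_range
  rw [Set.image_univ, this]
  exact genericPoint_spec X

/-- The map on function fields induced by a dominant morphism. -/
def functionFieldMapRingHom {Z X : Scheme.{u}} [IsIntegral Z] [IsIntegral X] (p : Z ⟶ X)
    [IsDominant p] : X.functionField →+* Z.functionField :=
  (X.presheaf.stalkSpecializes (specializes_of_eq (map_genericPoint p)) ≫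
    p.stalkMap (genericPoint Z)).hom

lemma functionFieldMapRingHom_toFunctionField {Z X : Scheme.{u}} [IsIntegral Z] [IsIntegral X]
    (p : Z ⟶ X) [IsDominant p] (U : X.Opens) (V : Z.Opens) (i : V ≤ p ⁻¹ᵁ U)
    (h : genericPoint X ∈ U) (h' : genericPoint Z ∈ V) (s : Γ(X, U)) :
    functionFieldMapRingHom p (toFunctionField X U h s) =
      toFunctionField Z V h' (p.appLE U V i s) := by
  have h1 := X.presheaf.germ_stalkSpecializes h (specializes_of_eq (map_genericPoint p))
  have h2 := p.germ_stalkMap U (genericPoint Z) (i h')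
  have h3 : X.presheaf.germ U _ h ≫ X.presheaf.stalkSpecializes
      (specializes_of_eq (map_genericPoint p)) ≫ p.stalkMap (genericPoint Z) =
      p.appLE U V i ≫ Z.presheaf.germ V _ h' := by
    rw [reassoc_of% h1, h2, Scheme.Hom.appLE, Category.assoc, TopCat.Presheaf.germ_res]
  exact ConcreteCategory.congr_hom h3 s

/-- The map of `k`-algebras on function fields induced by a dominant morphism over `k`. -/
def functionFieldMap {Z X : Scheme.{u}} [Z.Over (Spec (.of k))] [X.Over (Spec (.of k))]
    [IsIntegral Z] [IsIntegral X] (p : Z ⟶ X) [p.IsOver (Spec (.of k))]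
    [IsDominant p] : X.functionField →ₐ[k] Z.functionField where
  __ := functionFieldMapRingHom p
  commutes' c := by
    have i : (⊤ : Z.Opens) ≤ p ⁻¹ᵁ ⊤ := fun _ _ ↦ trivial
    rw [← toFunctionField_constants X ⊤ (TopologicalSpace.Opens.mem_top _),
      ← toFunctionField_constants Z ⊤ (TopologicalSpace.Opens.mem_top _)]
    exact (functionFieldMapRingHom_toFunctionField p ⊤ ⊤ i (TopologicalSpace.Opens.mem_top _)
        (TopologicalSpace.Opens.mem_top _) _).trans
      (by rw [appLE_constants])

lemma functionFieldMap_toFunctionField {Z X : Scheme.{u}} [Z.Over (Spec (.of k))]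
    [X.Over (Spec (.of k))] [IsIntegral Z] [IsIntegral X] (p : Z ⟶ X) [p.IsOver (Spec (.of k))]
    [IsDominant p] {U : X.Opens} {V : Z.Opens} (i : V ≤ p ⁻¹ᵁ U)
    (h : genericPoint X ∈ U) (h' : genericPoint Z ∈ V) (s : Γ(X, U)) :
    functionFieldMap (k := k) p (toFunctionField X U h s) =
      toFunctionField Z V h' (p.appLE U V i s) :=
  functionFieldMapRingHom_toFunctionField p U V i h h' s

/-- The inclusion of the generic point. -/
def fromSpecFunctionField (X : Scheme.{u}) [IsIntegral X] : Spec X.functionField ⟶ X :=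
  X.fromSpecStalk (genericPoint X)

/-- This allows morphisms from `X` to a separated scheme to be compared at the generic point alone.
-/
instance (X : Scheme.{u}) [IsIntegral X] : IsDominant (fromSpecFunctionField X) where
  denseRange := by
    have : genericPoint X ∈ Set.range (fromSpecFunctionField X) := by
      rw [fromSpecFunctionField, Scheme.range_fromSpecStalk]
      exact specializes_rfl
    refine Dense.mono (Set.singleton_subset_iff.mpr this) ?_
    rw [dense_iff_closure_eq, genericPoint_closure]

lemma fromSpecFunctionField_app (X : Scheme.{u}) [IsIntegral X] (U : X.Opens)
    (h : genericPoint X ∈ U) :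
    (fromSpecFunctionField X).app U = X.presheaf.germ U _ h ≫ (Scheme.ΓSpecIso _).inv ≫
      (Spec _).presheaf.map (homOfLE le_top).op :=
  Scheme.fromSpecStalk_app h

end FunctionField

end

end GaloisEmbedding

namespace GaloisEmbedding

noncomputable section

attribute [local instance] MvPolynomial.gradedAlgebra

/-! ## Points of projective space given by homogeneous coordinates -/

section Coordinates

open MvPolynomial HomogeneousLocalization

variable {k : Type u} [Field k] {N : ℕ}

lemma eval₂_mul_of_isHomogeneous {σ R S : Type*} [CommSemiring R] [CommSemiring S]
    [Fintype σ] (g : R →+* S) (r : S) (y : σ → S) {a : MvPolynomial σ R} {n : ℕ}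
    (ha : a.IsHomogeneous n) :
    eval₂ g (fun i ↦ r * y i) a = r ^ n * eval₂ g y a := by
  rw [eval₂_eq', eval₂_eq', Finset.mul_sum]
  refine Finset.sum_congr rfl fun d hd ↦ ?_
  have hdn : ∑ i, d i = n := by
    have := ha (mem_support_iff.mp hd)
    rw [Finsupp.weight_eq_sum] at this
    simpa using this
  simp_rw [mul_pow]
  rw [Finset.prod_mul_distrib, Finset.prod_pow_eq_pow_sum, hdn]
  ring

lemma aeval_mul_of_isHomogeneous {σ R S : Type*} [CommSemiring R] [CommSemiring S] [Algebra R S]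
    [Fintype σ] (r : S) (y : σ → S) {a : MvPolynomial σ R} {n : ℕ} (ha : a.IsHomogeneous n) :
    aeval (fun i ↦ r * y i) a = r ^ n * aeval y a :=
  eval₂_mul_of_isHomogeneous _ r y ha

/-- The constants in the degree zero localization of the polynomial ring. -/
def constantsAway (f : MvPolynomial (Fin (N + 1)) k) : k →+* Away (grading k N) f :=
  (fromZeroRingHom (grading k N) _).comp (algebraMap k (grading k N 0))

lemma val_constantsAway (f : MvPolynomial (Fin (N + 1)) k) (c : k) :
    (constantsAway f c).val =
      algebraMap (MvPolynomial (Fin (N + 1)) k) (Localization.Away f) (C c) := by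
  rw [constantsAway, RingHom.comp_apply, fromZeroRingHom]
  exact Localization.mk_one_eq_algebraMap _

lemma X_mem_grading (i : Fin (N + 1)) : X i ∈ grading k N 1 := isHomogeneous_X k i

lemma X_mem_grading_smul (i : Fin (N + 1)) : X i ∈ grading k N (1 • 1) := isHomogeneous_X k i

/-- Dehomogenization: in the full localization `X_j = X_i · (X_j / X_i)`, so homogeneity extracts
the unit `X_i ^ n`, which cancels. Hence the chart ring is generated over `k` by the ratios `X_j /
X_i`. -/
lemma away_mk_eq (i : Fin (N + 1)) {a : MvPolynomial (Fin (N + 1)) k} {n : ℕ}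
    (ha : a ∈ grading k N (n • 1)) :
    Away.mk (grading k N) (X_mem_grading i) n a ha =
      eval₂ (constantsAway (X i))
        (fun j ↦ Away.mk (grading k N) (X_mem_grading i) 1 (X j) (X_mem_grading_smul j)) a := by
  set y : Fin (N + 1) → Away (grading k N) (X i : MvPolynomial (Fin (N + 1)) k) := fun j ↦
    Away.mk (grading k N) (X_mem_grading i) 1 (X j) (X_mem_grading_smul j)
  let R := MvPolynomial (Fin (N + 1)) k
  let L := Localization.Away (X i : R)
  set x : L := algebraMap R L (X i) with hx
  have hu : IsUnit x := IsLocalization.Away.algebraMap_isUnit (X i)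
  have hy (j : Fin (N + 1)) : algebraMap R L (X j) = x * algebraMap _ L (y j) := by
    rw [HomogeneousLocalization.algebraMap_apply]
    simp only [y]
    rw [Away.val_mk, Localization.mk_eq_mk', mul_comm]
    simp only [pow_one, hx]
    exact (IsLocalization.mk'_spec L (X j) ⟨X i, _⟩).symm
  have hc : (algebraMap R L).comp C = (algebraMap _ L).comp (constantsAway (X i)) := by
    ext c
    exact (val_constantsAway _ c).symm
  have key : algebraMap R L a = x ^ n * algebraMap _ L (eval₂ (constantsAway (X i)) y a) := by
    have ha' : a.IsHomogeneous n := by simpa using ha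
    rw [eval₂_comp_left, ← hc]
    refine Eq.trans ?_ (eval₂_mul_of_isHomogeneous ((algebraMap R L).comp C) x
      (algebraMap _ L ∘ y) ha')
    conv_lhs => rw [← eval₂_eta a, eval₂_comp_left]
    simp only [Function.comp_def, hy]
  apply val_injective
  refine (hu.pow n).mul_left_cancel ?_
  rw [← HomogeneousLocalization.algebraMap_apply (eval₂ _ _ _), ← key, Away.val_mk,
    Localization.mk_eq_mk', mul_comm, hx, ← map_pow]
  exact IsLocalization.mk'_spec L a ⟨X i ^ n, _⟩

variable {K : Type u} [Field K] [Algebra k K]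

/-- The evaluation `a / f ^ n ↦ a(w) / f(w) ^ n`. -/
def evalAway (w : Fin (N + 1) → K) (f : MvPolynomial (Fin (N + 1)) k) (hf : aeval w f ≠ 0) :
    Away (grading k N) f →+* K :=
  (IsLocalization.Away.lift (S := Localization.Away f) f (g := (aeval w).toRingHom)
    (isUnit_iff_ne_zero.mpr hf)).comp (algebraMap (Away (grading k N) f) (Localization.Away f))

lemma evalAway_mk (w : Fin (N + 1) → K) {f : MvPolynomial (Fin (N + 1)) k} {m : ℕ}
    (hm : f ∈ grading k N m) (hf : aeval w f ≠ 0) {n : ℕ} {a : MvPolynomial (Fin (N + 1)) k}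
    (ha : a ∈ grading k N (n • m)) :
    evalAway w f hf (Away.mk (grading k N) hm n a ha) = aeval w a / aeval w f ^ n := by
  rw [eq_div_iff (pow_ne_zero _ hf), evalAway, RingHom.comp_apply,
    HomogeneousLocalization.algebraMap_apply, Away.val_mk]
  have h1 : (aeval w f) ^ n = IsLocalization.Away.lift (S := Localization.Away f) f
      (g := (aeval w).toRingHom) (isUnit_iff_ne_zero.mpr hf) (algebraMap _ _ (f ^ n)) := by
    rw [IsLocalization.Away.lift_eq]; simp
  have h2 : Localization.mk a (⟨f ^ n, n, rfl⟩ : Submonoid.powers f)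
      * algebraMap _ (Localization.Away f) (f ^ n) =
      algebraMap _ (Localization.Away f) a := by
    rw [Localization.mk_eq_mk']
    exact IsLocalization.mk'_spec (Localization.Away f) a
      (⟨f ^ n, n, rfl⟩ : Submonoid.powers f)
  rw [h1, ← map_mul, h2, IsLocalization.Away.lift_eq]
  rfl

lemma away_mk_X_self (i : Fin (N + 1)) : Away.mk (grading k N) (X_mem_grading i) 1 (X i)
    (X_mem_grading_smul i) = 1 := by
  apply val_injective
  rw [Away.val_mk, HomogeneousLocalization.val_one]
  simp only [pow_one]
  exact Localization.mk_self (⟨X i, _⟩ : Submonoid.powers (X i : MvPolynomial (Fin (N + 1)) k))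

lemma evalAway_eq (i : Fin (N + 1))
    (θ : Away (grading k N) (X i : MvPolynomial (Fin (N + 1)) k) →+* K)
    (hθ : ∀ c, θ (constantsAway _ c) = algebraMap k K c) (w : Fin (N + 1) → K)
    (hw : ∀ j, θ (Away.mk (grading k N) (X_mem_grading i) 1 (X j) (X_mem_grading_smul j)) = w j)
    (hi : aeval w (X i : MvPolynomial (Fin (N + 1)) k) ≠ 0) :
    θ = evalAway w (X i) hi := by
  -- The coordinates are normalized by `X_i / X_i = 1`, so the denominator of `evalAway` disappears.
  have hwi : w i = 1 := by
    rw [← hw i, ← map_one θ]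
    rw [away_mk_X_self]
  ext x
  obtain ⟨n, a, ha, rfl⟩ := x.mk_surjective _ (X_mem_grading i)
  rw [evalAway_mk, aeval_X, hwi, one_pow, div_one, away_mk_eq, eval₂_comp_left]
  have h1 : θ.comp (constantsAway (X i)) = algebraMap k K := RingHom.ext hθ
  have h2 : (θ ∘ fun j ↦ Away.mk (grading k N) (X_mem_grading i) 1 (X j) (X_mem_grading_smul j)) =
      w := funext hw
  rw [h1, h2]
  rfl

lemma evalAway_constantsAway (w : Fin (N + 1) → K) (f : MvPolynomial (Fin (N + 1)) k)
    (hf : aeval w f ≠ 0) (c : k) : evalAway w f hf (constantsAway f c) = algebraMap k K c := by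
  rw [evalAway, RingHom.comp_apply, HomogeneousLocalization.algebraMap_apply, val_constantsAway,
    IsLocalization.Away.lift_eq]
  simp

/-- The `K`-valued point of `ℙ^N` with homogeneous coordinates `w`. -/
def pointOn (w : Fin (N + 1) → K) {f : MvPolynomial (Fin (N + 1)) k} {m : ℕ}
    (hm : f ∈ grading k N m) (h0 : 0 < m) (hf : aeval w f ≠ 0) :
    Spec (.of K) ⟶ projectiveSpace k N :=
  Spec.map (CommRingCat.ofHom (evalAway w f hf)) ≫ Proj.awayι (grading k N) f hm h0

lemma pointOn_mul (w : Fin (N + 1) → K) {f g : MvPolynomial (Fin (N + 1)) k} {m m' : ℕ}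
    (hm : f ∈ grading k N m) (h0 : 0 < m) (hf : aeval w f ≠ 0)
    (hm' : g ∈ grading k N m') {p} (hp : p = f * g) (hg : aeval w p ≠ 0) {l : ℕ} (e : l = m + m')
    (hl : p ∈ grading k N l) (hl0 : 0 < l) :
    pointOn w hl hl0 hg = pointOn w hm h0 hf := by
  subst e
  have h1 := Proj.SpecMap_awayMap_awayι (grading k N) hm h0 hm' hp
  have h2 : (evalAway w p hg).comp (awayMap (grading k N) hm' hp) = evalAway w f hf := by
    ext x
    obtain ⟨n, a, ha, rfl⟩ := x.mk_surjective _ hm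
    subst hp
    rw [RingHom.comp_apply, awayMap_mk, evalAway_mk, evalAway_mk]
    rw [map_mul] at hg
    simp only [map_mul, map_pow, mul_pow]
    have := right_ne_zero_of_mul hg
    field_simp
  rw [pointOn, pointOn, ← h2, CommRingCat.ofHom_comp, Spec.map_comp, Category.assoc, h1]

/-- Both charts are compared with `D₊(fg)`, through which the point factors. -/
lemma pointOn_eq (w : Fin (N + 1) → K) {f g : MvPolynomial (Fin (N + 1)) k} {m m' : ℕ}
    (hm : f ∈ grading k N m) (h0 : 0 < m) (hf : aeval w f ≠ 0)
    (hm' : g ∈ grading k N m') (h0' : 0 < m') (hg : aeval w g ≠ 0) :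
    pointOn w hm h0 hf = pointOn w hm' h0' hg := by
  have h : aeval w (f * g) ≠ 0 := by rw [map_mul]; exact mul_ne_zero hf hg
  rw [← pointOn_mul w hm h0 hf hm' rfl h rfl (SetLike.mul_mem_graded hm hm') (by omega),
    ← pointOn_mul w hm' h0' hg hm (mul_comm _ _) h (add_comm _ _) (SetLike.mul_mem_graded hm hm')
      (by omega)]

end Coordinates

end

end GaloisEmbedding

namespace GaloisEmbedding

noncomputable section

attribute [local instance] MvPolynomial.gradedAlgebra

/-! ## Homogeneous coordinates of morphisms to projective space -/

section IsCoordinates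

open HomogeneousLocalization

variable {k : Type u} [Field k] {N : ℕ}

/-- The morphism `φ` is given by the homogeneous coordinates `w`, which are rational functions. -/
def IsCoordinates {X : Scheme.{u}} [X.Over (Spec (.of k))] [IsIntegral X]
    (φ : X ⟶ projectiveSpace k N) (w : Fin (N + 1) → X.functionField) : Prop :=
  ∃ (i : Fin (N + 1)) (hi : MvPolynomial.aeval w (MvPolynomial.X i : MvPolynomial (Fin (N + 1)) k) ≠
    0),
    fromSpecFunctionField X ≫ φ = pointOn w (X_mem_grading i) one_pos hi

variable {X : Scheme.{u}} [X.Over (Spec (.of k))] [IsIntegral X]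
    {φ : X ⟶ projectiveSpace k N} {w : Fin (N + 1) → X.functionField}

lemma IsCoordinates.eq_pointOn (h : IsCoordinates φ w) {f : MvPolynomial (Fin (N + 1)) k} {m : ℕ}
    (hm : f ∈ grading k N m) (h0 : 0 < m) (hf : MvPolynomial.aeval w f ≠ 0) :
    fromSpecFunctionField X ≫ φ = pointOn w hm h0 hf := by
  obtain ⟨i, hi, e⟩ := h
  rw [e, pointOn_eq]

/-- The function `a / b ^ n` on `D₊(b)`. -/
def powRatio {a b : MvPolynomial (Fin (N + 1)) k} {m : ℕ} (hb : b ∈ grading k N m) (n : ℕ)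
    (ha : a ∈ grading k N (n • m)) : Γ(projectiveSpace k N, Proj.basicOpen (grading k N) b) :=
  (Proj.awayToSection (grading k N) b).hom (Away.mk (grading k N) hb n a ha)

lemma fromSpecFunctionField_appLE (X : Scheme.{u}) [IsIntegral X] (U : X.Opens)
    (h : genericPoint X ∈ U) (hle : ⊤ ≤ fromSpecFunctionField X ⁻¹ᵁ U) :
    (fromSpecFunctionField X).appLE U ⊤ hle =
      X.presheaf.germ U _ h ≫ (Scheme.ΓSpecIso _).inv := by
  rw [Scheme.Hom.appLE, fromSpecFunctionField_app X _ h, Category.assoc, Category.assoc,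
    ← Functor.map_comp]
  congr 1

lemma fromSpecFunctionField_apply {X : Scheme.{u}} [IsIntegral X] (x : Spec X.functionField) :
    fromSpecFunctionField X x = genericPoint X := by
  have hx : x = IsLocalRing.closedPoint X.functionField :=
    Subsingleton.elim (α := PrimeSpectrum X.functionField) _ _
  rw [hx]
  exact Scheme.fromSpecStalk_closedPoint

lemma mem_basicOpen_awayι {b : MvPolynomial (Fin (N + 1)) k} {m : ℕ} (hb : b ∈ grading k N m)
    (h0 : 0 < m) (x) : Proj.awayι (grading k N) b hb h0 x ∈ Proj.basicOpen (grading k N) b := by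
  have : Proj.awayι (grading k N) b hb h0 x ∈ (Proj.awayι (grading k N) b hb h0).opensRange :=
    ⟨_, rfl⟩
  rwa [Proj.opensRange_awayι] at this

/-- Checked after pulling back along the isomorphism from `D₊(b)` to its affine model, where `awayι`
becomes the inclusion of `D₊(b)`. -/
lemma awayToSection_awayι_appLE {b : MvPolynomial (Fin (N + 1)) k} {m : ℕ}
    (hb : b ∈ grading k N m) (h0 : 0 < m)
    (hle : ⊤ ≤ Proj.awayι (grading k N) b hb h0 ⁻¹ᵁ Proj.basicOpen (grading k N) b) :
    Proj.awayToSection (grading k N) b ≫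
      (Proj.awayι (grading k N) b hb h0).appLE (Proj.basicOpen (grading k N) b) ⊤ hle =
      (Scheme.ΓSpecIso _).inv := by
  have h1 := Proj.basicOpenToSpec_app_top (grading k N) b
  have : IsIso (Proj.basicOpenToSpec (grading k N) b) := by
    rw [← Proj.basicOpenIsoSpec_hom (grading k N) b hb h0]; infer_instance
  have h3 : Proj.basicOpenToSpec (grading k N) b ≫ Proj.awayι (grading k N) b hb h0 =
      (Proj.basicOpen (grading k N) b).ι := by
    rw [← Proj.basicOpenIsoSpec_inv_ι (grading k N) b hb h0,
      ← Proj.basicOpenIsoSpec_hom (grading k N) b hb h0, Iso.hom_inv_id_assoc]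
  have hle' : (⊤ : (Proj.basicOpen (grading k N) b).toScheme.Opens) ≤
      Proj.basicOpenToSpec (grading k N) b ⁻¹ᵁ ⊤ := fun _ _ ↦ trivial
  have h4 (g) (hg : g = (Proj.basicOpen (grading k N) b).ι) (hle'') :
      g.appLE (Proj.basicOpen (grading k N) b) ⊤ hle'' =
        (Proj.basicOpen (grading k N) b).topIso.inv := by
    subst hg
    rw [Scheme.Opens.topIso_inv]
    rw [Scheme.Hom.appLE, Scheme.Opens.ι_app]
    exact (Functor.map_comp _ _ _).symm
  have h5 := Scheme.Hom.appLE_comp_appLE (Proj.basicOpenToSpec (grading k N) b)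
    (Proj.awayι (grading k N) b hb h0) (Proj.basicOpen (grading k N) b) ⊤ ⊤ hle hle'
  rw [h4 _ h3] at h5
  have h6 : (Proj.basicOpenToSpec (grading k N) b).appLE ⊤ ⊤ hle' =
      (Proj.basicOpenToSpec (grading k N) b).app ⊤ := Scheme.Hom.appLE_eq_app _
  rw [h6] at h5
  rw [← cancel_mono ((Proj.basicOpenToSpec (grading k N) b).app ⊤), Category.assoc]
  refine (congrArg (_ ≫ ·) h5).trans ?_
  rw [h1]
  exact (Iso.inv_hom_id_assoc _ _).symm

/-- The bridge from sections to fields: the composite of the generic point with `φ` is computed on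
sections once through the germ on `X` and once through the chart `D₊(b)`. -/
lemma IsCoordinates.toFunctionField_app (h : IsCoordinates φ w)
    {b : MvPolynomial (Fin (N + 1)) k} {m : ℕ} (hb : b ∈ grading k N m) (h0 : 0 < m)
    (hw : MvPolynomial.aeval w b ≠ 0)
    (hη : genericPoint X ∈ φ ⁻¹ᵁ Proj.basicOpen (grading k N) b)
    (y : Away (grading k N) b) :
    toFunctionField X _ hη (φ.app _ (Proj.awayToSection (grading k N) b y)) =
      evalAway w b hw y := by
  have e := h.eq_pointOn hb h0 hw
  have hle : (⊤ : (Spec X.functionField).Opens) ≤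
      (fromSpecFunctionField X ≫ φ) ⁻¹ᵁ Proj.basicOpen (grading k N) b := by
    rw [e]
    exact fun x _ ↦ mem_basicOpen_awayι hb h0 _
  have e1 : (fromSpecFunctionField X ≫ φ).appLE (Proj.basicOpen (grading k N) b) ⊤ hle =
      φ.app (Proj.basicOpen (grading k N) b) ≫ X.presheaf.germ _ _ hη ≫
        (Scheme.ΓSpecIso _).inv := by
    have hle' : (⊤ : (Spec X.functionField).Opens) ≤
      fromSpecFunctionField X ⁻¹ᵁ φ ⁻¹ᵁ Proj.basicOpen (grading k N) b := hle
    rw [Scheme.Hom.comp_appLE]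
    exact congrArg (_ ≫ ·) (fromSpecFunctionField_appLE X _ hη hle')
  have e2 : Proj.awayToSection (grading k N) b ≫
      (fromSpecFunctionField X ≫ φ).appLE (Proj.basicOpen (grading k N) b) ⊤ hle =
      CommRingCat.ofHom (evalAway w b hw) ≫ (Scheme.ΓSpecIso _).inv := by
    have hle' : (⊤ : (Spec (CommRingCat.of (Away (grading k N) b))).Opens) ≤
      Proj.awayι (grading k N) b hb h0 ⁻¹ᵁ Proj.basicOpen (grading k N) b :=
      fun x _ ↦ mem_basicOpen_awayι hb h0 x
    have hle3 : (⊤ : (Spec (CommRingCat.of X.functionField)).Opens) ≤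
      Spec.map (CommRingCat.ofHom (evalAway w b hw)) ⁻¹ᵁ ⊤ := fun _ _ ↦ trivial
    have h3 (g) (hg : g = pointOn w hb h0 hw) (hle'') :
      Scheme.Hom.appLE g (Proj.basicOpen (grading k N) b) ⊤ hle'' =
        (Proj.awayι (grading k N) b hb h0).appLE (Proj.basicOpen (grading k N) b) ⊤ hle' ≫
        (Spec.map (CommRingCat.ofHom (evalAway w b hw))).appLE ⊤ ⊤ hle3 := by
      subst hg
      rw [Scheme.Hom.appLE_comp_appLE]; rfl
    rw [h3 _ e, ← Category.assoc, awayToSection_awayι_appLE]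
    have h4 : (Spec.map (CommRingCat.ofHom (evalAway w b hw))).appLE ⊤ ⊤ hle3 =
      (Spec.map (CommRingCat.ofHom (evalAway w b hw))).appTop := Scheme.Hom.appLE_eq_app _
    rw [h4, Scheme.ΓSpecIso_inv_naturality]
  rw [e1, ← Category.assoc, ← Category.assoc] at e2
  replace e2 := (cancel_mono (Scheme.ΓSpecIso X.functionField).inv).mp e2
  exact ConcreteCategory.congr_hom e2 y

/-- A check on stalks: at a point of `D₊(b)` the germ of `a / b ^ n` is a unit exactly when `a` lies
outside the prime of that point. -/
lemma basicOpen_powRatio {a b : MvPolynomial (Fin (N + 1)) k} {m : ℕ} (hb : b ∈ grading k N m)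
    (n : ℕ) (ha : a ∈ grading k N (n • m)) :
    (projectiveSpace k N).basicOpen (powRatio hb n ha) =
      Proj.basicOpen (grading k N) b ⊓ Proj.basicOpen (grading k N) a := by
  ext x
  by_cases hx : x ∈ Proj.basicOpen (grading k N) b
  swap
  · refine ⟨fun h ↦ (hx (Scheme.basicOpen_le _ _ h)).elim, fun h ↦ (hx h.1).elim⟩
  have h1 := ProjectiveSpectrum.Proj.awayToSection_germ (grading k N) b x hx
  refine (Scheme.mem_basicOpen _ _ x hx).trans ?_
  let y : ProjectiveSpectrum (grading k N) := x
  have hx' : Submonoid.powers b ≤ y.asHomogeneousIdeal.toIdeal.primeCompl :=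
    Submonoid.powers_le.mpr hx
  let z : AtPrime (grading k N) y.asHomogeneousIdeal.toIdeal := mapId (grading k N) hx'
    (Away.mk (grading k N) hb n a ha)
  let e := (Proj.stalkIso (grading k N) x).commRingCatIsoToRingEquiv
  have h2 : (projectiveSpace k N).presheaf.germ _ x hx (powRatio hb n ha) = e.symm z :=
    ConcreteCategory.congr_hom h1 _
  have h4 : z.val = IsLocalization.mk' (Localization.AtPrime y.asHomogeneousIdeal.toIdeal) a
      (⟨b ^ n, hx' ⟨n, rfl⟩⟩ : y.asHomogeneousIdeal.toIdeal.primeCompl) := by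
    change (mapId (grading k N) hx' (HomogeneousLocalization.mk _)).val = _
    erw [map_mk]
    rw [val_mk, Localization.mk_eq_mk']
    rfl
  rw [h2, MulEquiv.isUnit_map e.symm, ← isUnit_iff_isUnit_val, h4,
    IsLocalization.AtPrime.isUnit_mk'_iff]
  exact ⟨fun h ↦ ⟨hx, h⟩, fun h ↦ h.2⟩

lemma IsCoordinates.mem_of_aeval_ne_zero (h : IsCoordinates φ w)
    {f : MvPolynomial (Fin (N + 1)) k} {m : ℕ} (hf : f ∈ grading k N m) (h0 : 0 < m)
    (hw : MvPolynomial.aeval w f ≠ 0) :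
    genericPoint X ∈ φ ⁻¹ᵁ Proj.basicOpen (grading k N) f := by
  let x : Spec X.functionField := IsLocalRing.closedPoint X.functionField
  change φ (genericPoint X) ∈ Proj.basicOpen (grading k N) f
  rw [← fromSpecFunctionField_apply x, ← Scheme.Hom.comp_apply, h.eq_pointOn hf h0 hw, pointOn,
      Scheme.Hom.comp_apply]
  exact mem_basicOpen_awayι hf h0 _

lemma IsCoordinates.mem_iff (h : IsCoordinates φ w)
    {f : MvPolynomial (Fin (N + 1)) k} {m : ℕ} (hf : f ∈ grading k N m) (h0 : 0 < m) :
    genericPoint X ∈ φ ⁻¹ᵁ Proj.basicOpen (grading k N) f ↔ MvPolynomial.aeval w f ≠ 0 := by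
  refine ⟨fun hη ↦ ?_, h.mem_of_aeval_ne_zero hf h0⟩
  obtain ⟨i, hi, e⟩ := id h
  have hηi := h.mem_of_aeval_ne_zero (X_mem_grading i) one_pos hi
  have ha : f ∈ grading k N (m • 1) := by simpa using hf
  -- If the generic point maps into `D₊(f)`, then `f / X_i ^ m` pulls back to a unit there, while
  -- its value is `f(w) / w_i ^ m`.
  have h1 : φ (genericPoint X) ∈ (projectiveSpace k N).basicOpen
      (powRatio (X_mem_grading i) m ha) := by
    rw [basicOpen_powRatio]
    exact ⟨hηi, hη⟩
  have h2 : genericPoint X ∈ X.basicOpen (φ.app _ (powRatio (X_mem_grading i) m ha)) := by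
    rw [← Scheme.preimage_basicOpen]
    exact h1
  rw [Scheme.mem_basicOpen _ _ _ hηi] at h2
  have h3 := h.toFunctionField_app (X_mem_grading i) one_pos hi hηi
    (Away.mk (grading k N) (X_mem_grading i) m f ha)
  rw [evalAway_mk] at h3
  intro h0
  rw [h0, zero_div] at h3
  exact h2.ne_zero h3

lemma awayι_structureMap {f : MvPolynomial (Fin (N + 1)) k} {m : ℕ} (hf : f ∈ grading k N m)
    (h0 : 0 < m) : Proj.awayι (grading k N) f hf h0 ≫ structureMap k N =
      Spec.map (CommRingCat.ofHom (constantsAway f)) := by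
  rw [structureMap, Proj.awayι_toSpecZero_assoc, ← Spec.map_comp]
  rfl

lemma fromSpecFunctionField_over (X : Scheme.{u}) [X.Over (Spec (.of k))] [IsIntegral X] :
    fromSpecFunctionField X ≫ (X ↘ Spec (.of k)) =
      Spec.map (CommRingCat.ofHom (algebraMap k X.functionField)) := by
  apply ext_of_isAffine
  rw [Scheme.Hom.comp_appTop]
  have h1 := Scheme.fromSpecStalk_appTop (x := genericPoint X)
  have h2 := Scheme.ΓSpecIso_naturality (CommRingCat.ofHom (algebraMap k X.functionField))
  rw [← Iso.eq_comp_inv] at h2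
  rw [h2]
  refine (congrArg (_ ≫ ·) h1).trans ?_
  have h3 : CommRingCat.ofHom (algebraMap k X.functionField) = (Scheme.ΓSpecIso (.of k)).inv ≫
      (X ↘ Spec (.of k)).appTop ≫
        X.presheaf.germ ⊤ (genericPoint X) (TopologicalSpace.Opens.mem_top _) := by
    have h4 : (X ↘ Spec (.of k)).appTop = (X ↘ Spec (.of k)).appLE ⊤ ⊤ (fun _ _ ↦ trivial) :=
      Scheme.Hom.app_eq_appLE _
    rw [h4]
    rfl
  rw [h3]
  simp

lemma IsCoordinates.comp_structureMap (h : IsCoordinates φ w) :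
    φ ≫ structureMap k N = X ↘ Spec (.of k) := by
  refine ext_of_isDominant (fromSpecFunctionField X) ?_
  obtain ⟨i, hi, e⟩ := h
  rw [← Category.assoc, e, pointOn, Category.assoc, awayι_structureMap, ← Spec.map_comp,
    fromSpecFunctionField_over]
  congr 1
  ext c
  exact evalAway_constantsAway w _ hi c

lemma exists_mem_basicOpen_X (x : projectiveSpace k N) :
    ∃ i, x ∈ Proj.basicOpen (grading k N) (MvPolynomial.X i) := by
  have h : ⨆ i, Proj.basicOpen (grading k N) (MvPolynomial.X i) = ⊤ := by
    refine Proj.iSup_basicOpen_eq_top' (grading k N) _ (fun i ↦ ⟨1, X_mem_grading i⟩) ?_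
    rw [eq_top_iff]
    intro p _
    induction p using MvPolynomial.induction_on with
    | C c =>
      let c' : grading k N 0 := ⟨MvPolynomial.C c, MvPolynomial.isHomogeneous_C _ _⟩
      exact Subalgebra.algebraMap_mem (Algebra.adjoin (grading k N 0) _) c'
    | add p q hp hq => exact add_mem (hp trivial) (hq trivial)
    | mul_X p i hp => exact mul_mem (hp trivial) (Algebra.subset_adjoin ⟨i, rfl⟩)
  have hx : x ∈ (⊤ : (projectiveSpace k N).Opens) := trivial
  rw [← h] at hx
  exact TopologicalSpace.Opens.mem_iSup.mp hx

lemma exists_isCoordinates (hφ : φ ≫ structureMap k N = X ↘ Spec (.of k)) :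
    ∃ w, IsCoordinates φ w := by
  obtain ⟨i, hi⟩ := exists_mem_basicOpen_X (φ (genericPoint X))
  have hr : Set.range (fromSpecFunctionField X ≫ φ) ⊆
      Set.range (Proj.awayι (grading k N) _ (X_mem_grading i) one_pos) := by
    rintro _ ⟨x, rfl⟩
    have h2 := Proj.opensRange_awayι (grading k N) _ (X_mem_grading (k := k) i) one_pos
    rw [← h2] at hi
    rw [Scheme.Hom.comp_apply, fromSpecFunctionField_apply x]
    exact hi
  let g := IsOpenImmersion.lift (Proj.awayι (grading k N) _ (X_mem_grading i) one_pos)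
    (fromSpecFunctionField X ≫ φ) hr
  have hg : g ≫ Proj.awayι (grading k N) _ (X_mem_grading i) one_pos =
    fromSpecFunctionField X ≫ φ := IsOpenImmersion.lift_fac _ _ _
  let θ := (Spec.preimage g).hom
  have hθ : Spec.map (CommRingCat.ofHom θ) = g := Spec.map_preimage g
  have hc (c : k) : θ (constantsAway _ c) = algebraMap k X.functionField c := by
    have : Spec.map (CommRingCat.ofHom (θ.comp (constantsAway _))) =
        Spec.map (CommRingCat.ofHom (algebraMap k X.functionField)) := by
      rw [← fromSpecFunctionField_over, ← hφ, ← Category.assoc, ← hg, Category.assoc,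
        awayι_structureMap, ← hθ, ← Spec.map_comp]
      rfl
    exact ConcreteCategory.congr_hom (Spec.map_injective this) c
  -- Coordinates are read off in a chart containing the image of the generic point, as the values of
  -- the ratios `X_j / X_i`.
  let w : Fin (N + 1) → X.functionField := fun j ↦
    θ (Away.mk (grading k N) (X_mem_grading i) 1 (MvPolynomial.X j) (X_mem_grading_smul j))
  have hwi : MvPolynomial.aeval w (MvPolynomial.X i : MvPolynomial (Fin (N + 1)) k) = 1 := by
    rw [MvPolynomial.aeval_X, ← map_one θ, ← away_mk_X_self]
  have hwi' : MvPolynomial.aeval w (MvPolynomial.X i : MvPolynomial (Fin (N + 1)) k) ≠ 0 := by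
    rw [hwi]; exact one_ne_zero
  refine ⟨w, i, hwi', ?_⟩
  rw [← hg, pointOn, ← evalAway_eq i θ hc w (fun _ ↦ rfl), hθ]

end IsCoordinates

end

end GaloisEmbedding

namespace GaloisEmbedding

noncomputable section

attribute [local instance] MvPolynomial.gradedAlgebra

/-! ## Morphisms to projective space through their homogeneous coordinates -/

section Morphisms

open HomogeneousLocalization

variable {k : Type u} [Field k] {N : ℕ}

lemma evalAway_mk_X {K : Type u} [Field K] [Algebra k K] (w : Fin (N + 1) → K) (i : Fin (N + 1))
    (hi : MvPolynomial.aeval w (MvPolynomial.X i : MvPolynomial (Fin (N + 1)) k) ≠ 0) {n : ℕ}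
    {a : MvPolynomial (Fin (N + 1)) k} (ha : a ∈ grading k N (n • 1)) :
    evalAway w _ hi (Away.mk (grading k N) (X_mem_grading i) n a ha) =
      MvPolynomial.aeval (fun j ↦ w j / w i) a := by
  have ha' : a.IsHomogeneous n := by simpa using ha
  have h := aeval_mul_of_isHomogeneous (w i)⁻¹ w ha'
  have h' : (fun j ↦ w j / w i) = fun j ↦ (w i)⁻¹ * w j := by
    ext j; rw [div_eq_mul_inv, mul_comm]
  rw [evalAway_mk, h', h, MvPolynomial.aeval_X, div_eq_mul_inv, mul_comm, inv_pow]

lemma mem_range_evalAway {K : Type u} [Field K] [Algebra k K] (w : Fin (N + 1) → K)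
    (i : Fin (N + 1))
    (hi : MvPolynomial.aeval w (MvPolynomial.X i : MvPolynomial (Fin (N + 1)) k) ≠ 0) {x : K} :
    (∃ y, evalAway w _ hi y = x) ↔ x ∈ Algebra.adjoin k (Set.range fun j ↦ w j / w i) := by
  constructor
  · rintro ⟨y, rfl⟩
    obtain ⟨n, a, ha, rfl⟩ := y.mk_surjective _ (X_mem_grading i)
    rw [evalAway_mk_X, Algebra.adjoin_range_eq_range_aeval]
    exact ⟨a, rfl⟩
  · intro hx
    induction hx using Algebra.adjoin_induction with
    | mem x hx =>
      obtain ⟨j, rfl⟩ := hx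
      refine ⟨Away.mk (grading k N) (X_mem_grading i) 1 (MvPolynomial.X j) (X_mem_grading_smul j),
          ?_⟩
      rw [evalAway_mk_X, MvPolynomial.aeval_X]
    | algebraMap r => exact ⟨_, evalAway_constantsAway w _ hi r⟩
    | add x y _ _ hx hy =>
      obtain ⟨a, rfl⟩ := hx
      obtain ⟨b, rfl⟩ := hy
      exact ⟨a + b, map_add _ _ _⟩
    | mul x y _ _ hx hy =>
      obtain ⟨a, rfl⟩ := hx
      obtain ⟨b, rfl⟩ := hy
      exact ⟨a * b, map_mul _ _ _⟩

lemma basicOpen_app_powRatio {X : Scheme.{u}} (φ : X ⟶ projectiveSpace k N)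
    {a b : MvPolynomial (Fin (N + 1)) k} {m : ℕ} (hb : b ∈ grading k N m)
    (n : ℕ) (ha : a ∈ grading k N (n • m)) :
    X.basicOpen (φ.app _ (powRatio hb n ha)) =
      φ ⁻¹ᵁ Proj.basicOpen (grading k N) b ⊓ φ ⁻¹ᵁ Proj.basicOpen (grading k N) a := by
  rw [← Scheme.preimage_basicOpen, basicOpen_powRatio]
  rfl

variable {X : Scheme.{u}} [X.Over (Spec (.of k))] [IsIntegral X]
    {φ : X ⟶ projectiveSpace k N} {w : Fin (N + 1) → X.functionField}

lemma IsCoordinates.toFunctionField_powRatio (h : IsCoordinates φ w)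
    {a b : MvPolynomial (Fin (N + 1)) k} {m : ℕ} (hb : b ∈ grading k N m) (h0 : 0 < m) (n : ℕ)
    (ha : a ∈ grading k N (n • m))
    (hη : genericPoint X ∈ φ ⁻¹ᵁ Proj.basicOpen (grading k N) b) :
    toFunctionField X _ hη (φ.app _ (powRatio hb n ha)) =
      MvPolynomial.aeval w a / MvPolynomial.aeval w b ^ n :=
  (h.toFunctionField_app hb h0 ((h.mem_iff hb h0).mp hη) hη _).trans
    (evalAway_mk w hb ((h.mem_iff hb h0).mp hη) ha)

lemma IsCoordinates.mem_X_iff (h : IsCoordinates φ w) (i : Fin (N + 1)) :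
    genericPoint X ∈ φ ⁻¹ᵁ Proj.basicOpen (grading k N) (MvPolynomial.X i) ↔ w i ≠ 0 := by
  rw [h.mem_iff (X_mem_grading i) one_pos, MvPolynomial.aeval_X]

/-- A family of rational functions whose quotients are regular on the members of a suitable open
cover defines a morphism to projective space. -/
lemma exists_isCoordinates_of_isOpenCover (w : Fin (N + 1) → X.functionField) (hw : ∀ i, w i ≠ 0)
    (U : Fin (N + 1) → X.Opens) (hη : ∀ i, genericPoint X ∈ U i)
    (hU : TopologicalSpace.IsOpenCover U)
    (h : ∀ i j, ∃ s : Γ(X, U i), toFunctionField X (U i) (hη i) s = w j / w i ∧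
      X.basicOpen s = U i ⊓ U j) :
    ∃ φ : X ⟶ projectiveSpace k N, IsCoordinates φ w ∧
      ∀ i, φ ⁻¹ᵁ Proj.basicOpen (grading k N) (MvPolynomial.X i) = U i := by
  have hi (i) : MvPolynomial.aeval w (MvPolynomial.X i : MvPolynomial (Fin (N + 1)) k) ≠ 0 := by
    rw [MvPolynomial.aeval_X]; exact hw i
  -- Evaluation at `w` lands in the functions regular on `U i`, since its image is generated over
  -- `k` by the `w j / w i`; injectivity of germs then lifts it to a map into `Γ(X, U i)`.
  have hg (i) : ∃ g : Away (grading k N) (MvPolynomial.X i) →+* Γ(X, U i),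
      (toFunctionField X (U i) (hη i)).comp g = evalAway w _ (hi i) := by
    let r := (toFunctionField X (U i) (hη i)).rangeRestrict
    have hr : Function.Bijective r := ⟨fun a b e ↦ toFunctionField_injective X (U i) (hη i)
      (congrArg Subtype.val e), RingHom.rangeRestrict_surjective _⟩
    let e := RingEquiv.ofBijective r hr
    have hm (y) : evalAway w _ (hi i) y ∈ (toFunctionField X (U i) (hη i)).range := by
      have h1 := (mem_range_evalAway w i (hi i)).mp ⟨y, rfl⟩
      have h2 : Algebra.adjoin k (Set.range fun j ↦ w j / w i) ≤
          regularFunctions X (U i) (hη i) := by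
        refine Algebra.adjoin_le ?_
        rintro _ ⟨j, rfl⟩
        obtain ⟨s, hs, -⟩ := h i j
        exact ⟨s, hs⟩
      exact h2 h1
    refine ⟨e.symm.toRingHom.comp ((evalAway w _ (hi i)).codRestrict _ hm), ?_⟩
    ext y
    have := e.apply_symm_apply ((evalAway w _ (hi i)).codRestrict _ hm y)
    exact congrArg Subtype.val this
  choose g hg using hg
  let χ (i) : (U i).toScheme ⟶ projectiveSpace k N := (U i).toSpecΓ ≫
    Spec.map (CommRingCat.ofHom (g i)) ≫ Proj.awayι (grading k N) _ (X_mem_grading i) one_pos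
  let ξ (i) : Spec X.functionField ⟶ (U i).toScheme :=
    (U i).fromSpecStalkOfMem (genericPoint X) (hη i)
  have hξ (i) : ξ i ≫ (U i).ι = fromSpecFunctionField X := Scheme.Opens.fromSpecStalkOfMem_ι _ _ _
  have hξχ (i) : ξ i ≫ χ i = pointOn w (X_mem_grading i) one_pos (hi i) := by
    have h1 := Scheme.Opens.fromSpecStalkOfMem_toSpecΓ (U i) (genericPoint X) (hη i)
    simp only [χ, ξ]
    rw [reassoc_of% h1, ← Spec.map_comp_assoc, pointOn, ← hg i]
    rfl
  let 𝒰 := X.openCoverOfIsOpenCover U hU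
  -- The overlap is reduced and contains the generic point as a dominant point, where both chart
  -- maps are the point with coordinates `w`.
  have hov (i j : Fin (N + 1)) : pullback.fst (U i).ι (U j).ι ≫ χ i =
      pullback.snd (U i).ι (U j).ι ≫ χ j := by
    let ζ : Spec X.functionField ⟶ pullback (U i).ι (U j).ι :=
      pullback.lift (ξ i) (ξ j) ((hξ i).trans (hξ j).symm)
    have hζ : ζ ≫ pullback.fst (U i).ι (U j).ι ≫ (U i).ι = fromSpecFunctionField X := by
      rw [pullback.lift_fst_assoc, hξ]
    have : IsDominant (ζ ≫ pullback.fst (U i).ι (U j).ι ≫ (U i).ι) := by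
      rw [hζ]; infer_instance
    have : IsDominant ζ := IsDominant.of_comp_of_isOpenImmersion _
      (pullback.fst (U i).ι (U j).ι ≫ (U i).ι)
    have : IsReduced (pullback (U i).ι (U j).ι) :=
      isReduced_of_isOpenImmersion (pullback.fst (U i).ι (U j).ι ≫ (U i).ι)
    refine ext_of_isDominant ζ ?_
    rw [pullback.lift_fst_assoc, pullback.lift_snd_assoc, hξχ, hξχ]
    exact pointOn_eq ..
  let φ : X ⟶ projectiveSpace k N := 𝒰.glueMorphisms χ hov
  have hφ (i) : (U i).ι ≫ φ = χ i := 𝒰.ι_glueMorphisms χ hov i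
  have hcoord : IsCoordinates φ w := by
    refine ⟨0, hi 0, ?_⟩
    rw [← hξ 0, Category.assoc, hφ, hξχ]
  refine ⟨φ, hcoord, fun j ↦ ?_⟩
  have hle (i) : U i ≤ φ ⁻¹ᵁ Proj.basicOpen (grading k N) (MvPolynomial.X i) := by
    intro x hx
    have : φ x = χ i ⟨x, hx⟩ := by
      rw [← hφ]; rfl
    change φ x ∈ Proj.basicOpen (grading k N) (MvPolynomial.X i)
    rw [this]
    simp only [χ]
    exact mem_basicOpen_awayι _ one_pos _
  -- A point over `D₊(X_j)` lying in `U i` makes the pullback `s` of `X_j / X_i` invertible, and the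
  -- locus where `s` is invertible is `U i ⊓ U j`.
  refine le_antisymm (fun x hx ↦ ?_) (hle j)
  obtain ⟨i, hxi⟩ := hU.exists_mem x
  obtain ⟨s, hs, hs'⟩ := h i j
  have h1 : X.presheaf.map (homOfLE (hle i)).op
      (φ.app _ (powRatio (X_mem_grading i) 1 (X_mem_grading_smul j))) = s := by
    apply toFunctionField_injective X (U i) (hη i)
    rw [toFunctionField_map, hcoord.toFunctionField_powRatio _ one_pos, hs]
    simp
  have h2 : x ∈ X.basicOpen s := by
    rw [← h1, Scheme.basicOpen_res, basicOpen_app_powRatio]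
    exact ⟨hxi, hle i hxi, hx⟩
  rw [hs'] at h2
  exact h2.2

/-- The claim is local on the target. Over each standard chart source and target are affine, so it
amounts to surjectivity on functions, i.e. to `hreg`. -/
lemma IsCoordinates.isClosedImmersion (h : IsCoordinates φ w) (hw : ∀ i, w i ≠ 0)
    (haff : ∀ i, IsAffineOpen (φ ⁻¹ᵁ Proj.basicOpen (grading k N) (MvPolynomial.X i)))
    (hreg : ∀ i, ∀ x ∈ regularFunctions (k := k) X
      (φ ⁻¹ᵁ Proj.basicOpen (grading k N) (MvPolynomial.X i)) ((h.mem_X_iff i).mpr (hw i)),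
      x ∈ Algebra.adjoin k (Set.range fun j ↦ w j / w i)) : IsClosedImmersion φ := by
  have hP : TopologicalSpace.IsOpenCover fun i : Fin (N + 1) ↦
      Proj.basicOpen (grading k N) (MvPolynomial.X i) := by
    rw [TopologicalSpace.IsOpenCover, eq_top_iff]
    intro x _
    exact TopologicalSpace.Opens.mem_iSup.mpr (exists_mem_basicOpen_X x)
  rw [IsZariskiLocalAtTarget.iff_of_iSup_eq_top (P := @IsClosedImmersion) _ hP]
  intro i
  have : IsAffine (φ ⁻¹ᵁ Proj.basicOpen (grading k N) (MvPolynomial.X i)).toScheme := haff i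
  have : IsAffine (Proj.basicOpen (grading k N) (MvPolynomial.X i)).toScheme :=
    Proj.isAffineOpen_basicOpen (grading k N) _ (X_mem_grading i) one_pos
  have hs : Function.Surjective (φ.app (Proj.basicOpen (grading k N) (MvPolynomial.X i))) := by
    intro s
    have h1 := hreg i _ (toFunctionField_mem _ _ s)
    have hi : MvPolynomial.aeval w (MvPolynomial.X i : MvPolynomial (Fin (N + 1)) k) ≠ 0 := by
      rw [MvPolynomial.aeval_X]; exact hw i
    obtain ⟨y, hy⟩ := (mem_range_evalAway w i hi).mpr h1
    refine ⟨Proj.awayToSection (grading k N) _ y, ?_⟩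
    apply toFunctionField_injective X _ ((h.mem_X_iff i).mpr (hw i))
    rw [← hy]
    exact h.toFunctionField_app (X_mem_grading i) one_pos hi _ y
  refine IsClosedImmersion.of_surjective_of_isAffine _ ?_
  have hU := Scheme.Opens.ι_image_top (Proj.basicOpen (grading k N) (MvPolynomial.X i))
  have hs' : ∀ V, V = Proj.basicOpen (grading k N) (MvPolynomial.X i) →
      Function.Surjective (φ.app V) := by rintro _ rfl; exact hs
  rw [morphismRestrict_appTop]
  exact (ConcreteCategory.bijective_of_isIso (X.presheaf.map _)).surjective.comp (hs' _ hU)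

lemma isAffineOpen_preimage_X {X : Scheme.{u}} (φ : X ⟶ projectiveSpace k N) [IsClosedImmersion φ]
    (i : Fin (N + 1)) :
    IsAffineOpen (φ ⁻¹ᵁ Proj.basicOpen (grading k N) (MvPolynomial.X i)) :=
  (Proj.isAffineOpen_basicOpen (grading k N) _ (X_mem_grading i) one_pos).preimage φ

/-- A closed immersion is surjective on sections over affine opens, so regular functions on the
chart come from polynomials in the ratios `X_j / X_i`. -/
lemma IsCoordinates.regularFunctions_eq (h : IsCoordinates φ w) (i : Fin (N + 1))
    [IsClosedImmersion φ]
    (hη : genericPoint X ∈ φ ⁻¹ᵁ Proj.basicOpen (grading k N) (MvPolynomial.X i)) :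
    regularFunctions X (φ ⁻¹ᵁ Proj.basicOpen (grading k N) (MvPolynomial.X i)) hη =
      Algebra.adjoin k (Set.range fun j ↦ w j / w i) := by
  have hi : MvPolynomial.aeval w (MvPolynomial.X i : MvPolynomial (Fin (N + 1)) k) ≠ 0 := by
    rw [MvPolynomial.aeval_X]; exact (h.mem_X_iff i).mp hη
  ext x
  rw [← mem_range_evalAway w i hi]
  constructor
  · rintro ⟨s, rfl⟩
    obtain ⟨t, rfl⟩ := φ.app_surjective _
      (Proj.isAffineOpen_basicOpen (grading k N) _ (X_mem_grading i) one_pos) s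
    let e := (Proj.basicOpenIsoAway (grading k N) _ (X_mem_grading (k := k) i)
      one_pos).commRingCatIsoToRingEquiv
    refine ⟨e.symm t, ?_⟩
    rw [← h.toFunctionField_app (X_mem_grading i) one_pos hi hη]
    exact congrArg (fun z ↦ toFunctionField X _ hη (φ.app _ z)) (e.apply_symm_apply t)
  · rintro ⟨y, rfl⟩
    exact ⟨_, h.toFunctionField_app (X_mem_grading i) one_pos hi hη y⟩

lemma toFunctionField_ratio (h : IsCoordinates φ w) (a b : LinearForm k N)
    (hη : genericPoint X ∈ φ ⁻¹ᵁ nonvanishing b) :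
    toFunctionField X _ hη (φ.app _ (ratio a b)) =
      MvPolynomial.aeval w a.1 / MvPolynomial.aeval w b.1 :=
  (h.toFunctionField_powRatio b.2 one_pos 1 (a := a.1) (by simp) hη).trans (by rw [pow_one])

lemma aeval_coord (w : Fin (N + 1) → X.functionField) (i) :
    MvPolynomial.aeval w (coord k N i).1 = w i := MvPolynomial.aeval_X _ _

/-- Completeness of the linear system in terms of rational functions. -/
lemma existsUnique_of_isTwistSection (h : IsCoordinates φ w) (hw : ∀ i, w i ≠ 0)
    (hinj : ∀ a : LinearForm k N, MvPolynomial.aeval w a.1 = 0 → a = 0)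
    (hcomp : ∀ s : X.functionField, (∀ i, s / w i ∈ regularFunctions (k := k) X
      (φ ⁻¹ᵁ Proj.basicOpen (grading k N) (MvPolynomial.X i)) ((h.mem_X_iff i).mpr (hw i))) →
      ∃ a : LinearForm k N, MvPolynomial.aeval w a.1 = s)
    (s : ∀ i, Γ(X, φ ⁻¹ᵁ nonvanishing (coord k N i))) (hs : IsTwistSection φ s) :
    ∃! a : LinearForm k N, ∀ i, s i = φ.app _ (ratio a (coord k N i)) := by
  have hη (i) : genericPoint X ∈ φ ⁻¹ᵁ nonvanishing (coord k N i) := (h.mem_X_iff i).mpr (hw i)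
  -- The gluing relation says that the rational function `s_i w_i` does not depend on `i`; this
  -- single function represents the section.
  have hval (i j) : toFunctionField X _ (hη i) (s i) * w i =
      toFunctionField X _ (hη j) (s j) * w j := by
    have h1 := congrArg (toFunctionField X _ (⟨hη i, hη j⟩ : genericPoint X ∈
      φ ⁻¹ᵁ nonvanishing (coord k N i) ⊓ φ ⁻¹ᵁ nonvanishing (coord k N j))) (hs i j)
    rw [map_mul] at h1
    have h2 := toFunctionField_map (X := X) inf_le_left (⟨hη i, hη j⟩ : genericPoint X ∈
      φ ⁻¹ᵁ nonvanishing (coord k N i) ⊓ φ ⁻¹ᵁ nonvanishing (coord k N j)) (s i)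
    have h3 := toFunctionField_map (X := X) inf_le_left (⟨hη i, hη j⟩ : genericPoint X ∈
      φ ⁻¹ᵁ nonvanishing (coord k N i) ⊓ φ ⁻¹ᵁ nonvanishing (coord k N j))
      (φ.app _ (ratio (coord k N j) (coord k N i)))
    have h4 := toFunctionField_map (X := X) inf_le_right (⟨hη i, hη j⟩ : genericPoint X ∈
      φ ⁻¹ᵁ nonvanishing (coord k N i) ⊓ φ ⁻¹ᵁ nonvanishing (coord k N j)) (s j)
    rw [toFunctionField_ratio h, aeval_coord, aeval_coord] at h3
    have h5 := h2.symm.trans (h1.trans (congrArg₂ (· * ·) h3 h4))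
    have := hw i
    simp only [h5]
    field_simp
  obtain ⟨a, ha⟩ := hcomp (toFunctionField X _ (hη 0) (s 0) * w 0) fun i ↦ by
    rw [← hval i 0, mul_div_cancel_right₀ _ (hw i)]
    exact toFunctionField_mem _ _ _
  refine ⟨a, fun i ↦ ?_, fun b hb ↦ ?_⟩
  · apply toFunctionField_injective X _ (hη i)
    rw [toFunctionField_ratio h, aeval_coord, ha, ← hval i 0, mul_div_cancel_right₀ _ (hw i)]
  · rw [← sub_eq_zero]
    apply hinj
    have h1 := congrArg (toFunctionField X _ (hη 0)) (hb 0)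
    rw [toFunctionField_ratio h, aeval_coord, eq_div_iff (hw 0)] at h1
    rw [Submodule.coe_sub, map_sub, ha, h1, sub_self]

/-- A linear form vanishing on `w` and the zero form both restrict to the zero section, so
uniqueness identifies them. -/
lemma aeval_injective_of_existsUnique (h : IsCoordinates φ w)
    (hu : ∀ s : (∀ i, Γ(X, φ ⁻¹ᵁ nonvanishing (coord k N i))), IsTwistSection φ s →
      ∃! a : LinearForm k N, ∀ i, s i = φ.app _ (ratio a (coord k N i)))
    (a : LinearForm k N) (ha : MvPolynomial.aeval w a.1 = 0) : a = 0 := by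
  have hz (b : LinearForm k N) (hb : MvPolynomial.aeval w b.1 = 0) (i) :
      φ.app _ (ratio b (coord k N i)) = 0 := by
    by_cases hη : genericPoint X ∈ φ ⁻¹ᵁ nonvanishing (coord k N i)
    · apply toFunctionField_injective X _ hη
      rw [toFunctionField_ratio h, hb, zero_div, map_zero]
    -- Nonvanishing of every `w_i` is not available yet. If `w_i = 0` the chart is empty and its
    -- ring of sections is trivial.
    · have : φ ⁻¹ᵁ nonvanishing (coord k N i) = ⊥ := by
        rw [eq_bot_iff]
        exact fun x hx ↦ (hη (genericPoint_mem_of_mem hx)).elim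
      have h2 : Subsingleton Γ(X, φ ⁻¹ᵁ nonvanishing (coord k N i)) := by
        rw [this]; infer_instance
      exact Subsingleton.elim _ _
  have ht : IsTwistSection φ (fun _ ↦ 0) := fun i j ↦ by
    simp only [TopCat.Presheaf.restrictOpen, TopCat.Presheaf.restrict]
    erw [map_zero, map_zero, mul_zero]
  exact (hu _ ht).unique (fun i ↦ (hz a ha i).symm) (fun i ↦ (hz 0 (map_zero _) i).symm)

lemma ne_zero_of_aeval_injective {K : Type*} [CommRing K] [Algebra k K] {w : Fin (N + 1) → K}
    (hinj : ∀ a : LinearForm k N, MvPolynomial.aeval w a.1 = 0 → a = 0) (i) : w i ≠ 0 := by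
  intro h0
  have h1 := congrArg Subtype.val (hinj (coord k N i) ((MvPolynomial.aeval_X _ _).trans h0))
  exact MvPolynomial.X_ne_zero (R := k) i h1

/-- The regular functions `x / w_i` satisfy the gluing relation, so they form a global section to
which completeness applies. -/
lemma exists_aeval_eq_of_existsUnique (h : IsCoordinates φ w) (hw : ∀ i, w i ≠ 0)
    (hu : ∀ s : (∀ i, Γ(X, φ ⁻¹ᵁ nonvanishing (coord k N i))), IsTwistSection φ s →
      ∃! a : LinearForm k N, ∀ i, s i = φ.app _ (ratio a (coord k N i)))
    (x : X.functionField) (hx : ∀ i, x / w i ∈ regularFunctions (k := k) X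
      (φ ⁻¹ᵁ Proj.basicOpen (grading k N) (MvPolynomial.X i)) ((h.mem_X_iff i).mpr (hw i))) :
    ∃ a : LinearForm k N, MvPolynomial.aeval w a.1 = x := by
  have hη (i) : genericPoint X ∈ φ ⁻¹ᵁ nonvanishing (coord k N i) := (h.mem_X_iff i).mpr (hw i)
  choose s hs using hx
  replace hs (i) : toFunctionField X _ (hη i) (s i) = x / w i := hs i
  have ht : IsTwistSection φ s := fun i j ↦ by
    have hij : genericPoint X ∈
      φ ⁻¹ᵁ nonvanishing (coord k N i) ⊓ φ ⁻¹ᵁ nonvanishing (coord k N j) := ⟨hη i, hη j⟩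
    have h2 := toFunctionField_map (X := X) inf_le_left hij (s i)
    have h3 := toFunctionField_map (X := X) inf_le_left hij
      (φ.app _ (ratio (coord k N j) (coord k N i)))
    have h4 := toFunctionField_map (X := X) inf_le_right hij (s j)
    rw [toFunctionField_ratio h, aeval_coord, aeval_coord] at h3
    rw [hs] at h2 h4
    apply toFunctionField_injective X _ hij
    rw [map_mul]
    refine h2.trans (Eq.trans ?_ (congrArg₂ (· * ·) h3 h4).symm)
    have := hw i
    have := hw j
    field_simp
  obtain ⟨a, ha, -⟩ := hu s ht
  refine ⟨a, ?_⟩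
  have h1 := congrArg (toFunctionField X _ (hη 0)) (ha 0)
  rw [toFunctionField_ratio h, aeval_coord, hs] at h1
  exact ((div_left_inj' (hw 0)).mp h1).symm

end Morphisms

end

end GaloisEmbedding

namespace GaloisEmbedding

noncomputable section

attribute [local instance] MvPolynomial.gradedAlgebra

/-! ## Products over an algebraically closed field -/

section TensorDomain

open TensorProduct

/-- The Nullstellensatz on the localization of `A` at `a`: the residue field of a maximal ideal is
finite over `k`, hence equal to `k`. -/
lemma exists_algHom_ne_zero {k A : Type*} [Field k] [IsAlgClosed k] [CommRing A] [IsDomain A]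
    [Algebra k A] [Algebra.FiniteType k A] {a : A} (ha : a ≠ 0) : ∃ f : A →ₐ[k] k, f a ≠ 0 := by
  have : IsDomain (Localization.Away a) := IsLocalization.isDomain_localization
    (powers_le_nonZeroDivisors_of_noZeroDivisors ha)
  obtain ⟨m, hm⟩ := Ideal.exists_maximal (Localization.Away a)
  have : Algebra.FiniteType A (Localization.Away a) := IsLocalization.finiteType_of_monoid_fg
    (Submonoid.powers a) _
  have : Algebra.FiniteType k (Localization.Away a) := Algebra.FiniteType.trans (S := A)
      inferInstance inferInstance
  let := Ideal.Quotient.field m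
  have : Algebra.FiniteType k (Localization.Away a ⧸ m) :=
    Algebra.FiniteType.of_surjective (Ideal.Quotient.mkₐ k m) (Ideal.Quotient.mkₐ_surjective _ _)
  have := finite_of_finite_type_of_isJacobsonRing k (Localization.Away a ⧸ m)
  let e : k ≃ₐ[k] (Localization.Away a ⧸ m) := AlgEquiv.ofBijective (Algebra.ofId _ _)
    (IsAlgClosed.algebraMap_bijective_of_isIntegral)
  refine ⟨(e.symm.toAlgHom.comp (Ideal.Quotient.mkₐ k m)).comp
    (IsScalarTower.toAlgHom k A (Localization.Away a)), ?_⟩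
  have hu : IsUnit (algebraMap A (Localization.Away a) a) :=
    IsLocalization.Away.algebraMap_isUnit a
  exact (hu.map (e.symm.toAlgHom.comp (Ideal.Quotient.mkₐ k m))).ne_zero

/-- Over an algebraically closed field the tensor product of two domains, one of them of finite
type, is a domain. -/
lemma isDomain_tensorProduct (k A B : Type*) [Field k] [IsAlgClosed k] [CommRing A] [IsDomain A]
    [Algebra k A] [Algebra.FiniteType k A] [CommRing B] [IsDomain B] [Algebra k B] :
    IsDomain (A ⊗[k] B) := by
  let b := Module.Free.chooseBasis k B
  let β := b.baseChange A
  have hε (f : A →ₐ[k] k) (x : A ⊗[k] B) (i) :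
      b.repr (Algebra.TensorProduct.lid k B (Algebra.TensorProduct.map f (AlgHom.id k B) x)) i =
        f (β.repr x i) := by
    induction x with
    | zero => simp
    | add x y hx hy => simp [hx, hy]
    | tmul x y => simp [β, Module.Basis.baseChange_repr_tmul, mul_comm]
  have hne (x : A ⊗[k] B) (hx : x ≠ 0) : ∃ i, β.repr x i ≠ 0 := by
    by_contra! h
    apply hx
    apply β.repr.injective
    ext i
    simpa using h i
  have : Nontrivial (A ⊗[k] B) := inferInstance
  have : NoZeroDivisors (A ⊗[k] B) := by
    refine ⟨fun {x y} hxy ↦ ?_⟩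
    by_contra! h
    obtain ⟨i, hi⟩ := hne x h.1
    obtain ⟨j, hj⟩ := hne y h.2
    -- A `k`-point of `A` at which a coefficient of `x` and a coefficient of `y` are both nonzero:
    -- specializing there sends `x` and `y` to nonzero elements of the domain `B` with product zero.
    obtain ⟨f, hf⟩ := exists_algHom_ne_zero (k := k) (mul_ne_zero hi hj)
    rw [map_mul] at hf
    have h1 := congrArg (fun z ↦ Algebra.TensorProduct.lid k B
      (Algebra.TensorProduct.map f (AlgHom.id k B) z)) hxy
    simp only [map_mul, map_zero] at h1
    rcases mul_eq_zero.mp h1 with h2 | h2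
    · have := hε f x i
      rw [h2] at this
      simp only [map_zero, Finsupp.coe_zero, Pi.zero_apply] at this
      exact left_ne_zero_of_mul hf this.symm
    · have := hε f y j
      rw [h2] at this
      simp only [map_zero, Finsupp.coe_zero, Pi.zero_apply] at this
      exact right_ne_zero_of_mul hf this.symm
  exact NoZeroDivisors.to_isDomain _

lemma productMap_bijective_of_isPushout {R A B C : Type u} [CommRing R] [CommRing A] [CommRing B]
    [CommRing C] [Algebra R A] [Algebra R B] [Algebra R C] (f : A →ₐ[R] C) (g : B →ₐ[R] C)
    (h : IsPushout (CommRingCat.ofHom (algebraMap R A)) (CommRingCat.ofHom (algebraMap R B))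
      (CommRingCat.ofHom f.toRingHom) (CommRingCat.ofHom g.toRingHom)) :
    Function.Bijective (Algebra.TensorProduct.productMap f g) := by
  let h' := CommRingCat.isPushout_tensorProduct R A B
  have he : (h'.isoIsPushout _ _ h).hom =
      CommRingCat.ofHom (Algebra.TensorProduct.productMap f g).toRingHom := by
    apply h'.hom_ext
    · rw [IsPushout.inl_isoIsPushout_hom]
      ext x
      simp
    · rw [IsPushout.inr_isoIsPushout_hom]
      ext x
      simp
  have := ConcreteCategory.bijective_of_isIso (h'.isoIsPushout _ _ h).hom
  rw [he] at this
  exact this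

end TensorDomain

/-! ### Affine charts and integrality of a fibre product -/

section Charts

open TensorProduct

variable {k : Type u} [Field k]

instance (X : Scheme.{u}) [X.Over (Spec (.of k))] (U : X.Opens) : Algebra k Γ(X, U) :=
  (constants X U).toAlgebra

/-- Pullback of regular functions along a morphism over `k`. -/
def sectionMap {Z X : Scheme.{u}} [Z.Over (Spec (.of k))] [X.Over (Spec (.of k))]
    (p : Z ⟶ X) [p.IsOver (Spec (.of k))] (U : X.Opens) (V : Z.Opens) (i : V ≤ p ⁻¹ᵁ U) :
    Γ(X, U) →ₐ[k] Γ(Z, V) where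
  __ := (p.appLE U V i).hom
  commutes' c := appLE_constants p U V i c

/-- The germ at the generic point, as a map of `k`-algebras. -/
def toFunctionFieldₐ (X : Scheme.{u}) [X.Over (Spec (.of k))] [IsIntegral X] (U : X.Opens)
    (h : genericPoint X ∈ U) : Γ(X, U) →ₐ[k] X.functionField where
  __ := toFunctionField X U h
  commutes' c := toFunctionField_constants X U h c

lemma finiteType_sections (X : Scheme.{u}) [X.Over (Spec (.of k))]
    [LocallyOfFiniteType (X ↘ Spec (.of k))] {U : X.Opens} (hU : IsAffineOpen U) :
    Algebra.FiniteType k Γ(X, U) := by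
  have h1 := (X ↘ Spec (.of k)).finiteType_appLE (isAffineOpen_top _) hU (fun _ _ ↦ trivial)
  have h2 : (constants (k := k) X U).FiniteType :=
    h1.comp (RingHom.FiniteType.of_surjective _ (ConcreteCategory.bijective_of_isIso
      (Scheme.ΓSpecIso (.of k)).inv).surjective)
  exact h2

lemma isAffineOpen_inf {Z X Y : Scheme.{u}} [X.Over (Spec (.of k))]
    [Y.Over (Spec (.of k))] {p : Z ⟶ X} {q : Z ⟶ Y}
    (H : IsPullback p q (X ↘ Spec (.of k)) (Y ↘ Spec (.of k)))
    {U : X.Opens} {V : Y.Opens} (hU : IsAffineOpen U) (hV : IsAffineOpen V) :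
    IsAffineOpen (p ⁻¹ᵁ U ⊓ q ⁻¹ᵁ V) := by
  have h1 := Scheme.Hom.isPullback_resLE H (US := ⊤) (UT := V) (UX := U) (fun _ _ ↦ trivial)
    (fun _ _ ↦ trivial) rfl
  have : IsAffine U.toScheme := hU
  have : IsAffine V.toScheme := hV
  have : IsAffine (⊤ : (Spec (.of k)).Opens).toScheme := isAffineOpen_top _
  exact .of_isIso h1.isoPullback.hom

variable {Z X Y : Scheme.{u}} [Z.Over (Spec (.of k))] [X.Over (Spec (.of k))]
  [Y.Over (Spec (.of k))] {p : Z ⟶ X} {q : Z ⟶ Y} [p.IsOver (Spec (.of k))]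
  [q.IsOver (Spec (.of k))]

lemma isPushout_sections {Z X Y : Scheme.{u}} [X.Over (Spec (.of k))]
    [Y.Over (Spec (.of k))] {p : Z ⟶ X} {q : Z ⟶ Y}
    (H : IsPullback p q (X ↘ Spec (.of k)) (Y ↘ Spec (.of k)))
    {U : X.Opens} {V : Y.Opens} (hU : IsAffineOpen U) (hV : IsAffineOpen V) :
    IsPushout (CommRingCat.ofHom (constants (k := k) X U))
      (CommRingCat.ofHom (constants (k := k) Y V))
      (p.appLE U (p ⁻¹ᵁ U ⊓ q ⁻¹ᵁ V) inf_le_left) (q.appLE V (p ⁻¹ᵁ U ⊓ q ⁻¹ᵁ V) inf_le_right) := by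
  have e1 : V ≤ (Y ↘ Spec (.of k)) ⁻¹ᵁ ⊤ := fun _ _ ↦ trivial
  have e2 : U ≤ (X ↘ Spec (.of k)) ⁻¹ᵁ ⊤ := fun _ _ ↦ trivial
  have h1 := (isIso_pushoutSection_iff H e1 e2 rfl).mp
    (isIso_pushoutSection_of_isAffineOpen H e1 e2 rfl (isAffineOpen_top _) hV hU)
  refine h1.of_iso (Scheme.ΓSpecIso (.of k)) (Iso.refl _) (Iso.refl _) (Iso.refl _) ?_ ?_ ?_ ?_
  · rw [← Iso.inv_comp_eq]
    exact (Category.comp_id _).symm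
  · rw [← Iso.inv_comp_eq]
    exact (Category.comp_id _).symm
  · simp
  · simp

lemma productMap_sectionMap_bijective (H : IsPullback p q (X ↘ Spec (.of k)) (Y ↘ Spec (.of k)))
    {U : X.Opens} {V : Y.Opens} (hU : IsAffineOpen U) (hV : IsAffineOpen V) :
    Function.Bijective (Algebra.TensorProduct.productMap
      (sectionMap (k := k) p U (p ⁻¹ᵁ U ⊓ q ⁻¹ᵁ V) inf_le_left)
      (sectionMap (k := k) q V (p ⁻¹ᵁ U ⊓ q ⁻¹ᵁ V) inf_le_right)) :=
  productMap_bijective_of_isPushout _ _ (isPushout_sections H hU hV)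

variable [IsAlgClosed k] [IsIntegral X] [IsIntegral Y] [LocallyOfFiniteType (X ↘ Spec (.of k))]

lemma isDomain_sections (H : IsPullback p q (X ↘ Spec (.of k)) (Y ↘ Spec (.of k)))
    {U : X.Opens} {V : Y.Opens} (hU : IsAffineOpen U) (hV : IsAffineOpen V)
    (hU' : (U : Set X).Nonempty) (hV' : (V : Set Y).Nonempty) :
    IsDomain Γ(Z, p ⁻¹ᵁ U ⊓ q ⁻¹ᵁ V) := by
  have : Nonempty U := hU'.to_subtype
  have : Nonempty V := hV'.to_subtype
  have := finiteType_sections (k := k) X hU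
  have := isDomain_tensorProduct k Γ(X, U) Γ(Y, V)
  exact (RingEquiv.ofBijective _ (productMap_sectionMap_bijective H hU hV)).symm.toMulEquiv.isDomain
      _

lemma isIntegral_inf (H : IsPullback p q (X ↘ Spec (.of k)) (Y ↘ Spec (.of k)))
    {U : X.Opens} {V : Y.Opens} (hU : IsAffineOpen U) (hV : IsAffineOpen V)
    (hU' : (U : Set X).Nonempty) (hV' : (V : Set Y).Nonempty) :
    IsIntegral (p ⁻¹ᵁ U ⊓ q ⁻¹ᵁ V).toScheme := by
  have := isDomain_sections H hU hV hU' hV'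
  have h := isAffineOpen_inf H hU hV
  have : IsAffine (p ⁻¹ᵁ U ⊓ q ⁻¹ᵁ V).toScheme := h
  have : IsDomain Γ((p ⁻¹ᵁ U ⊓ q ⁻¹ᵁ V).toScheme, ⊤) :=
    (p ⁻¹ᵁ U ⊓ q ⁻¹ᵁ V).topIso.commRingCatIsoToRingEquiv.toMulEquiv.isDomain _
  have : Nonempty (p ⁻¹ᵁ U ⊓ q ⁻¹ᵁ V).toScheme := by
    by_contra hn
    rw [not_nonempty_iff] at hn
    exact not_subsingleton Γ((p ⁻¹ᵁ U ⊓ q ⁻¹ᵁ V).toScheme, ⊤) inferInstance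
  exact isIntegral_of_isAffine_of_isDomain _

/-- After shrinking to affine opens the functions on the product chart form a domain, and the zero
ring is not one. -/
lemma nonempty_inf (H : IsPullback p q (X ↘ Spec (.of k)) (Y ↘ Spec (.of k)))
    {U : X.Opens} {V : Y.Opens} (hU : (U : Set X).Nonempty) (hV : (V : Set Y).Nonempty) :
    ((p ⁻¹ᵁ U ⊓ q ⁻¹ᵁ V : Z.Opens) : Set Z).Nonempty := by
  obtain ⟨x, hx⟩ := hU
  obtain ⟨y, hy⟩ := hV
  obtain ⟨U', hU', hxU', hUU'⟩ := exists_isAffineOpen_mem_and_subset hx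
  obtain ⟨V', hV', hxV', hVV'⟩ := exists_isAffineOpen_mem_and_subset hy
  have := isIntegral_inf H hU' hV' ⟨x, hxU'⟩ ⟨y, hxV'⟩
  obtain ⟨z, hz⟩ := (inferInstance : Nonempty (p ⁻¹ᵁ U' ⊓ q ⁻¹ᵁ V').toScheme)
  exact ⟨z, hUU' hz.1, hVV' hz.2⟩

/-- The product is covered by integral product charts. Any two of them meet, because opens of the
irreducible factors do, and this makes the whole space irreducible. -/
lemma isIntegral_of_isPullback (H : IsPullback p q (X ↘ Spec (.of k)) (Y ↘ Spec (.of k))) :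
    IsIntegral Z := by
  have hchart (z : Z) : ∃ W : Z.Opens, z ∈ W ∧ IsIntegral W.toScheme ∧
      ∃ (U : X.Opens) (V : Y.Opens), (U : Set X).Nonempty ∧ (V : Set Y).Nonempty ∧
        W = p ⁻¹ᵁ U ⊓ q ⁻¹ᵁ V := by
    obtain ⟨U, hU, hxU, -⟩ := exists_isAffineOpen_mem_and_subset (x := p z) (U := ⊤) trivial
    obtain ⟨V, hV, hxV, -⟩ := exists_isAffineOpen_mem_and_subset (x := q z) (U := ⊤) trivial
    exact ⟨p ⁻¹ᵁ U ⊓ q ⁻¹ᵁ V, ⟨hxU, hxV⟩, isIntegral_inf H hU hV ⟨_, hxU⟩ ⟨_, hxV⟩, U, V, ⟨_, hxU⟩,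
        ⟨_, hxV⟩, rfl⟩
  choose W hW hWi U V hU hV hWe using hchart
  have hirr (z : Z) : IsPreirreducible (W z : Set Z) := by
    have h1 := (PreirreducibleSpace.isPreirreducible_univ (X := (W z).toScheme)).image (W z).ι
      (W z).ι.continuous.continuousOn
    rwa [Set.image_univ, Scheme.Opens.range_ι] at h1
  have hint (z z' : Z) : ((W z : Set Z) ∩ W z').Nonempty := by
    have hX (A B : X.Opens) (hA : (A : Set X).Nonempty) (hB : (B : Set X).Nonempty) :
        ((A ⊓ B : X.Opens) : Set X).Nonempty :=
      nonempty_preirreducible_inter A.isOpen B.isOpen hA hB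
    have hY (A B : Y.Opens) (hA : (A : Set Y).Nonempty) (hB : (B : Set Y).Nonempty) :
        ((A ⊓ B : Y.Opens) : Set Y).Nonempty :=
      nonempty_preirreducible_inter A.isOpen B.isOpen hA hB
    obtain ⟨x, hx⟩ := nonempty_inf H (hX _ _ (hU z) (hU z')) (hY _ _ (hV z) (hV z'))
    rw [hWe z, hWe z']
    exact ⟨x, ⟨hx.1.1, hx.2.1⟩, ⟨hx.1.2, hx.2.2⟩⟩
  have : Nonempty Z := by
    obtain ⟨z, -⟩ := nonempty_inf H (U := ⊤) (V := ⊤) ⟨genericPoint X, trivial⟩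
      ⟨genericPoint Y, trivial⟩
    exact ⟨z⟩
  have : PreirreducibleSpace Z := by
    refine ⟨fun A B hA hB ⟨a, _, ha⟩ ⟨b, _, hb⟩ ↦ ?_⟩
    -- First move from `A` into the chart around `b`, then use irreducibility of that chart to reach
    -- `B`.
    obtain ⟨c, hc⟩ := hirr a A (W b) hA (W b).isOpen ⟨a, hW a, ha⟩ (hint a b)
    obtain ⟨d, hd⟩ := hirr b (A ∩ W a) B (hA.inter (W a).isOpen) hB
      ⟨c, hc.2.2, hc.2.1, hc.1⟩ ⟨b, hW b, hb⟩
    exact ⟨d, trivial, hd.2.1.1, hd.2.2⟩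
  have : IrreducibleSpace Z := ⟨inferInstance⟩
  have : IsReduced Z := by
    have hcov : TopologicalSpace.IsOpenCover W := by
      rw [TopologicalSpace.IsOpenCover, eq_top_iff]
      exact fun z _ ↦ TopologicalSpace.Opens.mem_iSup.mpr ⟨z, hW z⟩
    have (i : (Z.openCoverOfIsOpenCover W hcov).I₀) :
        IsReduced ((Z.openCoverOfIsOpenCover W hcov).X i) := by
      have := hWi i
      exact inferInstanceAs (IsReduced (W i).toScheme)
    exact IsReduced.of_openCover Z (Z.openCoverOfIsOpenCover W hcov)
  exact isIntegral_of_irreducibleSpace_of_isReduced _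

lemma isDominant_fst_of_isPullback (H : IsPullback p q (X ↘ Spec (.of k)) (Y ↘ Spec (.of k))) :
    IsDominant p where
  denseRange := by
    refine dense_iff_inter_open.mpr fun A hA hA' ↦ ?_
    obtain ⟨z, hz⟩ := nonempty_inf H (U := ⟨A, hA⟩) (V := ⊤) hA' ⟨genericPoint Y, trivial⟩
    exact ⟨p z, hz.1, z, rfl⟩

lemma isDominant_snd_of_isPullback (H : IsPullback p q (X ↘ Spec (.of k)) (Y ↘ Spec (.of k))) :
    IsDominant q where
  denseRange := by
    refine dense_iff_inter_open.mpr fun A hA hA' ↦ ?_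
    obtain ⟨z, hz⟩ := nonempty_inf H (U := ⊤) (V := ⟨A, hA⟩) ⟨genericPoint X, trivial⟩ hA'
    exact ⟨q z, hz.2, z, rfl⟩

end Charts

end

end GaloisEmbedding

namespace GaloisEmbedding

noncomputable section

attribute [local instance] MvPolynomial.gradedAlgebra

/-! ## Linearly disjoint embeddings of fields -/

section TensorFields

open TensorProduct

variable {k L M K : Type*} [Field k] [Field L] [Field M] [Field K] [Algebra k L] [Algebra k M]
  [Algebra k K]

/-- Clearing denominators: a unit `i a ⊗ j b` multiplies any tensor over the fields into the image
of `A ⊗ B`, where injectivity is assumed. -/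
lemma productMap_injective_of_fractions {A B : Type*} [CommRing A] [CommRing B] [Algebra k A]
    [Algebra k B] (i : A →ₐ[k] L) (j : B →ₐ[k] M) (hi : ∀ x, ∃ a b, i b ≠ 0 ∧ x = i a / i b)
    (hj : ∀ x, ∃ a b, j b ≠ 0 ∧ x = j a / j b) (P : L →ₐ[k] K) (Q : M →ₐ[k] K)
    (h : Function.Injective (Algebra.TensorProduct.productMap (P.comp i) (Q.comp j))) :
    Function.Injective (Algebra.TensorProduct.productMap P Q) := by
  have key (x : L ⊗[k] M) : ∃ (a : A) (b : B) (y : A ⊗[k] B), i a ≠ 0 ∧ j b ≠ 0 ∧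
      (i a ⊗ₜ[k] j b) * x = Algebra.TensorProduct.map i j y := by
    induction x with
    | zero =>
      obtain ⟨-, a, ha, -⟩ := hi 0
      obtain ⟨-, b, hb, -⟩ := hj 0
      exact ⟨a, b, 0, ha, hb, by simp⟩
    | tmul x y =>
      obtain ⟨a, a', ha, rfl⟩ := hi x
      obtain ⟨b, b', hb, rfl⟩ := hj y
      refine ⟨a', b', a ⊗ₜ b, ha, hb, ?_⟩
      rw [Algebra.TensorProduct.tmul_mul_tmul, mul_div_cancel₀ _ ha, mul_div_cancel₀ _ hb,
        Algebra.TensorProduct.map_tmul]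
    | add x y hx hy =>
      obtain ⟨a, b, z, ha, hb, hz⟩ := hx
      obtain ⟨a', b', z', ha', hb', hz'⟩ := hy
      refine ⟨a * a', b * b', (a' ⊗ₜ b') * z + (a ⊗ₜ b) * z', ?_, ?_, ?_⟩
      · rw [map_mul]; exact mul_ne_zero ha ha'
      · rw [map_mul]; exact mul_ne_zero hb hb'
      · simp only [map_add, map_mul, Algebra.TensorProduct.map_tmul]
        rw [← hz, ← hz', ← Algebra.TensorProduct.tmul_mul_tmul]
        ring
  have hcomp (y) : Algebra.TensorProduct.productMap P Q (Algebra.TensorProduct.map i j y) =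
      Algebra.TensorProduct.productMap (P.comp i) (Q.comp j) y := by
    induction y with
    | zero => simp
    | tmul x y => simp
    | add x y hx hy => simp [hx, hy]
  rw [injective_iff_map_eq_zero]
  intro x hx
  obtain ⟨a, b, y, ha, hb, hy⟩ := key x
  have h1 := congrArg (Algebra.TensorProduct.productMap P Q) hy
  rw [map_mul, hx, mul_zero, hcomp] at h1
  have h2 : y = 0 := h (h1.symm.trans (map_zero _).symm)
  rw [h2, map_zero] at hy
  calc x = ((i a)⁻¹ ⊗ₜ[k] (j b)⁻¹) * ((i a ⊗ₜ[k] j b) * x) := by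
        rw [← mul_assoc, Algebra.TensorProduct.tmul_mul_tmul, inv_mul_cancel₀ ha,
          inv_mul_cancel₀ hb, ← Algebra.TensorProduct.one_def, one_mul]
    _ = 0 := by rw [hy, mul_zero]

lemma linearIndependent_mul_of_productMap {P : L →ₐ[k] K} {Q : M →ₐ[k] K}
    (h : Function.Injective (Algebra.TensorProduct.productMap P Q)) {I J : Type*} {w : I → L}
    {v : J → M} (hw : LinearIndependent k w) (hv : LinearIndependent k v) :
    LinearIndependent k fun x : I × J ↦ P (w x.1) * Q (v x.2) := by
  have h1 := hw.tmul_of_flat_left hv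
  exact h1.map' (Algebra.TensorProduct.productMap P Q).toLinearMap (LinearMap.ker_eq_bot.mpr h)

/-- The partial evaluation `x ⊗ y ↦ l(y) x`. -/
def sliceRight (l : M →ₗ[k] k) : L ⊗[k] M →ₗ[k] L :=
  (TensorProduct.rid k L).toLinearMap ∘ₗ LinearMap.lTensor L l

/-- The partial evaluation `x ⊗ y ↦ l(x) y`. -/
def sliceLeft (l : L →ₗ[k] k) : L ⊗[k] M →ₗ[k] M :=
  (TensorProduct.lid k M).toLinearMap ∘ₗ LinearMap.rTensor M l

lemma sliceRight_tmul (l : M →ₗ[k] k) (x : L) (y : M) : sliceRight l (x ⊗ₜ y) = l y • x := by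
  simp [sliceRight]

lemma sliceLeft_tmul (l : L →ₗ[k] k) (x : L) (y : M) : sliceLeft l (x ⊗ₜ y) = l x • y := by
  simp [sliceLeft]

lemma slice_comm (l : L →ₗ[k] k) (m : M →ₗ[k] k) (x : L ⊗[k] M) :
    m (sliceLeft l x) = l (sliceRight m x) := by
  induction x with
  | zero => simp
  | tmul x y => simp [sliceLeft_tmul, sliceRight_tmul, mul_comm]
  | add x y hx hy => simp [hx, hy]

lemma eq_of_sliceRight (x y : L ⊗[k] M)
    (h : ∀ l : M →ₗ[k] k, sliceRight l x = sliceRight l y) : x = y := by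
  let b := Module.Free.chooseBasis k M
  let β := b.baseChange L
  have hb (x : L ⊗[k] M) (i) : β.repr x i = sliceRight (b.coord i) x := by
    induction x with
    | zero => simp
    | add x y hx hy => simp [hx, hy]
    | tmul x y => simp [β, Module.Basis.baseChange_repr_tmul, sliceRight_tmul]
  apply β.repr.injective
  ext i
  rw [hb, hb, h]

lemma exists_dual {I : Type*} [Fintype I] {w : I → L} (hw : LinearIndependent k w) :
    ∃ m : I → L →ₗ[k] k, ∀ x ∈ Submodule.span k (Set.range w), x = ∑ i, m i x • w i := by
  have h (i : I) : ∃ m : L →ₗ[k] k, m ∘ₗ (Submodule.span k (Set.range w)).subtype =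
      (Finsupp.lapply i) ∘ₗ hw.repr := LinearMap.exists_extend _
  choose m hm using h
  refine ⟨m, fun x hx ↦ ?_⟩
  have h1 := hw.linearCombination_repr ⟨x, hx⟩
  rw [Finsupp.linearCombination_apply, Finsupp.sum_fintype _ _ (by simp)] at h1
  refine h1.symm.trans (Finset.sum_congr rfl fun i _ ↦ ?_)
  congr 1
  exact (LinearMap.congr_fun (hm i) ⟨x, hx⟩).symm

/-- Membership in `A ⊗ B` is expressed through slices, as these conditions can be intersected over
several `A` and `B`. -/
lemma exists_productMap_eq {P : L →ₐ[k] K} {Q : M →ₐ[k] K} {A : Submodule k L}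
    {B : Submodule k M} {y : K} (hy : y ∈ A.map P.toLinearMap * B.map Q.toLinearMap) :
    ∃ t : L ⊗[k] M, Algebra.TensorProduct.productMap P Q t = y ∧ (∀ l, sliceRight l t ∈ A) ∧
      ∀ l, sliceLeft l t ∈ B := by
  induction hy using Submodule.mul_induction_on' with
  | mem_mul_mem m hm n hn =>
    obtain ⟨a, ha, rfl⟩ := hm
    obtain ⟨b, hb, rfl⟩ := hn
    refine ⟨a ⊗ₜ b, by simp, fun l ↦ ?_, fun l ↦ ?_⟩
    · rw [sliceRight_tmul]; exact A.smul_mem _ ha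
    · rw [sliceLeft_tmul]; exact B.smul_mem _ hb
  | add x hx y hy h1 h2 =>
    obtain ⟨s, hs, hs1, hs2⟩ := h1
    obtain ⟨t, ht, ht1, ht2⟩ := h2
    refine ⟨s + t, by rw [map_add, hs, ht], fun l ↦ ?_, fun l ↦ ?_⟩
    · rw [map_add]; exact A.add_mem (hs1 l) (ht1 l)
    · rw [map_add]; exact B.add_mem (hs2 l) (ht2 l)

/-- The intersection of the products `A_i ⊗ B_j` is the product of the intersections. -/
lemma mem_span_of_forall_mem_mul {P : L →ₐ[k] K} {Q : M →ₐ[k] K}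
    (h : Function.Injective (Algebra.TensorProduct.productMap P Q)) {I J : Type*} [Fintype I]
    [Fintype J] [Nonempty I] [Nonempty J] {w : I → L} {v : J → M} (hw : LinearIndependent k w)
    (A : I → Submodule k L) (B : J → Submodule k M)
    (hA : ⨅ i, A i ≤ Submodule.span k (Set.range w))
    (hB : ⨅ i, B i ≤ Submodule.span k (Set.range v)) {y : K}
    (hy : ∀ i j, y ∈ (A i).map P.toLinearMap * (B j).map Q.toLinearMap) :
    y ∈ Submodule.span k (Set.range fun x : I × J ↦ P (w x.1) * Q (v x.2)) := by
  obtain ⟨t, ht, -, -⟩ := exists_productMap_eq (hy (Classical.arbitrary I) (Classical.arbitrary J))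
  -- By injectivity one tensor `t` represents `y` for all `i` and `j` at once, so its slices lie in
  -- every `A i` and every `B j`.
  have hmem (i j) : (∀ l, sliceRight l t ∈ A i) ∧ ∀ l, sliceLeft l t ∈ B j := by
    obtain ⟨s, hs, h1⟩ := exists_productMap_eq (hy i j)
    have : s = t := h (hs.trans ht.symm)
    rwa [this] at h1
  have hR (l) : sliceRight l t ∈ Submodule.span k (Set.range w) :=
    hA (Submodule.mem_iInf _ |>.mpr fun i ↦ (hmem i (Classical.arbitrary J)).1 l)
  have hL (l) : sliceLeft l t ∈ Submodule.span k (Set.range v) :=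
    hB (Submodule.mem_iInf _ |>.mpr fun j ↦ (hmem (Classical.arbitrary I) j).2 l)
  obtain ⟨m, hm⟩ := exists_dual hw
  -- Expansion of `t` along `w`: the coefficients are left slices, hence in the span of `v`.
  -- Equality is tested on right slices, which lie in the span of `w`.
  have hte : t = ∑ i, w i ⊗ₜ[k] sliceLeft (m i) t := by
    apply eq_of_sliceRight
    intro l
    rw [map_sum, hm _ (hR l)]
    exact Finset.sum_congr rfl fun i _ ↦ by rw [sliceRight_tmul, slice_comm]
  rw [← ht, hte, map_sum]
  refine Submodule.sum_mem _ fun i _ ↦ ?_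
  rw [Algebra.TensorProduct.productMap_apply_tmul]
  have h1 : (LinearMap.mulLeft k (P (w i)) ∘ₗ Q.toLinearMap) (sliceLeft (m i) t) ∈
      (Submodule.span k (Set.range v)).map (LinearMap.mulLeft k (P (w i)) ∘ₗ Q.toLinearMap) :=
    Submodule.mem_map_of_mem (hL _)
  rw [Submodule.map_span] at h1
  refine Submodule.span_mono ?_ h1
  rintro _ ⟨_, ⟨j, rfl⟩, rfl⟩
  exact ⟨(i, j), rfl⟩

end TensorFields

/-! ### The function field of a product -/

section ProductFunctionField

open TensorProduct

lemma genericPoint_mem_inf {Z X Y : Scheme.{u}} {p : Z ⟶ X} {q : Z ⟶ Y} [IsIntegral X]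
    [IsIntegral Y] [IsIntegral Z] [IsDominant p] [IsDominant q] {U : X.Opens} {V : Y.Opens}
      (hU : genericPoint X ∈ U)
    (hV : genericPoint Y ∈ V) : genericPoint Z ∈ p ⁻¹ᵁ U ⊓ q ⁻¹ᵁ V := by
  refine ⟨?_, ?_⟩
  · change p (genericPoint Z) ∈ U
    rwa [map_genericPoint]
  · change q (genericPoint Z) ∈ V
    rwa [map_genericPoint]

variable {k : Type u} [Field k] {Z X Y : Scheme.{u}} [Z.Over (Spec (.of k))]
  [X.Over (Spec (.of k))] [Y.Over (Spec (.of k))] {p : Z ⟶ X} {q : Z ⟶ Y}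
  [p.IsOver (Spec (.of k))] [q.IsOver (Spec (.of k))] [IsIntegral X] [IsIntegral Y] [IsIntegral Z]
  [IsDominant p] [IsDominant q]

lemma toFunctionField_productMap {U : X.Opens} {V : Y.Opens} (hU : genericPoint X ∈ U)
    (hV : genericPoint Y ∈ V) (t : Γ(X, U) ⊗[k] Γ(Y, V)) :
    toFunctionField Z _ (genericPoint_mem_inf (p := p) (q := q) hU hV)
      (Algebra.TensorProduct.productMap
        (sectionMap (k := k) p U (p ⁻¹ᵁ U ⊓ q ⁻¹ᵁ V) inf_le_left)
        (sectionMap (k := k) q V (p ⁻¹ᵁ U ⊓ q ⁻¹ᵁ V) inf_le_right) t) =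
      Algebra.TensorProduct.productMap
        ((functionFieldMap (k := k) p).comp (toFunctionFieldₐ X U hU))
        ((functionFieldMap (k := k) q).comp (toFunctionFieldₐ Y V hV)) t := by
  induction t with
  | zero => simp
  | add x y hx hy => rw [map_add, map_add, map_add, hx, hy]
  | tmul x y =>
    rw [Algebra.TensorProduct.productMap_apply_tmul, Algebra.TensorProduct.productMap_apply_tmul,
      map_mul]
    exact congrArg₂ (· * ·)
      (functionFieldMap_toFunctionField (k := k) p inf_le_left hU (genericPoint_mem_inf hU hV)
        x).symm
      (functionFieldMap_toFunctionField (k := k) q inf_le_right hV (genericPoint_mem_inf hU hV)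
        y).symm

lemma productMap_functionFieldMap_injective
    (H : IsPullback p q (X ↘ Spec (.of k)) (Y ↘ Spec (.of k))) :
    Function.Injective (Algebra.TensorProduct.productMap (functionFieldMap (k := k) p)
      (functionFieldMap (k := k) q)) := by
  obtain ⟨U, hU, hxU, -⟩ := exists_isAffineOpen_mem_and_subset (x := genericPoint X) (U := ⊤)
      trivial
  obtain ⟨V, hV, hxV, -⟩ := exists_isAffineOpen_mem_and_subset (x := genericPoint Y) (U := ⊤)
      trivial
  refine productMap_injective_of_fractions (toFunctionFieldₐ X U hxU) (toFunctionFieldₐ Y V hxV)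
    (exists_div_of_isAffineOpen hU hxU) (exists_div_of_isAffineOpen hV hxV) _ _ fun a b e ↦ ?_
  rw [← toFunctionField_productMap, ← toFunctionField_productMap] at e
  exact (productMap_sectionMap_bijective H hU hV).1 (toFunctionField_injective _ _ _ e)

lemma regularFunctions_inf (H : IsPullback p q (X ↘ Spec (.of k)) (Y ↘ Spec (.of k)))
    {U : X.Opens} {V : Y.Opens} (hU : IsAffineOpen U)
    (hV : IsAffineOpen V) (hxU : genericPoint X ∈ U) (hxV : genericPoint Y ∈ V) :
    Subalgebra.toSubmodule (regularFunctions (k := k) Z (p ⁻¹ᵁ U ⊓ q ⁻¹ᵁ V)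
      (genericPoint_mem_inf hxU hxV)) =
    (Subalgebra.toSubmodule (regularFunctions (k := k) X U hxU)).map
        (functionFieldMap (k := k) p).toLinearMap *
      (Subalgebra.toSubmodule (regularFunctions (k := k) Y V hxV)).map
        (functionFieldMap (k := k) q).toLinearMap := by
  apply le_antisymm
  · rintro _ ⟨s, rfl⟩
    obtain ⟨t, rfl⟩ := (productMap_sectionMap_bijective H hU hV).2 s
    change toFunctionField Z _ _ _ ∈ _
    rw [toFunctionField_productMap hxU hxV]
    induction t with
    | zero => simp
    | add x y hx hy => rw [map_add]; exact add_mem hx hy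
    | tmul x y =>
      rw [Algebra.TensorProduct.productMap_apply_tmul]
      exact Submodule.mul_mem_mul ⟨_, toFunctionField_mem (k := k) _ _ x, rfl⟩
        ⟨_, toFunctionField_mem (k := k) _ _ y, rfl⟩
  · rw [Submodule.mul_le]
    rintro _ ⟨_, ⟨a, rfl⟩, rfl⟩ _ ⟨_, ⟨b, rfl⟩, rfl⟩
    refine Subalgebra.mul_mem _ ⟨_, (functionFieldMap_toFunctionField (k := k) p inf_le_left hxU
      (genericPoint_mem_inf hxU hxV) a).symm⟩ ⟨_, (functionFieldMap_toFunctionField (k := k) q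
        inf_le_right
        hxV (genericPoint_mem_inf hxU hxV) b).symm⟩

/-- Every rational function on the product is a quotient of functions on an affine product chart,
and those are sums of products of functions pulled back from the factors. -/
lemma functionField_le_of_isPullback
    (H : IsPullback p q (X ↘ Spec (.of k)) (Y ↘ Spec (.of k))) (F : Subfield Z.functionField)
    (hP : ∀ x, functionFieldMap (k := k) p x ∈ F) (hQ : ∀ x, functionFieldMap (k := k) q x ∈ F) :
    F = ⊤ := by
  obtain ⟨U, hU, hxU, -⟩ := exists_isAffineOpen_mem_and_subset (x := genericPoint X) (U := ⊤)
      trivial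
  obtain ⟨V, hV, hxV, -⟩ := exists_isAffineOpen_mem_and_subset (x := genericPoint Y) (U := ⊤)
      trivial
  have hreg (s) : toFunctionField Z _ (genericPoint_mem_inf (p := p) (q := q) hxU hxV) s ∈ F := by
    have h1 : toFunctionField Z _ (genericPoint_mem_inf (p := p) (q := q) hxU hxV) s ∈
      Subalgebra.toSubmodule (regularFunctions (k := k) Z (p ⁻¹ᵁ U ⊓ q ⁻¹ᵁ V)
      (genericPoint_mem_inf hxU hxV)) := toFunctionField_mem (k := k) _ _ s
    rw [regularFunctions_inf H hU hV hxU hxV] at h1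
    refine Submodule.mul_induction_on h1 ?_ fun _ _ ↦ F.add_mem
    rintro _ ⟨a, -, rfl⟩ _ ⟨b, -, rfl⟩
    exact F.mul_mem (hP a) (hQ b)
  rw [eq_top_iff]
  rintro x -
  obtain ⟨a, b, -, rfl⟩ := exists_div_of_isAffineOpen (isAffineOpen_inf H hU hV)
    (genericPoint_mem_inf hxU hxV) x
  exact F.div_mem (hreg a) (hreg b)

end ProductFunctionField

end

end GaloisEmbedding

namespace GaloisEmbedding

noncomputable section

attribute [local instance] MvPolynomial.gradedAlgebra

/-! ## Linearly normal embeddings and Segre products -/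

section LinearForms

variable {k : Type u} [Field k] {N : ℕ} {K : Type*} [CommRing K] [Algebra k K]

lemma exists_aeval_eq_iff {w : Fin (N + 1) → K} {s : K} :
    (∃ a : LinearForm k N, MvPolynomial.aeval w a.1 = s) ↔ s ∈ Submodule.span k (Set.range w) := by
  have h : (grading k N 1).map (MvPolynomial.aeval w).toLinearMap =
      Submodule.span k (Set.range w) := by
    rw [grading, MvPolynomial.homogeneousSubmodule_one_eq_span_X, Submodule.map_span,
      ← Set.range_comp]
    congr 2
    ext i
    simp
  rw [← h]
  exact ⟨fun ⟨a, ha⟩ ↦ ⟨a.1, a.2, ha⟩, fun ⟨a, ha, e⟩ ↦ ⟨⟨a, ha⟩, e⟩⟩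

lemma linearIndependent_iff_aeval {w : Fin (N + 1) → K} :
    LinearIndependent k w ↔ ∀ a : LinearForm k N, MvPolynomial.aeval w a.1 = 0 → a = 0 := by
  rw [Fintype.linearIndependent_iff]
  constructor
  · intro h a ha
    have h1 : a.1 ∈ Submodule.span k (Set.range (MvPolynomial.X (R := k) (σ := Fin (N + 1)))) := by
      rw [← MvPolynomial.homogeneousSubmodule_one_eq_span_X]; exact a.2
    obtain ⟨c, hc⟩ := (Submodule.mem_span_range_iff_exists_fun k).mp h1
    have h2 : ∑ i, c i • w i = 0 := by
      rw [← ha, ← hc, map_sum]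
      simp
    ext1
    rw [← hc]
    simp [h _ h2]
  · intro h c hc i
    let a : LinearForm k N := ∑ i, c i • coord k N i
    have ha : a.1 = ∑ i, c i • MvPolynomial.X i := by simp [a, coord]
    have h1 := congrArg Subtype.val (h a (by rw [ha, map_sum, ← hc]; simp))
    rw [ha] at h1
    have h2 := congrArg (MvPolynomial.coeff (Finsupp.single i 1)) h1
    simpa [MvPolynomial.coeff_sum, MvPolynomial.coeff_X, Finsupp.single_left_inj] using h2

end LinearForms

/-! ### Complete linear systems in terms of rational functions -/

section LinearlyNormal

variable {k : Type u} [Field k] {N : ℕ}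

/-- `φ` is a closed immersion with homogeneous coordinates `w`, and the coordinates form a basis of
the space of sections of `φ^* 𝒪(1)`. -/
structure IsLinearlyNormal {X : Scheme.{u}} [X.Over (Spec (.of k))] [IsIntegral X]
    (φ : X ⟶ projectiveSpace k N) (w : Fin (N + 1) → X.functionField) : Prop where
  isCoordinates : IsCoordinates φ w
  isClosedImmersion : IsClosedImmersion φ
  linearIndependent : LinearIndependent k w
  mem_span (s : X.functionField) (hs : ∀ i (hi : genericPoint X ∈
    φ ⁻¹ᵁ Proj.basicOpen (grading k N) (MvPolynomial.X i)), s / w i ∈ regularFunctions (k := k) X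
      (φ ⁻¹ᵁ Proj.basicOpen (grading k N) (MvPolynomial.X i)) hi) :
    s ∈ Submodule.span k (Set.range w)

lemma IsLinearlyNormal.isVeryAmpleEmbedding {X : Over (Spec (.of k))} [IsIntegral X.left]
    {φ : X.left ⟶ projectiveSpace k N} {w : Fin (N + 1) → X.left.functionField}
    (h : IsLinearlyNormal φ w) : IsVeryAmpleEmbedding φ where
  comp_structureMap := h.isCoordinates.comp_structureMap
  isClosedImmersion := h.isClosedImmersion
  complete := existsUnique_of_isTwistSection h.isCoordinates h.linearIndependent.ne_zero
    (linearIndependent_iff_aeval.mp h.linearIndependent)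
    fun s hs ↦ exists_aeval_eq_iff.mpr (h.mem_span s fun i _ ↦ hs i)

lemma IsVeryAmpleEmbedding.exists_isLinearlyNormal {X : Over (Spec (.of k))} [IsIntegral X.left]
    {φ : X.left ⟶ projectiveSpace k N} (h : IsVeryAmpleEmbedding φ) :
    ∃ w, IsLinearlyNormal φ w := by
  obtain ⟨w, hw⟩ := exists_isCoordinates h.comp_structureMap
  have hinj := aeval_injective_of_existsUnique hw h.complete
  refine ⟨w, hw, h.isClosedImmersion, linearIndependent_iff_aeval.mpr hinj, fun s hs ↦ ?_⟩
  exact exists_aeval_eq_iff.mp (exists_aeval_eq_of_existsUnique hw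
    (ne_zero_of_aeval_injective hinj) h.complete s fun i ↦ hs i _)

/-- By injectivity of germs `s` is the pullback of `a / X_i`, so inside the chart its invertibility
locus is that of `a`. This recovers the zero locus of a linear form from its rational function. -/
lemma IsCoordinates.inf_preimage_nonvanishing {X : Scheme.{u}} [X.Over (Spec (.of k))]
    [IsIntegral X] {φ : X ⟶ projectiveSpace k N} {w : Fin (N + 1) → X.functionField}
    (h : IsCoordinates φ w) {i : Fin (N + 1)} {W D : X.Opens}
    (hW : φ ⁻¹ᵁ Proj.basicOpen (grading k N) (MvPolynomial.X i) = W) (hη : genericPoint X ∈ W)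
    (a : LinearForm k N) (s : Γ(X, W))
    (hs : toFunctionField X W hη s = MvPolynomial.aeval w a.1 / w i)
    (hD : X.basicOpen s = W ⊓ D) : W ⊓ φ ⁻¹ᵁ nonvanishing a = W ⊓ D := by
  subst hW
  have ha : a.1 ∈ grading k N (1 • 1) := a.2
  have h1 := h.toFunctionField_powRatio (X_mem_grading i) one_pos 1 ha hη
  rw [pow_one, MvPolynomial.aeval_X, ← hs] at h1
  rw [← hD, ← toFunctionField_injective _ _ _ h1, basicOpen_app_powRatio]
  rfl

end LinearlyNormal

/-! ### The Segre product -/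

section Segre

variable {k : Type u} [Field k] {N M : ℕ} {Z X Y : Scheme.{u}} [Z.Over (Spec (.of k))]
  [X.Over (Spec (.of k))] [Y.Over (Spec (.of k))] {p : Z ⟶ X} {q : Z ⟶ Y}
  [p.IsOver (Spec (.of k))] [q.IsOver (Spec (.of k))] [IsIntegral X] [IsIntegral Y] [IsIntegral Z]
  [IsDominant p] [IsDominant q]
  {φ : X ⟶ projectiveSpace k N} {w : Fin (N + 1) → X.functionField}
  {ψ : Y ⟶ projectiveSpace k M} {v : Fin (M + 1) → Y.functionField}

/-- On a product, the ratios of bihomogeneous coordinates are regular. -/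
lemma exists_bihomogeneous_ratio (hφ : IsCoordinates φ w) (hψ : IsCoordinates ψ v) {i j}
    (hi : w i ≠ 0) (hj : v j ≠ 0) (a : LinearForm k N) (b : LinearForm k M) :
    ∃ s : Γ(Z, p ⁻¹ᵁ φ ⁻¹ᵁ Proj.basicOpen (grading k N) (MvPolynomial.X i) ⊓
        q ⁻¹ᵁ ψ ⁻¹ᵁ Proj.basicOpen (grading k M) (MvPolynomial.X j)),
      toFunctionField Z _ (genericPoint_mem_inf ((hφ.mem_X_iff i).mpr hi)
        ((hψ.mem_X_iff j).mpr hj)) s =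
        functionFieldMap (k := k) p (MvPolynomial.aeval w a.1) *
          functionFieldMap (k := k) q (MvPolynomial.aeval v b.1) /
          (functionFieldMap (k := k) p (w i) * functionFieldMap (k := k) q (v j)) ∧
      Z.basicOpen s = (p ⁻¹ᵁ φ ⁻¹ᵁ Proj.basicOpen (grading k N) (MvPolynomial.X i) ⊓
        q ⁻¹ᵁ ψ ⁻¹ᵁ Proj.basicOpen (grading k M) (MvPolynomial.X j)) ⊓
        (p ⁻¹ᵁ φ ⁻¹ᵁ nonvanishing a ⊓ q ⁻¹ᵁ ψ ⁻¹ᵁ nonvanishing b) := by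
  have hηi := (hφ.mem_X_iff i).mpr hi
  have hηj := (hψ.mem_X_iff j).mpr hj
  have ha : a.1 ∈ grading k N (1 • 1) := a.2
  have hb : b.1 ∈ grading k M (1 • 1) := b.2
  refine ⟨p.appLE _ _ inf_le_left (φ.app _ (powRatio (X_mem_grading i) 1 ha)) *
    q.appLE _ _ inf_le_right (ψ.app _ (powRatio (X_mem_grading j) 1 hb)), ?_, ?_⟩
  · rw [map_mul, ← functionFieldMap_toFunctionField (k := k) p inf_le_left hηi
      (genericPoint_mem_inf hηi hηj), ← functionFieldMap_toFunctionField (k := k) q inf_le_right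
      hηj (genericPoint_mem_inf hηi hηj), hφ.toFunctionField_powRatio _ one_pos,
      hψ.toFunctionField_powRatio _ one_pos, MvPolynomial.aeval_X, MvPolynomial.aeval_X, pow_one,
      pow_one, map_div₀, map_div₀, div_mul_div_comm]
  · rw [Scheme.basicOpen_mul, Scheme.basicOpen_appLE, Scheme.basicOpen_appLE,
      basicOpen_app_powRatio, basicOpen_app_powRatio]
    ext z
    change (_ ∧ _ ∧ _) ∧ (_ ∧ _ ∧ _) ↔ (_ ∧ _) ∧ (_ ∧ _)
    tauto

/-- The Segre embedding of a product of two linearly normal varieties. -/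
theorem exists_isLinearlyNormal_product (H : IsPullback p q (X ↘ Spec (.of k)) (Y ↘ Spec (.of k)))
    (hφ : IsLinearlyNormal φ w) (hψ : IsLinearlyNormal ψ v) :
    ∃ (R : ℕ) (χ : Z ⟶ projectiveSpace k R) (u : Fin (R + 1) → Z.functionField),
      IsLinearlyNormal χ u ∧ ∀ (a : LinearForm k N) (b : LinearForm k M),
        ∃ c : LinearForm k R, MvPolynomial.aeval u c.1 =
          functionFieldMap (k := k) p (MvPolynomial.aeval w a.1) *
            functionFieldMap (k := k) q (MvPolynomial.aeval v b.1) ∧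
          χ ⁻¹ᵁ nonvanishing c = p ⁻¹ᵁ φ ⁻¹ᵁ nonvanishing a ⊓ q ⁻¹ᵁ ψ ⁻¹ᵁ nonvanishing b := by
  have hX := hφ.isCoordinates
  have hY := hψ.isCoordinates
  have hw := hφ.linearIndependent.ne_zero
  have hv := hψ.linearIndependent.ne_zero
  have := hφ.isClosedImmersion
  have := hψ.isClosedImmersion
  set P := functionFieldMap (k := k) p
  set Q := functionFieldMap (k := k) q
  have hPQ : Function.Injective (Algebra.TensorProduct.productMap P Q) :=
    productMap_functionFieldMap_injective H
  -- `ℙ^R` has `R + 1` coordinates, so the number of products `w_i v_j` has to be written as a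
  -- successor.
  have hR : (N + 1) * (M + 1) = ((N + 1) * (M + 1) - 1) + 1 := by
    have : 0 < (N + 1) * (M + 1) := by positivity
    omega
  let R := (N + 1) * (M + 1) - 1
  let e : Fin (R + 1) ≃ Fin (N + 1) × Fin (M + 1) :=
    (finCongr hR).symm.trans finProdFinEquiv.symm
  let u' : Fin (N + 1) × Fin (M + 1) → Z.functionField := fun x ↦ P (w x.1) * Q (v x.2)
  let u : Fin (R + 1) → Z.functionField := u' ∘ e
  have hu' : LinearIndependent k u' := linearIndependent_mul_of_productMap hPQ
    hφ.linearIndependent hψ.linearIndependent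
  have hu : LinearIndependent k u := hu'.comp e e.injective
  let U (i) := φ ⁻¹ᵁ Proj.basicOpen (grading k N) (MvPolynomial.X i)
  let V (j) := ψ ⁻¹ᵁ Proj.basicOpen (grading k M) (MvPolynomial.X j)
  have hU (i) : genericPoint X ∈ U i := (hX.mem_X_iff i).mpr (hw i)
  have hV (j) : genericPoint Y ∈ V j := (hY.mem_X_iff j).mpr (hv j)
  let W (l) := p ⁻¹ᵁ U (e l).1 ⊓ q ⁻¹ᵁ V (e l).2
  have hW (l) : genericPoint Z ∈ W l := genericPoint_mem_inf (hU _) (hV _)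
  have hcov : TopologicalSpace.IsOpenCover W := by
    rw [TopologicalSpace.IsOpenCover, eq_top_iff]
    intro z _
    obtain ⟨i, hi⟩ := exists_mem_basicOpen_X (φ (p z))
    obtain ⟨j, hj⟩ := exists_mem_basicOpen_X (ψ (q z))
    refine TopologicalSpace.Opens.mem_iSup.mpr ⟨e.symm (i, j), ?_⟩
    simp only [W, Equiv.apply_symm_apply]
    exact ⟨hi, hj⟩
  obtain ⟨χ, hχ, hχW⟩ := exists_isCoordinates_of_isOpenCover (k := k) u hu.ne_zero W hW hcov
    fun l l' ↦ by
    obtain ⟨s, hs, hs'⟩ := exists_bihomogeneous_ratio (k := k) (p := p) (q := q) hX hY (hw (e l).1)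
      (hv (e l).2) (coord k N (e l').1) (coord k M (e l').2)
    refine ⟨s, hs.trans ?_, hs'⟩
    rw [aeval_coord, aeval_coord]
    rfl
  have hregX (i) := hX.regularFunctions_eq i (hU i)
  have hregY (j) := hY.regularFunctions_eq j (hV j)
  have hregW (l) : Subalgebra.toSubmodule (regularFunctions (k := k) Z (W l) (hW l)) =
      (Subalgebra.toSubmodule (regularFunctions (k := k) X (U (e l).1) (hU _))).map P.toLinearMap *
      (Subalgebra.toSubmodule (regularFunctions (k := k) Y (V (e l).2) (hV _))).map
        Q.toLinearMap :=
    regularFunctions_inf H (isAffineOpen_preimage_X φ _) (isAffineOpen_preimage_X ψ _) (hU _) (hV _)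
  have hreg (l) (l') (h : l' = W l) (hl') : regularFunctions (k := k) Z l' hl' =
      regularFunctions (k := k) Z (W l) (hW l) := by subst h; rfl
  have hPw (i) : P (w i) ≠ 0 := (map_ne_zero _).mpr (hw i)
  have hQv (j) : Q (v j) ≠ 0 := (map_ne_zero _).mpr (hv j)
  have hclosed : IsClosedImmersion χ := by
    refine hχ.isClosedImmersion hu.ne_zero (fun l ↦ ?_) fun l x hx ↦ ?_
    · rw [hχW]
      exact isAffineOpen_inf H (isAffineOpen_preimage_X φ _) (isAffineOpen_preimage_X ψ _)
    · rw [hreg l _ (hχW l)] at hx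
      have h1 := (hregW l).le hx
      rw [hregX, hregY] at h1
      refine Submodule.mul_induction_on h1 ?_ fun _ _ ↦ add_mem
      -- Varying one index of `w_i v_j` while the other is fixed gives the ratios of a single factor
      -- as ratios of Segre coordinates.
      have hPm : (Algebra.adjoin k (Set.range fun j ↦ w j / w (e l).1)).map P ≤
          Algebra.adjoin k (Set.range fun j ↦ u j / u l) := by
        rw [AlgHom.map_adjoin]
        refine Algebra.adjoin_mono ?_
        rintro _ ⟨_, ⟨i, rfl⟩, rfl⟩
        refine ⟨e.symm (i, (e l).2), ?_⟩
        have := hQv (e l).2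
        simp only [u, u', Function.comp_apply, Equiv.apply_symm_apply, map_div₀]
        rw [mul_div_mul_right _ _ this]
      have hQm : (Algebra.adjoin k (Set.range fun j ↦ v j / v (e l).2)).map Q ≤
          Algebra.adjoin k (Set.range fun j ↦ u j / u l) := by
        rw [AlgHom.map_adjoin]
        refine Algebra.adjoin_mono ?_
        rintro _ ⟨_, ⟨j, rfl⟩, rfl⟩
        refine ⟨e.symm ((e l).1, j), ?_⟩
        have := hPw (e l).1
        simp only [u, u', Function.comp_apply, Equiv.apply_symm_apply, map_div₀]
        rw [mul_div_mul_left _ _ this]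
      rintro _ ⟨a, ha, rfl⟩ _ ⟨b, hb, rfl⟩
      exact mul_mem (hPm ⟨a, ha, rfl⟩) (hQm ⟨b, hb, rfl⟩)
  have hspan : Submodule.span k (Set.range u') = Submodule.span k (Set.range u) := by
    rw [e.surjective.range_comp]
  refine ⟨R, χ, u, ⟨hχ, hclosed, hu, fun s hs ↦ ?_⟩, fun a b ↦ ?_⟩
  · rw [← hspan]
    -- `w_i 𝒪(U_i)` and `v_j 𝒪(V_j)` are the sections of the two line bundles over the charts. Their
    -- intersections are the global sections, so the next step is the Künneth formula for `H⁰`.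
    let A (i) := (Subalgebra.toSubmodule (regularFunctions (k := k) X (U i) (hU i))).map
      (LinearMap.mulLeft k (w i))
    let B (j) := (Subalgebra.toSubmodule (regularFunctions (k := k) Y (V j) (hV j))).map
      (LinearMap.mulLeft k (v j))
    refine mem_span_of_forall_mem_mul hPQ hφ.linearIndependent A B ?_ ?_ fun i j ↦ ?_
    · intro x hx
      refine hφ.mem_span x fun i _ ↦ ?_
      obtain ⟨y, hy, rfl⟩ := (Submodule.mem_iInf _).mp hx i
      rw [LinearMap.mulLeft_apply, mul_div_cancel_left₀ _ (hw i)]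
      exact hy
    · intro x hx
      refine hψ.mem_span x fun i _ ↦ ?_
      obtain ⟨y, hy, rfl⟩ := (Submodule.mem_iInf _).mp hx i
      rw [LinearMap.mulLeft_apply, mul_div_cancel_left₀ _ (hv i)]
      exact hy
    · obtain ⟨l, hl⟩ := e.surjective (i, j)
      have h1 := hs l ((hχ.mem_X_iff l).mpr (hu.ne_zero l))
      rw [hreg l _ (hχW l)] at h1
      replace h1 := (hregW l).le h1
      have hl1 : (e l).1 = i := congrArg Prod.fst hl
      have hl2 : (e l).2 = j := congrArg Prod.snd hl
      subst hl1 hl2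
      have h2 : s = u l * (s / u l) := (mul_div_cancel₀ _ (hu.ne_zero l)).symm
      rw [h2]
      refine Submodule.mul_induction_on h1 ?_ fun x y hx hy ↦ by
        rw [mul_add]; exact add_mem hx hy
      rintro _ ⟨a, ha, rfl⟩ _ ⟨b, hb, rfl⟩
      have h3 : u l * (P.toLinearMap a * Q.toLinearMap b) =
          P.toLinearMap (w (e l).1 * a) * Q.toLinearMap (v (e l).2 * b) := by
        simp only [u, u', Function.comp_apply, AlgHom.toLinearMap_apply, map_mul]
        ring
      rw [h3]
      exact Submodule.mul_mem_mul ⟨_, ⟨a, ha, rfl⟩, rfl⟩ ⟨_, ⟨b, hb, rfl⟩, rfl⟩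
  · obtain ⟨c, hc⟩ := exists_aeval_eq_iff.mpr (show P (MvPolynomial.aeval w a.1) *
        Q (MvPolynomial.aeval v b.1) ∈ Submodule.span k (Set.range u) by
      rw [← hspan]
      have ha := (Submodule.mem_span_range_iff_exists_fun k).mp
        (exists_aeval_eq_iff.mp ⟨a, rfl⟩ : MvPolynomial.aeval w a.1 ∈ _)
      have hb := (Submodule.mem_span_range_iff_exists_fun k).mp
        (exists_aeval_eq_iff.mp ⟨b, rfl⟩ : MvPolynomial.aeval v b.1 ∈ _)
      obtain ⟨r, hr⟩ := ha
      obtain ⟨s, hs⟩ := hb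
      rw [← hr, ← hs, map_sum, map_sum, Finset.sum_mul_sum]
      refine Submodule.sum_mem _ fun i _ ↦ Submodule.sum_mem _ fun j _ ↦ ?_
      rw [map_smul, map_smul, smul_mul_smul_comm]
      exact Submodule.smul_mem _ _ (Submodule.subset_span ⟨(i, j), rfl⟩))
    refine ⟨c, hc, ?_⟩
    -- The two open sets are compared on each chart, where both are the invertibility locus of the
    -- same regular function.
    have hl (l) : W l ⊓ χ ⁻¹ᵁ nonvanishing c =
        W l ⊓ (p ⁻¹ᵁ φ ⁻¹ᵁ nonvanishing a ⊓ q ⁻¹ᵁ ψ ⁻¹ᵁ nonvanishing b) := by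
      obtain ⟨s, hs, hs'⟩ := exists_bihomogeneous_ratio (k := k) (p := p) (q := q) hX hY
          (hw (e l).1)
        (hv (e l).2) a b
      exact hχ.inf_preimage_nonvanishing (hχW l) (hW l) c s (hs.trans (by rw [hc]; rfl)) hs'
    ext z
    obtain ⟨l, hzl⟩ := hcov.exists_mem z
    have h3 := (congrArg (z ∈ ·) (hl l)).to_iff
    change (z ∈ W l ∧ z ∈ χ ⁻¹ᵁ nonvanishing c) ↔
        (z ∈ W l ∧ z ∈ p ⁻¹ᵁ φ ⁻¹ᵁ nonvanishing a ⊓ q ⁻¹ᵁ ψ ⁻¹ᵁ nonvanishing b) at h3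
    exact ⟨fun h ↦ (h3.mp ⟨hzl, h⟩).2, fun h ↦ (h3.mpr ⟨hzl, h⟩).2⟩

end Segre

end

end GaloisEmbedding

namespace GaloisEmbedding

noncomputable section

attribute [local instance] MvPolynomial.gradedAlgebra

/-! ## Powers of a linearly normal variety -/

section Powers

lemma isIso_hom_of_isEmpty {k : Type u} [Field k] {C Z : Over (Spec (.of k))} (π : Fin 0 → (Z ⟶ C))
    (hZ : IsLimit (Fan.mk Z π)) : IsIso Z.hom := by
  let T : Over (Spec (.of k)) := Over.mk (𝟙 _)
  let f : T ⟶ Z := Fan.IsLimit.lift hZ fun i ↦ i.elim0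
  refine ⟨f.left, ?_, Over.w f⟩
  have h : (Over.homMk Z.hom : Z ⟶ T) ≫ f = 𝟙 Z := Fan.IsLimit.hom_ext hZ _ _ fun i ↦ i.elim0
  exact congrArg (fun g ↦ Over.Hom.left g) h


variable {k : Type u} [Field k] {N : ℕ} {C : Over (Spec (.of k))} [IsIntegral C.left]

/-- The `k`-algebra maps `P_i : L → K` are jointly free and `K` is the compositum of their
images. -/
structure IsFreeCompositum {ι L K : Type*} [Fintype ι] [Field L] [Field K] [Algebra k L]
    [Algebra k K] (P : ι → L →ₐ[k] K) : Prop where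
  linearIndependent {J : Type u} {e : J → L} : LinearIndependent k e →
    LinearIndependent k fun f : ι → J ↦ ∏ i, P i (e (f i))
  eq_top (F : Subfield K) : (∀ c : k, algebraMap k K c ∈ F) → (∀ i x, P i x ∈ F) → F = ⊤

/-- The data produced on a `d`-fold power `Z` of `C`: a linearly normal embedding `χ` which contains
the products of the sections given by linear forms on the factors. -/
structure IsSegrePower {d : ℕ} {Z : Over (Spec (.of k))} [IsIntegral Z.left] (π : Fin d → (Z ⟶ C))
    (φ : C.left ⟶ projectiveSpace k N) (w : Fin (N + 1) → C.left.functionField)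
    (P : Fin d → C.left.functionField →ₐ[k] Z.left.functionField) {R : ℕ}
    (χ : Z.left ⟶ projectiveSpace k R) (u : Fin (R + 1) → Z.left.functionField) : Prop where
  isFreeCompositum : IsFreeCompositum P
  isLinearlyNormal : IsLinearlyNormal χ u
  exists_linearForm (b : Fin d → LinearForm k N) : ∃ c : LinearForm k R,
    MvPolynomial.aeval u c.1 = ∏ i, P i (MvPolynomial.aeval w (b i).1) ∧
    ∀ z, χ z ∈ nonvanishing c ↔ ∀ i, φ ((π i).left z) ∈ nonvanishing (b i)

/-- A `(d + 1)`-fold power is the product of the first factor and the `d`-fold power. -/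
def isLimitBinaryFan {𝒞 : Type*} [Category* 𝒞] {X : 𝒞} {d : ℕ} {Z Z' : 𝒞}
    (π : Fin (d + 1) → (Z ⟶ X)) (hZ : IsLimit (Fan.mk Z π)) (π' : Fin d → (Z' ⟶ X))
    (hZ' : IsLimit (Fan.mk Z' π')) :
    IsLimit (BinaryFan.mk (π 0) (Fan.IsLimit.lift hZ' fun i ↦ π i.succ)) :=
  BinaryFan.isLimitMk (fun s ↦ Fan.IsLimit.lift hZ
    (Fin.cons (α := fun _ ↦ s.pt ⟶ X) s.fst fun i ↦ s.snd ≫ π' i))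
    (fun s ↦ Fan.IsLimit.fac hZ (Fin.cons (α := fun _ ↦ s.pt ⟶ X) s.fst fun i ↦ s.snd ≫ π' i) 0)
    (fun s ↦ Fan.IsLimit.hom_ext hZ' _ _ fun i ↦ by
      rw [Category.assoc]
      refine (congrArg (_ ≫ ·) (Fan.IsLimit.fac hZ' _ i)).trans ?_
      exact Fan.IsLimit.fac hZ (Fin.cons (α := fun _ ↦ s.pt ⟶ X) s.fst fun i ↦ s.snd ≫ π' i) i.succ)
    (fun s m h0 h1 ↦ Fan.IsLimit.hom_ext hZ _ _ fun i ↦ by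
      refine Eq.trans ?_ (Fan.IsLimit.fac hZ
        (Fin.cons (α := fun _ ↦ s.pt ⟶ X) s.fst fun i ↦ s.snd ≫ π' i) i).symm
      refine Fin.cases h0 (fun i ↦ ?_) i
      refine Eq.trans ?_ (congrArg (· ≫ π' i) h1)
      refine Eq.trans ?_ (Category.assoc _ _ _).symm
      exact congrArg (m ≫ ·) (Fan.IsLimit.fac hZ' (fun i ↦ π i.succ) i).symm)

/-- For `d = 0` every rational function on `Z` is constant. The embedding is the one into `ℙ⁰` with
coordinate `1`, matching the empty product of sections. -/
lemma exists_isSegrePower_zero {Z : Over (Spec (.of k))} [IsIntegral Z.left] [IsIso Z.hom]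
    (π : Fin 0 → (Z ⟶ C)) (φ : C.left ⟶ projectiveSpace k N)
    (w : Fin (N + 1) → C.left.functionField) :
    ∃ (P : Fin 0 → C.left.functionField →ₐ[k] Z.left.functionField) (R : ℕ)
      (χ : Z.left ⟶ projectiveSpace k R) (u : Fin (R + 1) → Z.left.functionField),
      IsSegrePower π φ w P χ u := by
  have hη : genericPoint Z.left ∈ (⊤ : Z.left.Opens) := TopologicalSpace.Opens.mem_top _
  have haff : IsAffine Z.left := .of_isIso Z.hom
  have hconst (s : Γ(Z.left, ⊤)) : ∃ c : k, constants Z.left ⊤ c = s := by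
    have : IsIso (Z.left ↘ Spec (.of k)) := ‹IsIso Z.hom›
    have : IsIso (Z.left ↘ Spec (.of k)).appTop :=
      inferInstanceAs (IsIso ((Z.left ↘ Spec (.of k)).app ⊤))
    have h1 : Function.Surjective ((Z.left ↘ Spec (.of k)).appTop) :=
      (ConcreteCategory.bijective_of_isIso _).surjective
    have h2 : Function.Surjective (Scheme.ΓSpecIso (.of k)).inv :=
      (ConcreteCategory.bijective_of_isIso _).surjective
    obtain ⟨t, rfl⟩ := h1 s
    obtain ⟨c, rfl⟩ := h2 t
    refine ⟨c, ?_⟩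
    have h3 : (Z.left ↘ Spec (.of k)).appLE ⊤ ⊤ (fun _ _ ↦ trivial) =
        (Z.left ↘ Spec (.of k)).appTop :=
      Scheme.Hom.appLE_eq_app _
    simp only [constants, RingHom.comp_apply]
    rw [h3]
  have halg (x : Z.left.functionField) : ∃ c : k, algebraMap k _ c = x := by
    obtain ⟨a, b, -, rfl⟩ := exists_div_of_isAffineOpen (isAffineOpen_top _) hη x
    obtain ⟨a, rfl⟩ := hconst a
    obtain ⟨b, rfl⟩ := hconst b
    exact ⟨a / b, by rw [map_div₀, toFunctionField_constants, toFunctionField_constants]⟩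
  let u : Fin (0 + 1) → Z.left.functionField := fun _ ↦ 1
  have hu (i) : u i ≠ 0 := one_ne_zero
  have hul : LinearIndependent k u := LinearIndependent.of_subsingleton (ι := Fin 1) 0 one_ne_zero
  have hspan (x) : x ∈ Submodule.span k (Set.range u) := by
    obtain ⟨c, rfl⟩ := halg x
    rw [Algebra.algebraMap_eq_smul_one]
    exact Submodule.smul_mem _ _ (Submodule.subset_span ⟨0, rfl⟩)
  obtain ⟨χ, hχ, hχU⟩ := exists_isCoordinates_of_isOpenCover (k := k) u hu (fun _ ↦ ⊤)
    (fun _ ↦ hη) (by simp [TopologicalSpace.IsOpenCover]) fun i j ↦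
      ⟨1, by simp [u], by simp⟩
  have hclosed : IsClosedImmersion χ := hχ.isClosedImmersion hu
    (fun i ↦ by rw [hχU]; exact isAffineOpen_top _) fun i x _ ↦ by
      obtain ⟨c, rfl⟩ := halg x
      exact Subalgebra.algebraMap_mem _ c
  refine ⟨fun i ↦ i.elim0, 0, χ, u, ⟨⟨fun {J e} he ↦ ?_, fun F hF _ ↦ ?_⟩, ⟨hχ, hclosed, hul,
    fun s _ ↦ hspan s⟩, fun b ↦ ⟨coord k 0 0, ?_, fun z ↦ ?_⟩⟩⟩
  · exact LinearIndependent.of_subsingleton (fun i ↦ i.elim0) (by simp)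
  · rw [eq_top_iff]
    rintro x -
    obtain ⟨c, rfl⟩ := halg x
    exact hF c
  · rw [aeval_coord]; simp [u]
  · have h1 : z ∈ χ ⁻¹ᵁ nonvanishing (coord k 0 0) := (hχU 0).ge trivial
    exact ⟨fun _ i ↦ i.elim0, fun _ ↦ h1⟩

/-- Induction on `d` through `C^(d+1) = C × C^d`: integrality, the Segre embedding and free
compositum all pass to a product of two factors. -/
theorem exists_isSegrePower [IsAlgClosed k] [SmoothOfRelativeDimension 1 C.hom]
    {φ : C.left ⟶ projectiveSpace k N} {w : Fin (N + 1) → C.left.functionField}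
    (hφ : IsLinearlyNormal φ w) (d : ℕ) (Z : Over (Spec (.of k))) (π : Fin d → (Z ⟶ C))
    (hZ : IsLimit (Fan.mk Z π)) :
    ∃ (_ : IsIntegral Z.left) (_ : SmoothOfRelativeDimension d Z.hom)
      (P : Fin d → C.left.functionField →ₐ[k] Z.left.functionField) (R : ℕ)
      (χ : Z.left ⟶ projectiveSpace k R) (u : Fin (R + 1) → Z.left.functionField),
      IsSegrePower π φ w P χ u := by
  induction d generalizing Z with
  | zero =>
    have := isIso_hom_of_isEmpty π hZ
    have : Nonempty Z.left := ⟨inv Z.hom (IsLocalRing.closedPoint k)⟩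
    have : IsIntegral Z.left := isIntegral_of_isOpenImmersion Z.hom
    exact ⟨this, inferInstance, exists_isSegrePower_zero π φ w⟩
  | succ d ih =>
    let Z' : Over (Spec (.of k)) := ∏ᶜ fun _ : Fin d ↦ C
    let π' : Fin d → (Z' ⟶ C) := fun i ↦ Pi.π (fun _ : Fin d ↦ C) i
    have hZ' : IsLimit (Fan.mk Z' π') := productIsProduct _
    obtain ⟨hint, hsm, P', R', χ', u', h⟩ := ih Z' π' hZ'
    let q : Z ⟶ Z' := Fan.IsLimit.lift hZ' fun i ↦ π i.succ
    have hq (i) : q ≫ π' i = π i.succ := Fan.IsLimit.fac hZ' _ i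
    have H : IsPullback (π 0).left q.left (C.left ↘ Spec (.of k)) (Z'.left ↘ Spec (.of k)) :=
      Over.isPullback_of_binaryFan_isLimit _ (isLimitBinaryFan π hZ π' hZ')
    have : Smooth C.hom := SmoothOfRelativeDimension.smooth 1 C.hom
    have : LocallyOfFiniteType (C.left ↘ Spec (.of k)) :=
      inferInstanceAs (LocallyOfFiniteType C.hom)
    have hZint : IsIntegral Z.left := isIntegral_of_isPullback H
    have := isDominant_fst_of_isPullback H
    have := isDominant_snd_of_isPullback H
    -- The projection `C^(d+1) → C^d` is a base change of `C → Spec k`, so relative dimensions add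
    -- along the tower.
    have hqs : SmoothOfRelativeDimension 1 q.left :=
      have := smoothOfRelativeDimension_isStableUnderBaseChange 1
      MorphismProperty.of_isPullback H ‹SmoothOfRelativeDimension 1 C.hom›
    have hZs : SmoothOfRelativeDimension (d + 1) Z.hom := by
      have h1 : SmoothOfRelativeDimension (1 + d) (q.left ≫ Z'.hom) := inferInstance
      rwa [Over.w, add_comm] at h1
    obtain ⟨R, χ, u, hχ, hc⟩ := exists_isLinearlyNormal_product H hφ h.isLinearlyNormal
    let P : Fin (d + 1) → C.left.functionField →ₐ[k] Z.left.functionField :=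
      Fin.cons (functionFieldMap (π 0).left) fun i ↦ (functionFieldMap q.left).comp (P' i)
    refine ⟨hZint, hZs, P, R, χ, u, ⟨⟨fun {J e} he ↦ ?_, fun F hF hP ↦ ?_⟩, hχ, fun b ↦ ?_⟩⟩
    · have h1 := linearIndependent_mul_of_productMap (productMap_functionFieldMap_injective H) he
        (h.isFreeCompositum.linearIndependent he)
      have h2 := h1.comp (fun f : Fin (d + 1) → J ↦ (f 0, Fin.tail f)) fun f g e ↦ by
        rw [← Fin.cons_self_tail f, ← Fin.cons_self_tail g]
        rw [Prod.mk.injEq] at e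
        rw [e.1, e.2]
      have h3 : (fun f : Fin (d + 1) → J ↦ ∏ i, P i (e (f i))) =
          (fun x : J × (Fin d → J) ↦ functionFieldMap (k := k) (π 0).left (e x.1) *
            functionFieldMap (k := k) q.left (∏ i, P' i (e (x.2 i)))) ∘
            fun f : Fin (d + 1) → J ↦ (f 0, Fin.tail f) := by
        funext f
        rw [Fin.prod_univ_succ]
        simp [P, Fin.tail, map_prod]
      rw [h3]
      exact h2
    · refine functionField_le_of_isPullback H F (hP 0) fun x ↦ ?_
      let F' : Subfield Z'.left.functionField := F.comap
          (functionFieldMap (k := k) q.left).toRingHom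
      have h1 : F' = ⊤ := h.isFreeCompositum.eq_top F' (fun c ↦ by
        change functionFieldMap (k := k) q.left (algebraMap k _ c) ∈ F
        rw [AlgHom.commutes]
        exact hF c) fun i x ↦ hP i.succ x
      have h2 : x ∈ F' := by rw [h1]; trivial
      exact h2
    · obtain ⟨c', hc', hc'z⟩ := h.exists_linearForm (Fin.tail b)
      obtain ⟨c, hc, hcz⟩ := hc (b 0) c'
      refine ⟨c, ?_, fun z ↦ ?_⟩
      · rw [hc, hc', Fin.prod_univ_succ, map_prod]
        rfl
      · have h1 : χ z ∈ nonvanishing c ↔ φ ((π 0).left z) ∈ nonvanishing (b 0) ∧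
            χ' (q.left z) ∈ nonvanishing c' := (congrArg (z ∈ ·) hcz).to_iff
        rw [h1, hc'z, Fin.forall_fin_succ]
        refine and_congr Iff.rfl (forall_congr' fun i ↦ ?_)
        rw [← hq, Over.comp_left, Scheme.Hom.comp_apply]
        rfl

end Powers

end

end GaloisEmbedding

namespace GaloisEmbedding

noncomputable section

attribute [local instance] MvPolynomial.gradedAlgebra

/-! ## Projections through homogeneous coordinates -/

section Projections

open HomogeneousLocalization

variable {k : Type u} [Field k] {N n : ℕ}

lemma evalAway_map {K : Type u} [Field K] [Algebra k K] (u : Fin (N + 1) → K)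
    (ℓ : Fin (n + 1) → LinearForm k N) (j : Fin (n + 1))
    (h : MvPolynomial.aeval u (substitution ℓ (MvPolynomial.X j)) ≠ 0)
    (h' : MvPolynomial.aeval (fun i ↦ MvPolynomial.aeval u (ℓ i).1)
      (MvPolynomial.X j : MvPolynomial (Fin (n + 1)) k) ≠ 0) :
    (evalAway u _ h).comp (Away.map (substitution ℓ) (MvPolynomial.X j)) =
      evalAway (fun i ↦ MvPolynomial.aeval u (ℓ i).1) _ h' := by
  have hs (a : MvPolynomial (Fin (n + 1)) k) : MvPolynomial.aeval u (substitution ℓ a) =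
      MvPolynomial.aeval (fun i ↦ MvPolynomial.aeval u (ℓ i).1) a :=
    MvPolynomial.comp_aeval_apply (fun j ↦ (ℓ j).1) (MvPolynomial.aeval u) a
  ext x
  obtain ⟨m, a, ha, rfl⟩ := x.mk_surjective _ (X_mem_grading j)
  rw [RingHom.comp_apply, evalAway_mk, Away.map_mk, evalAway_mk, hs, hs]

lemma substitution_X_mem (ℓ : Fin (n + 1) → LinearForm k N) (j : Fin (n + 1)) :
    substitution ℓ (MvPolynomial.X j) ∈ grading k N 1 :=
  (substitution ℓ).map_mem (X_mem_grading j)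

lemma homOfLE_linearProjection (ℓ : Fin (n + 1) → LinearForm k N) (j : Fin (n + 1))
    (hle : Proj.basicOpen (grading k N) (substitution ℓ (MvPolynomial.X j)) ≤ centerCompl ℓ) :
    (projectiveSpace k N).homOfLE hle ≫ linearProjection ℓ =
      localProjection ℓ (MvPolynomial.X j) (MvPolynomial.isHomogeneous_X k j) one_pos :=
  Scheme.Cover.ι_glueMorphisms (Scheme.Opens.iSupOpenCover (X := projectiveSpace k N)
    fun j : Fin (n + 1) ↦ Proj.basicOpen (grading k N) (substitution ℓ (MvPolynomial.X j))) _ _ j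

variable {X : Scheme.{u}} [X.Over (Spec (.of k))] [IsIntegral X]

/-- The generic point avoids the center, hence lies over some `D₊(ℓ_j)`, and there the projection is
the substitution `y_i ↦ ℓ_i`. -/
lemma IsCoordinates.projectFrom {φ : X ⟶ projectiveSpace k N}
    {u : Fin (N + 1) → X.functionField} (h : IsCoordinates φ u) (ℓ : Fin (n + 1) → LinearForm k N)
    (hφ : Disjoint (Set.range φ) (center ℓ)) :
    IsCoordinates (projectFrom ℓ φ hφ) fun j ↦ MvPolynomial.aeval u (ℓ j).1 := by
  have h1 : φ (genericPoint X) ∉ center ℓ := Set.disjoint_left.mp hφ ⟨_, rfl⟩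
  obtain ⟨j, hj⟩ : ∃ j, φ (genericPoint X) ∈ nonvanishing (ℓ j) := by
    by_contra! h2
    exact h1 h2
  have hj0 : MvPolynomial.aeval u (ℓ j).1 ≠ 0 := (h.mem_iff (ℓ j).2 one_pos).mp hj
  have hj1 : MvPolynomial.aeval u (substitution ℓ (MvPolynomial.X j)) ≠ 0 := by
    rwa [substitution_X]
  have hj2 : MvPolynomial.aeval (fun i ↦ MvPolynomial.aeval u (ℓ i).1)
      (MvPolynomial.X j : MvPolynomial (Fin (n + 1)) k) ≠ 0 := by
    rwa [MvPolynomial.aeval_X]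
  refine ⟨j, hj2, ?_⟩
  let D := Proj.basicOpen (grading k N) (substitution ℓ (MvPolynomial.X j))
  have hle : D ≤ centerCompl ℓ := le_iSup (fun j : Fin (n + 1) ↦
    Proj.basicOpen (grading k N) (substitution ℓ (MvPolynomial.X j))) j
  let I := Proj.basicOpenIsoSpec (grading k N) _ (substitution_X_mem ℓ j) one_pos
  let ζ : Spec X.functionField ⟶ D.toScheme :=
    Spec.map (CommRingCat.ofHom (evalAway u _ hj1)) ≫ I.inv
  have hζ : ζ ≫ D.ι = fromSpecFunctionField X ≫ φ := by
    rw [h.eq_pointOn (substitution_X_mem ℓ j) one_pos hj1, pointOn, Category.assoc,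
      Proj.basicOpenIsoSpec_inv_ι]
    rfl
  have hζ' : fromSpecFunctionField X ≫ IsOpenImmersion.lift (centerCompl ℓ).ι φ
      (by
        rw [Scheme.Opens.range_ι, coe_centerCompl]
        exact Set.disjoint_left.mp hφ) = ζ ≫ (projectiveSpace k N).homOfLE hle := by
    rw [← cancel_mono (centerCompl ℓ).ι, Category.assoc, Category.assoc, IsOpenImmersion.lift_fac,
      Scheme.homOfLE_ι, hζ]
  have hloc : localProjection ℓ (MvPolynomial.X j) (MvPolynomial.isHomogeneous_X k j) one_pos =
      I.hom ≫ Spec.map (CommRingCat.ofHom (Away.map (substitution ℓ) (MvPolynomial.X j))) ≫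
        Proj.awayι (grading k n) _ (X_mem_grading j) one_pos := by
    rw [Proj.basicOpenIsoSpec_hom]
    rfl
  rw [GaloisEmbedding.projectFrom, ← Category.assoc, hζ', Category.assoc, homOfLE_linearProjection,
    hloc, pointOn, ← evalAway_map u ℓ j hj1 hj2, CommRingCat.ofHom_comp, Spec.map_comp]
  simp only [ζ, Category.assoc]
  rw [Iso.inv_hom_id_assoc]
  rfl

/-- A morphism to projective space is dominant if its coordinates satisfy no homogeneous
equation. -/
lemma IsCoordinates.isDominant {f : X ⟶ projectiveSpace k n} {w : Fin (n + 1) → X.functionField}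
    (h : IsCoordinates f w)
    (hw : ∀ (m : ℕ) (a : MvPolynomial (Fin (n + 1)) k), a.IsHomogeneous m →
      MvPolynomial.aeval w a = 0 → a = 0) : IsDominant f where
  denseRange := by
    intro x
    let y : ProjectiveSpectrum (grading k n) := f (genericPoint X)
    let x' : ProjectiveSpectrum (grading k n) := x
    -- The prime at the image of the generic point is zero, so every point of `ℙ^n` lies in the
    -- closure of that image.
    have hle : y ≤ x' := by
      intro a ha
      have hcomp (m : ℕ) (b : MvPolynomial (Fin (n + 1)) k) (hb : b ∈ grading k n m)
          (hby : b ∈ y.asHomogeneousIdeal) : b = 0 := by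
        -- `IsCoordinates.mem_iff` requires positive degree; the factor `X 0` also takes care of `m
        -- = 0`.
        have hc : b * MvPolynomial.X 0 ∈ grading k n (m + 1) :=
          SetLike.mul_mem_graded hb (X_mem_grading 0)
        by_contra hb0
        have h1 : MvPolynomial.aeval w (b * MvPolynomial.X 0) ≠ 0 := fun h0 ↦
          mul_ne_zero hb0 (MvPolynomial.X_ne_zero 0) (hw _ _ hc h0)
        exact (h.mem_iff hc m.succ_pos).mpr h1 (Ideal.mul_mem_right _ _ hby)
      have h0 : a = 0 := by
        classical
        rw [← DirectSum.sum_support_decompose (grading k n) a]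
        exact Finset.sum_eq_zero fun m _ ↦ hcomp m _ (SetLike.coe_mem _)
          (y.asHomogeneousIdeal.isHomogeneous m ha)
      rw [h0]
      exact zero_mem _
    have h1 : x' ∈ closure {y} := (ProjectiveSpectrum.le_iff_mem_closure _ y x').mp hle
    have h2 : ({f (genericPoint X)} : Set (projectiveSpace k n)) ⊆ Set.range f :=
      Set.singleton_subset_iff.mpr ⟨_, rfl⟩
    exact closure_mono h2 h1

/-- The local ring at the image of the generic point is a localization of the chart ring, whose
image in `k(X)` is generated over `k` by the `w_i / w_j`. -/
lemma IsCoordinates.pulledBackFunctionField_eq {f : X ⟶ projectiveSpace k n}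
    {w : Fin (n + 1) → X.functionField} (h : IsCoordinates f w) (j : Fin (n + 1)) (hj : w j ≠ 0) :
    pulledBackFunctionField f = Subfield.closure
      (Set.range (algebraMap k X.functionField) ∪ Set.range fun i ↦ w i / w j) := by
  have hj' : MvPolynomial.aeval w (MvPolynomial.X j : MvPolynomial (Fin (n + 1)) k) ≠ 0 := by
    rwa [MvPolynomial.aeval_X]
  have hη := (h.mem_X_iff j).mpr hj
  let U := Proj.basicOpen (grading k n) (MvPolynomial.X j)
  have hgerm (y : Away (grading k n) (MvPolynomial.X j)) :
      f.stalkMap (genericPoint X) ((projectiveSpace k n).presheaf.germ U _ hη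
        (Proj.awayToSection (grading k n) _ y)) = evalAway w _ hj' y := by
    rw [← h.toFunctionField_app (X_mem_grading j) one_pos hj' hη y]
    exact Scheme.Hom.germ_stalkMap_apply f U (genericPoint X) hη _
  apply le_antisymm
  · refine Subfield.closure_le.mpr ?_
    rintro _ ⟨z, rfl⟩
    have hE (y) : evalAway w _ hj' y ∈ Subfield.closure
        (Set.range (algebraMap k X.functionField) ∪ Set.range fun i ↦ w i / w j) := by
      have h1 := (mem_range_evalAway w j hj').mp ⟨y, rfl⟩
      generalize evalAway w _ hj' y = x at h1 ⊢
      induction h1 using Algebra.adjoin_induction with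
      | mem x hx => exact Subfield.subset_closure (Or.inr hx)
      | algebraMap r => exact Subfield.subset_closure (Or.inl ⟨r, rfl⟩)
      | add x y _ _ hx hy => exact add_mem hx hy
      | mul x y _ _ hx hy => exact mul_mem hx hy
    have hU : IsAffineOpen U := Proj.isAffineOpen_basicOpen (grading k n) _ (X_mem_grading j)
        one_pos
    let e := (Proj.basicOpenIsoAway (grading k n) _ (X_mem_grading (k := k) j)
      one_pos).commRingCatIsoToRingEquiv
    have hsurj (s : Γ(projectiveSpace k n, U)) : ∃ y, Proj.awayToSection (grading k n) _ y = s :=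
      ⟨e.symm s, e.apply_symm_apply s⟩
    let := (projectiveSpace k n).presheaf.algebra_section_stalk (⟨f (genericPoint X), hη⟩ : U)
    have hloc := hU.isLocalization_stalk ⟨f (genericPoint X), hη⟩
    obtain ⟨⟨a, s⟩, hs⟩ := IsLocalization.surj (hU.primeIdealOf ⟨_, hη⟩).asIdeal.primeCompl z
    have hu := IsLocalization.map_units ((projectiveSpace k n).presheaf.stalk (f (genericPoint X)))
        s
    obtain ⟨ya, hya⟩ := hsurj a
    obtain ⟨ys, hys⟩ := hsurj s.1
    have h1 := hgerm ya
    have h2 := hgerm ys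
    rw [hya] at h1
    rw [hys] at h2
    have h3 := hu.map (f.stalkMap (genericPoint X)).hom
    have h4 := congrArg (f.stalkMap (genericPoint X)).hom hs
    rw [map_mul] at h4
    have h5 : (f.stalkMap (genericPoint X)).hom z = evalAway w _ hj' ya / evalAway w _ hj' ys := by
      have h6 : evalAway w _ hj' ys ≠ 0 := fun h0 ↦ h3.ne_zero (h2.trans h0)
      exact (eq_div_iff h6).mpr ((congrArg (_ * ·) h2.symm).trans (h4.trans h1))
    rw [h5]
    exact div_mem (hE _) (hE _)
  · refine Subfield.closure_le.mpr ?_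
    rintro x hx
    apply Subfield.subset_closure
    have : ∃ y, evalAway w _ hj' y = x := by
      rw [mem_range_evalAway]
      rcases hx with ⟨c, rfl⟩ | ⟨i, rfl⟩
      · exact Subalgebra.algebraMap_mem _ c
      · exact Algebra.subset_adjoin ⟨i, rfl⟩
    obtain ⟨y, rfl⟩ := this
    exact ⟨_, hgerm y⟩

end Projections

end

end GaloisEmbedding

namespace GaloisEmbedding

noncomputable section

attribute [local instance] MvPolynomial.gradedAlgebra

/-! ## The Galois group of a free compositum over symmetric functions -/

section FreeCompositum

open scoped TensorProduct

variable {k : Type u} [Field k] {ι : Type} {L : Type u} {K K' : Type*} [Fintype ι] [Field L]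
  [Field K] [Field K'] [Algebra k L] [Algebra k K]

lemma injective_iff_linearIndependent_comp_basis {R V W J : Type*} [Ring R] [AddCommGroup V]
    [Module R V] [AddCommGroup W] [Module R W] (b : Module.Basis J R V) (f : V →ₗ[R] W) :
    Function.Injective f ↔ LinearIndependent R (f ∘ b) := by
  refine ⟨fun h ↦ b.linearIndependent.map' _ (LinearMap.ker_eq_bot.mpr h), fun h ↦ ?_⟩
  refine LinearMap.ker_eq_bot.mp (LinearMap.ker_eq_bot'.mpr fun x hx ↦ ?_)
  refine b.repr.map_eq_zero_iff.mp (linearIndependent_iff.mp h _ ?_)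
  rw [← Finsupp.apply_linearCombination, b.linearCombination_repr, hx]

/-- The map from the tensor power of `L` given by homomorphisms from `L`. -/
def powerLift (P : ι → L →ₐ[k] K) : (⨂[k] _ : ι, L) →ₐ[k] K :=
  PiTensorProduct.liftAlgHom
    ((MultilinearMap.mkPiAlgebra k ι K).compLinearMap fun i ↦ (P i).toLinearMap)
    (by simp) (fun x y ↦ by simp [Finset.prod_mul_distrib])

lemma powerLift_tprod (P : ι → L →ₐ[k] K) (x : ι → L) :
    powerLift P (PiTensorProduct.tprod k x) = ∏ i, P i (x i) := by
  exact (PiTensorProduct.lift.tprod x).trans (by simp)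

lemma powerLift_injective_iff {P : ι → L →ₐ[k] K} {J : Type u} (b : ι → Module.Basis J k L) :
    Function.Injective (powerLift P) ↔
      LinearIndependent k fun f : ι → J ↦ ∏ i, P i (b i (f i)) := by
  have h2 : (fun f : ι → J ↦ ∏ i, P i (b i (f i))) =
      (powerLift P).toLinearMap ∘ Basis.piTensorProduct (R := k) b := by
    ext f
    simp [Basis.piTensorProduct_apply, powerLift_tprod]
  rw [h2]
  exact injective_iff_linearIndependent_comp_basis _ _

lemma IsFreeCompositum.powerLift_injective {P : ι → L →ₐ[k] K} (h : IsFreeCompositum P) :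
    Function.Injective (powerLift P) :=
  (powerLift_injective_iff fun _ ↦ Module.Basis.ofVectorSpace k L).mpr
    (h.linearIndependent (Module.Basis.ofVectorSpace k L).linearIndependent)

/-- Automorphisms of the factors only replace their bases, and a permutation only reindexes the
products. These twisted families are the ones extended to endomorphisms of `K` below. -/
lemma IsFreeCompositum.powerLift_comp_injective {P : ι → L →ₐ[k] K} (h : IsFreeCompositum P)
    (s : Equiv.Perm ι) (g : ι → L ≃ₐ[k] L) :
    Function.Injective (powerLift fun i ↦ (P (s i)).comp (g i).toAlgHom) := by
  let b := Module.Basis.ofVectorSpace k L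
  rw [powerLift_injective_iff fun _ ↦ b]
  have h1 := (powerLift_injective_iff fun i ↦ b.map (g (s.symm i)).toLinearEquiv).mp
    h.powerLift_injective
  let c (f : ι → Module.Basis.ofVectorSpaceIndex k L) (i : ι) := f (s.symm i)
  have hc : Function.Injective c := fun f f' hf ↦ funext fun i ↦ by
    simpa [c] using congrFun hf (s i)
  convert h1.comp c hc using 2 with f
  refine Eq.trans ?_ (Equiv.prod_comp s _)
  simp [c]

/-- The universal property of a free compositum. -/
lemma IsFreeCompositum.exists_algHom {P : ι → L →ₐ[k] K} (h : IsFreeCompositum P)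
    [Algebra k K'] {Q : ι → L →ₐ[k] K'} (hQ : Function.Injective (powerLift Q)) :
    ∃ ρ : K →ₐ[k] K', ∀ i x, ρ (P i x) = Q i x := by
  classical
  have hPi := h.powerLift_injective
  let A := ⨂[k] _ : ι, L
  let : Algebra A K := (powerLift P).toRingHom.toAlgebra
  have : IsDomain A := hPi.isDomain (powerLift P).toRingHom
  have : FaithfulSMul A K := (faithfulSMul_iff_algebraMap_injective A K).mpr hPi
  have hs (R : ι → L →ₐ[k] K) (i x) :
      powerLift R (PiTensorProduct.tprod k (Function.update 1 i x)) = R i x := by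
    rw [powerLift_tprod, Finset.prod_eq_single i]
    · simp
    · intro j _ hj
      simp [Function.update_of_ne hj]
    · simp
  have hs' (i x) :
      powerLift Q (PiTensorProduct.tprod k (Function.update 1 i x)) = Q i x := by
    rw [powerLift_tprod, Finset.prod_eq_single i]
    · simp
    · intro j _ hj
      simp [Function.update_of_ne hj]
    · simp
  -- `K` is generated as a field by the image of the tensor power `A`, so each element is a quotient
  -- of two elements of that image; injective maps from `A` to a field therefore extend to `K`.
  have : IsFractionRing A K := by
    refine IsFractionRing.of_field A K fun z ↦ ?_
    have h1 : Subfield.closure (Set.range (powerLift P)) = ⊤ :=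
      h.eq_top _ (fun c ↦ Subfield.subset_closure ⟨algebraMap k A c, (powerLift P).commutes c⟩)
        fun i x ↦ Subfield.subset_closure ⟨_, hs P i x⟩
    have h2 : z ∈ Subfield.closure (Set.range (powerLift P)) := h1 ▸ Subfield.mem_top z
    have h3 : Subring.closure (Set.range (powerLift P)) = (powerLift P).toRingHom.range :=
      Subring.closure_eq (powerLift P).toRingHom.range
    rw [Subfield.mem_closure_iff, h3] at h2
    obtain ⟨_, ⟨x, rfl⟩, _, ⟨y, rfl⟩, h4⟩ := h2
    exact ⟨x, y, h4.symm⟩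
  let ρ := IsFractionRing.lift (A := A) (K := K) (g := (powerLift Q).toRingHom) hQ
  have hρ (x : A) : ρ (powerLift P x) = powerLift Q x :=
    IsFractionRing.lift_algebraMap (A := A) (K := K) (g := (powerLift Q).toRingHom) hQ x
  refine ⟨⟨ρ, fun c ↦ ?_⟩, fun i x ↦ ?_⟩
  · have := hρ (algebraMap k A c)
    rwa [AlgHom.commutes, AlgHom.commutes] at this
  · rw [← hs P, ← hs']
    exact hρ _

lemma IsFreeCompositum.ringHom_ext {P : ι → L →ₐ[k] K} (h : IsFreeCompositum P) {ρ σ : K →+* K'}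
    (h0 : ∀ c, ρ (algebraMap k K c) = σ (algebraMap k K c))
    (h1 : ∀ i x, ρ (P i x) = σ (P i x)) : ρ = σ := by
  have := h.eq_top (RingHom.eqLocusField ρ σ) h0 h1
  ext x
  exact (this ▸ Subfield.mem_top x : x ∈ RingHom.eqLocusField ρ σ)

/-- The elements `1, t` are independent, and the `P i t` are members with distinct indices in the
independent family of products formed from them. The lift of `Bool` serves only to reach the
universe of the index type. -/
lemma IsFreeCompositum.injective_apply {P : ι → L →ₐ[k] K} (h : IsFreeCompositum P) {t : L}
    (ht : ∀ c, algebraMap k L c ≠ t) : Function.Injective fun i ↦ P i t := by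
  classical
  have h1 : LinearIndependent k fun j : ULift.{u} Bool ↦ bif j.down then t else 1 := by
    have h0 : (fun j : ULift.{u} Bool ↦ bif j.down then t else 1) ∘
        (finTwoEquiv.trans Equiv.ulift.symm) = ![1, t] := by
      ext i
      fin_cases i <;> rfl
    rw [← linearIndependent_equiv (finTwoEquiv.trans Equiv.ulift.symm), h0,
      LinearIndependent.pair_iff' one_ne_zero]
    exact fun c hc ↦ ht c (by simpa [Algebra.smul_def] using hc)
  have h2 := (h.linearIndependent h1).injective
  intro i j hij
  by_contra hne
  have h3 (l : ι) : ∏ i, P i (bif (ULift.up.{u} (decide (i = l))).down then t else 1) = P l t := by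
    rw [Finset.prod_eq_single l]
    · simp
    · intro j _ hj
      simp [hj]
    · simp
  have h4 := @h2 (fun l ↦ ULift.up (decide (l = i))) (fun l ↦ ULift.up (decide (l = j)))
    ((h3 i).trans (hij.trans (h3 j).symm))
  exact hne (by simpa using congrFun h4 i)

end FreeCompositum

section Symmetric

variable {k : Type u} [Field k] {d : ℕ} {L : Type u} {K Ω : Type*} [Field L] [Field K] [Field Ω]
  [Algebra k L] [Algebra k K] {P : Fin d → L →ₐ[k] K} {t : L} {F : Subfield L} {M : Subfield K}

/-- Two embeddings of a normal extension differ by an automorphism. -/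
lemma exists_algEquiv_of_normal [Normal F L] (τ τ' : L →+* Ω) (h : ∀ x ∈ F, τ x = τ' x) :
    ∃ g : L ≃ₐ[F] L, ∀ x, τ x = τ' (g x) := by
  let : Algebra L Ω := τ'.toAlgebra
  let τF : L →ₐ[F] Ω := ⟨τ, fun x ↦ h x x.2⟩
  exact ⟨τF.restrictNormal' L, fun x ↦ (τF.restrictNormal_commutes L x).symm⟩

/-- The field of symmetric functions of the copies of `t`. -/
def symmetricField (P : Fin d → L →ₐ[k] K) (t : L) : Subfield K :=
  Subfield.closure (Set.range (algebraMap k K) ∪ Set.range fun j : Fin (d + 1) ↦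
    MvPolynomial.aeval (fun i ↦ P i t) (MvPolynomial.esymm (Fin d) k j))

/-- The polynomial `∏ (X - P_j t)` has symmetric coefficients, so `σ` and `τ` give it the same
image; `σ (P i t)` is a root of that image. -/
lemma exists_eq_of_eqOn_symmetricField (σ τ : K →+* Ω) (h : ∀ x ∈ symmetricField P t, σ x = τ x)
    (i : Fin d) : ∃ j, σ (P i t) = τ (P j t) := by
  let s : Multiset K := Finset.univ.val.map fun i ↦ P i t
  have hs : s.card = d := by simp [s]
  have h1 := Multiset.prod_X_sub_X_eq_sum_esymm s
  have h2 : ((s.map fun x ↦ Polynomial.X - Polynomial.C x).prod).map σ =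
      ((s.map fun x ↦ Polynomial.X - Polynomial.C x).prod).map τ := by
    rw [h1, Polynomial.map_sum, Polynomial.map_sum]
    refine Finset.sum_congr rfl fun j hj ↦ ?_
    have h3 : σ (s.esymm j) = τ (s.esymm j) := by
      refine h _ (Subfield.subset_closure (Or.inr ⟨⟨j, ?_⟩, ?_⟩))
      · rw [← hs]
        exact Finset.mem_range.mp hj
      · exact MvPolynomial.aeval_esymm_eq_multiset_esymm ..
    simp [h3]
  have h3 := congrArg (Polynomial.eval (σ (P i t))) h2
  have h4 (ρ : K →+* Ω) (y : Ω) :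
      (((s.map fun x ↦ Polynomial.X - Polynomial.C x).prod).map ρ).eval y =
        ∏ j, (y - ρ (P j t)) := by
    have h5 : (s.map fun x ↦ Polynomial.X - Polynomial.C x).prod =
        ∏ j, (Polynomial.X - Polynomial.C (P j t)) := by
      rw [Multiset.map_map]
      rfl
    rw [h5, Polynomial.map_prod, Polynomial.eval_prod]
    simp
  rw [h4, h4, Finset.prod_eq_zero (Finset.mem_univ i) (sub_self _)] at h3
  obtain ⟨j, -, hj⟩ := Finset.prod_eq_zero_iff.mp h3.symm
  exact ⟨j, sub_eq_zero.mp hj⟩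

/-- Once the images of the copies of `t` match, `σ ∘ P_i` and `τ ∘ P_j` agree on `F = k(t)`, and
normality of `L / F` provides the automorphism. -/
lemma exists_algEquiv_of_eqOn_symmetricField [Normal F L]
    (hF : F = Subfield.closure (Set.range (algebraMap k L) ∪ {t})) (σ τ : K →+* Ω)
    (h : ∀ x ∈ symmetricField P t, σ x = τ x) (i : Fin d) :
    ∃ (j : Fin d) (g : L ≃ₐ[F] L), ∀ x, σ (P i x) = τ (P j (g x)) := by
  obtain ⟨j, hj⟩ := exists_eq_of_eqOn_symmetricField σ τ h i
  refine ⟨j, exists_algEquiv_of_normal (F := F) (σ.comp (P i).toRingHom) (τ.comp (P j).toRingHom)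
      ?_⟩
  have h1 : F ≤ RingHom.eqLocusField (σ.comp (P i).toRingHom) (τ.comp (P j).toRingHom) := by
    rw [hF, Subfield.closure_le]
    rintro x (⟨c, rfl⟩ | rfl)
    · have h2 : algebraMap k K c ∈ symmetricField P t := Subfield.subset_closure (Or.inl ⟨c, rfl⟩)
      change σ (P i _) = τ (P j _)
      rw [(P i).commutes, (P j).commutes]
      exact h _ h2
    · exact hj
  exact h1

/-- Each `P_i t` is a root of `∏ (X - P_j t)`, hence `P_i(F)` and then `P_i(L)` are algebraic over
the symmetric functions; these copies generate `K`. -/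
lemma isAlgebraic_symmetricField (hP : IsFreeCompositum P)
    (hF : F = Subfield.closure (Set.range (algebraMap k L) ∪ {t})) [Algebra.IsAlgebraic F L] :
    Algebra.IsAlgebraic (symmetricField P t) K := by
  let A := algebraicClosure (symmetricField P t) K
  have ht (i : Fin d) : P i t ∈ A := by
    let s : Multiset K := Finset.univ.val.map fun i ↦ P i t
    have hs : s.card = d := by simp [s]
    let f := (s.map fun x ↦ Polynomial.X - Polynomial.C x).prod
    have hf : f.Monic := Polynomial.monic_multisetProd_X_sub_C s
    have h1 : f ∈ (Polynomial.mapRingHom (algebraMap (symmetricField P t) K)).range := by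
      simp only [f]
      rw [Multiset.prod_X_sub_X_eq_sum_esymm s]
      have hX : Polynomial.X ∈
          (Polynomial.mapRingHom (algebraMap (symmetricField P t) K)).range :=
        ⟨Polynomial.X, Polynomial.map_X _⟩
      refine sum_mem fun j hj ↦ mul_mem (pow_mem (neg_mem (one_mem _)) _)
        (mul_mem ?_ (pow_mem hX _))
      have h2 : s.esymm j ∈ symmetricField P t := by
        refine Subfield.subset_closure (Or.inr ⟨⟨j, ?_⟩, ?_⟩)
        · rw [← hs]
          exact Finset.mem_range.mp hj
        · exact MvPolynomial.aeval_esymm_eq_multiset_esymm ..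
      exact ⟨Polynomial.C ⟨_, h2⟩, Polynomial.map_C _⟩
    obtain ⟨q, hq⟩ := h1
    rw [Polynomial.coe_mapRingHom] at hq
    rw [mem_algebraicClosure_iff]
    refine ⟨q, ?_, ?_⟩
    · rintro rfl
      exact hf.ne_zero (hq.symm.trans (Polynomial.map_zero _))
    · rw [Polynomial.aeval_def, ← Polynomial.eval_map, hq]
      refine (Polynomial.eval_multiset_prod _ _).trans (Multiset.prod_eq_zero ?_)
      simp only [Multiset.map_map, Multiset.mem_map]
      exact ⟨P i t, Multiset.mem_map_of_mem _ (Finset.mem_univ_val i), by simp⟩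
  have hk (c : k) : algebraMap k K c ∈ A :=
    A.algebraMap_mem ⟨_, Subfield.subset_closure (Or.inl ⟨c, rfl⟩)⟩
  have hFA (i : Fin d) (x : F) : P i x ∈ A := by
    have h1 : F ≤ A.toSubfield.comap (P i).toRingHom := by
      rw [hF, Subfield.closure_le]
      rintro x (⟨c, rfl⟩ | rfl)
      · change P i _ ∈ A
        rw [(P i).commutes]
        exact hk c
      · exact ht i
    exact h1 x.2
  have h2 : A.toSubfield = ⊤ := by
    refine hP.eq_top _ hk fun i x ↦ ?_
    obtain ⟨p, hp0, hp⟩ := Algebra.IsAlgebraic.isAlgebraic (R := F) x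
    let r : F →+* A := ((P i).toRingHom.comp F.subtype).codRestrict A (hFA i)
    have h3 : IsAlgebraic A (P i x) := by
      refine ⟨p.map r, (Polynomial.map_ne_zero_iff r.injective).mpr hp0, ?_⟩
      have h4 := congrArg (P i) hp
      rw [Polynomial.aeval_def, ← AlgHom.coe_toRingHom, Polynomial.hom_eval₂, map_zero] at h4
      rw [Polynomial.aeval_def, Polynomial.eval₂_map]
      exact h4
    exact mem_algebraicClosure_iff.mpr (h3.restrictScalars _)
  exact (algebraicClosure.eq_top_iff ..).mp (IntermediateField.toSubfield_injective h2)

/-- A conjugate of `x` is `σ x` for an embedding `σ` of `K` into an algebraic closure. Such a `σ`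
sends every copy of `L` into the image of another copy, so it maps `K` into itself. -/
lemma normal_symmetricField (hP : IsFreeCompositum P)
    (hF : F = Subfield.closure (Set.range (algebraMap k L) ∪ {t})) [Normal F L] :
    Normal (symmetricField P t) K := by
  have := isAlgebraic_symmetricField hP hF
  let Ω := AlgebraicClosure K
  rw [normal_iff]
  refine fun x ↦ ⟨Algebra.IsIntegral.isIntegral x, ?_⟩
  refine Polynomial.Splits.of_splits_map (algebraMap K Ω) (IsAlgClosed.splits _) fun y hy ↦ ?_
  have hy1 : Polynomial.aeval y (minpoly (symmetricField P t) x) = 0 := by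
    rw [Polynomial.map_map, ← IsScalarTower.algebraMap_eq] at hy
    exact (Polynomial.mem_aroots.mp hy).2
  obtain ⟨σ, rfl⟩ := IntermediateField.exists_algHom_of_splits_of_aeval
    (F := symmetricField P t) (E := K) (K := Ω)
    (fun x ↦ ⟨Algebra.IsIntegral.isIntegral x, IsAlgClosed.splits _⟩) hy1
  have h1 : (algebraMap K Ω).fieldRange.comap σ.toRingHom = ⊤ := by
    refine hP.eq_top _ (fun c ↦ ?_) fun i x ↦ ?_
    · have hc : algebraMap k K c ∈ symmetricField P t := Subfield.subset_closure (Or.inl ⟨c, rfl⟩)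
      exact ⟨algebraMap k K c, (σ.commutes ⟨_, hc⟩).symm⟩
    · obtain ⟨j, g, hg⟩ := exists_algEquiv_of_eqOn_symmetricField hF σ.toRingHom (algebraMap K Ω)
        (fun x hx ↦ σ.commutes ⟨x, hx⟩) i
      exact ⟨_, (hg x).symm⟩
  exact (h1 ▸ Subfield.mem_top x : x ∈ (algebraMap K Ω).fieldRange.comap σ.toRingHom)

lemma exists_algHom_symmetricField (hP : IsFreeCompositum P)
    (hF : F = Subfield.closure (Set.range (algebraMap k L) ∪ {t})) (s : Equiv.Perm (Fin d))
    (g : Fin d → (L ≃ₐ[F] L)) :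
    ∃ ρ : K →ₐ[symmetricField P t] K, ∀ i x, ρ (P i x) = P (s i) (g (s i) x) := by
  have hk (c : k) : algebraMap k L c ∈ F := hF ▸ Subfield.subset_closure (Or.inl ⟨c, rfl⟩)
  have ht : t ∈ F := hF ▸ Subfield.subset_closure (Or.inr rfl)
  -- The automorphism is indexed by the target copy `s i`, in accordance with the multiplication of
  -- the wreath product.
  let g' (i : Fin d) : L ≃ₐ[k] L :=
    AlgEquiv.ofRingEquiv (f := (g (s i)).toRingEquiv) fun c ↦ (g (s i)).commutes ⟨_, hk c⟩
  obtain ⟨ρ, hρ⟩ := hP.exists_algHom (hP.powerLift_comp_injective s g')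
  have h1 : symmetricField P t ≤ RingHom.eqLocusField ρ.toRingHom (RingHom.id K) := by
    refine Subfield.closure_le.mpr ?_
    rintro x (⟨c, rfl⟩ | ⟨j, rfl⟩)
    · exact ρ.commutes c
    · have h2 (i : Fin d) : ρ (P i t) = P (s i) t :=
        (hρ i t).trans (congrArg (P (s i)) ((g (s i)).commutes ⟨t, ht⟩))
      change ρ (MvPolynomial.aeval (fun i ↦ P i t) (MvPolynomial.esymm (Fin d) k j)) =
        MvPolynomial.aeval (fun i ↦ P i t) (MvPolynomial.esymm (Fin d) k j)
      rw [← AlgHom.comp_apply, MvPolynomial.comp_aeval]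
      conv_rhs => rw [← MvPolynomial.esymm_isSymmetric (Fin d) k j s, MvPolynomial.aeval_rename]
      congr 2
      ext i
      exact h2 i
  exact ⟨⟨ρ.toRingHom, fun x ↦ h1 x.2⟩, hρ⟩

/-- The Galois group of a free compositum over the symmetric functions is a wreath product. -/
theorem nonempty_mulEquiv_symmetricField {G : Type*} [Group G] (hP : IsFreeCompositum P)
    (ht : ∀ c, algebraMap k L c ≠ t)
    (hF : F = Subfield.closure (Set.range (algebraMap k L) ∪ {t})) [Normal F L]
    (e : G ≃* (L ≃ₐ[F] L)) :
    Nonempty (WreathProduct G d ≃* (K ≃ₐ[symmetricField P t] K)) := by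
  have := isAlgebraic_symmetricField hP hF
  have htF : t ∈ F := hF ▸ Subfield.subset_closure (Or.inr rfl)
  have hinj := hP.injective_apply ht
  have hext {ρ σ : K →ₐ[symmetricField P t] K} (h : ∀ i x, ρ (P i x) = σ (P i x)) : ρ = σ := by
    refine AlgHom.coe_ringHom_injective (hP.ringHom_ext (fun c ↦ ?_) h)
    have hc : algebraMap k K c ∈ symmetricField P t := Subfield.subset_closure (Or.inl ⟨c, rfl⟩)
    exact (ρ.commutes ⟨_, hc⟩).trans (σ.commutes ⟨_, hc⟩).symm
  choose ρ hρ using fun γ : WreathProduct G d ↦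
    exists_algHom_symmetricField hP hF γ.right fun i ↦ e (γ.left i)
  have hfix (g : L ≃ₐ[F] L) : g t = t := g.commutes ⟨t, htF⟩
  let Θ : WreathProduct G d →* (K →ₐ[symmetricField P t] K) :=
    { toFun := ρ
      map_one' := hext fun i x ↦ by simp [hρ]
      map_mul' := fun γ γ' ↦ hext fun i x ↦ by
        -- In `mulAutArrow` a permutation acts on functions by precomposition with its inverse,
        -- which cancels against `γ.right`.
        have h1 : (γ * γ').left ((γ * γ').right i) =
            γ.left (γ.right (γ'.right i)) * γ'.left (γ'.right i) := by
          change _ * γ'.left (γ.right.symm (γ.right (γ'.right i))) = _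
          rw [Equiv.symm_apply_apply]
          rfl
        rw [hρ, h1, map_mul, AlgHom.mul_apply, hρ, hρ]
        rfl }
  have hΘ (γ i x) : Θ γ (P i x) = P (γ.right i) (e (γ.left (γ.right i)) x) := hρ γ i x
  have hbij : Function.Bijective Θ := by
    constructor
    · refine (injective_iff_map_eq_one Θ).mpr fun γ hγ ↦ ?_
      have h1 (i x) : P (γ.right i) (e (γ.left (γ.right i)) x) = P i x := by
        rw [← hΘ, hγ]
        rfl
      -- Evaluation at `t`, which `G` fixes, recovers the permutation because the `P_i t` are
      -- distinct; injectivity of `P_i` then recovers the components in `G`.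
      have h2 : γ.right = 1 := Equiv.ext fun i ↦ hinj (by
        have := h1 i t
        rwa [hfix] at this)
      refine SemidirectProduct.ext (funext fun i ↦ e.injective (AlgEquiv.ext fun x ↦ ?_)) h2
      have := h1 i x
      rw [h2] at this
      rw [SemidirectProduct.one_left, Pi.one_apply, map_one]
      exact (P i).injective this
    · intro σ
      choose s g hg using exists_algEquiv_of_eqOn_symmetricField (F := F) hF σ.toRingHom
        (RingHom.id K) fun x hx ↦ σ.commutes ⟨x, hx⟩
      have hs : Function.Injective s := fun i j hij ↦ hinj (σ.injective (by
        refine (hg i t).trans (Eq.trans ?_ (hg j t).symm)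
        rw [hfix, hfix, hij]))
      let s' := Equiv.ofBijective s (Finite.injective_iff_bijective.mp hs)
      refine ⟨⟨fun i ↦ e.symm (g (s'.symm i)), s'⟩, hext fun i x ↦ ?_⟩
      rw [hΘ]
      refine Eq.trans ?_ (hg i x).symm
      simp [s']
  -- Endomorphisms of an algebraic extension are automorphisms.
  exact ⟨(MulEquiv.ofBijective Θ hbij).trans
    (Algebra.IsAlgebraic.algEquivEquivAlgHom (symmetricField P t) K).symm⟩

end Symmetric

end

end GaloisEmbedding

namespace GaloisEmbedding

noncomputable section

attribute [local instance] MvPolynomial.gradedAlgebra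

/-! ## The center of projection given by the elementary symmetric functions -/

section Symmetric

variable {k : Type u} [Field k] {d : ℕ} {L : Type u} {K : Type*} [Field L] [Field K]
  [Algebra k L] [Algebra k K] {P : Fin d → L →ₐ[k] K} {t : L}

lemma transcendental_of_isAlgClosed [IsAlgClosed k] (ht : ∀ c, algebraMap k L c ≠ t) :
    Transcendental k t := by
  intro h
  have h1 := IntermediateField.eq_bot_of_isAlgClosed_of_isAlgebraic (algebraicClosure k L)
  have h2 : t ∈ algebraicClosure k L := mem_algebraicClosure_iff.mpr h
  rw [h1] at h2
  obtain ⟨c, hc⟩ := IntermediateField.mem_bot.mp h2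
  exact ht c hc

/-- The copies of a transcendental element in a free compositum are algebraically independent. -/
lemma IsFreeCompositum.algebraicIndependent (hP : IsFreeCompositum P) (ht : Transcendental k t) :
    AlgebraicIndependent k fun i ↦ P i t := by
  -- The powers of `t` are independent, and monomials in the `P_i t` are products of such powers,
  -- one from each copy.
  have h1 : LinearIndependent k fun n : ULift.{u} ℕ ↦ t ^ n.down := by
    have h2 := (injective_iff_linearIndependent_comp_basis (Polynomial.basisMonomials k)
      (Polynomial.aeval t).toLinearMap).mp (transcendental_iff_injective.mp ht)
    have h3 : (fun n : ULift.{u} ℕ ↦ t ^ n.down) =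
        ((Polynomial.aeval t).toLinearMap ∘ Polynomial.basisMonomials k) ∘ ULift.down := by
      ext n
      simp
    rw [h3]
    exact h2.comp ULift.down ULift.down_injective
  have h2 := hP.linearIndependent h1
  refine (injective_iff_linearIndependent_comp_basis (MvPolynomial.basisMonomials (Fin d) k)
    (MvPolynomial.aeval fun i ↦ P i t).toLinearMap).mpr ?_
  let c (m : Fin d →₀ ℕ) (i : Fin d) := ULift.up.{u} (m i)
  have hc : Function.Injective c := fun m m' h ↦
    Finsupp.ext fun i ↦ congrArg ULift.down (congrFun h i)
  have h3 : (MvPolynomial.aeval fun i ↦ P i t).toLinearMap ∘ MvPolynomial.basisMonomials (Fin d) k =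
      (fun f : Fin d → ULift.{u} ℕ ↦ ∏ i, P i (t ^ (f i).down)) ∘ c := by
    ext m
    simp [c, MvPolynomial.aeval_monomial, Finsupp.prod_fintype]
  rw [h3]
  exact h2.comp c hc

/-- A homogeneous polynomial is determined by its dehomogenization. -/
lemma eq_zero_of_aeval_cons_eq_zero {n m : ℕ} {a : MvPolynomial (Fin (n + 1)) k}
    (ha : a.IsHomogeneous m)
    (h : MvPolynomial.aeval (Fin.cons 1 MvPolynomial.X : Fin (n + 1) → MvPolynomial (Fin n) k) a =
      0) : a = 0 := by
  let E := FractionRing (MvPolynomial (Fin (n + 1)) k)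
  let x (i : Fin (n + 1)) : E := algebraMap (MvPolynomial (Fin (n + 1)) k) E (MvPolynomial.X i)
  have hx : x 0 ≠ 0 := by
    simp [x]
  have h1 : MvPolynomial.aeval x a = algebraMap _ E a := by
    have := MvPolynomial.aeval_algebraMap_apply (A := MvPolynomial (Fin (n + 1)) k) E
      (MvPolynomial.X (R := k)) a
    rwa [MvPolynomial.aeval_X_left_apply] at this
  -- In the fraction field `a` is `x_0 ^ m` times its dehomogenization evaluated at the ratios `x_i
  -- / x_0`.
  have h2 : MvPolynomial.aeval x a = x 0 ^ m * MvPolynomial.aeval (fun i ↦ x i / x 0) a := by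
    rw [← aeval_mul_of_isHomogeneous _ _ ha]
    congr 2
    ext i
    exact ((mul_comm _ _).trans (div_mul_cancel₀ _ hx)).symm
  have h3 : MvPolynomial.aeval (fun i ↦ x i / x 0) a =
      MvPolynomial.aeval (fun i : Fin n ↦ x i.succ / x 0) (MvPolynomial.aeval
        (Fin.cons 1 MvPolynomial.X : Fin (n + 1) → MvPolynomial (Fin n) k) a) := by
    rw [← AlgHom.comp_apply, MvPolynomial.comp_aeval]
    congr 2
    ext i
    refine Fin.cases ?_ (fun i ↦ ?_) i
    · simp [hx]
    · simp
  rw [h3, h, map_zero, mul_zero, h1] at h2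
  exact (map_eq_zero_iff _ (IsFractionRing.injective (MvPolynomial (Fin (n + 1)) k) E)).mp h2

/-- Homogeneity removes the common factor `q`. Since the symmetric function of index `0` is `1`,
what remains is a relation for the dehomogenized polynomial among the others, excluded by their
algebraic independence. -/
lemma IsFreeCompositum.eq_zero_of_aeval_esymm_eq_zero (hP : IsFreeCompositum P)
    (ht : Transcendental k t) {q : K} (hq : q ≠ 0) {m : ℕ} {a : MvPolynomial (Fin (d + 1)) k}
    (ha : a.IsHomogeneous m)
    (h : MvPolynomial.aeval (fun j : Fin (d + 1) ↦
      q * MvPolynomial.aeval (fun i ↦ P i t) (MvPolynomial.esymm (Fin d) k j)) a = 0) :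
    a = 0 := by
  rw [aeval_mul_of_isHomogeneous _ _ ha] at h
  replace h := (mul_eq_zero.mp h).resolve_left (pow_ne_zero _ hq)
  refine eq_zero_of_aeval_cons_eq_zero ha ?_
  apply MvPolynomial.esymmAlgHom_fin_injective k le_rfl
  rw [map_zero]
  apply Subtype.ext
  apply hP.algebraicIndependent ht
  rw [MvPolynomial.esymmAlgHom_apply, ZeroMemClass.coe_zero, map_zero, ← h,
    ← AlgHom.comp_apply, ← AlgHom.comp_apply, MvPolynomial.comp_aeval, MvPolynomial.comp_aeval]
  congr 2
  ext i
  refine Fin.cases ?_ (fun i ↦ ?_) i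
  · simp
  · simp

end Symmetric

/-! ### Linear forms on the power cutting out the new center -/

section Center

variable {k : Type u} [Field k] {C Z : Over (Spec (.of k))} [IsIntegral C.left] [IsIntegral Z.left]
  {N R d : ℕ} {π : Fin d → (Z ⟶ C)} {φ : C.left ⟶ projectiveSpace k N}
  {w : Fin (N + 1) → C.left.functionField}
  {P : Fin d → C.left.functionField →ₐ[k] Z.left.functionField}
  {χ : Z.left ⟶ projectiveSpace k R} {u : Fin (R + 1) → Z.left.functionField}

/-- The linear forms on the power which restrict to the elementary symmetric functions. -/
lemma IsSegrePower.exists_symmetricForms (h : IsSegrePower π φ w P χ u)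
    (ℓ : Fin 2 → LinearForm k N) (hℓ : Disjoint (Set.range φ) (center ℓ))
    (h0 : MvPolynomial.aeval w (ℓ 0).1 ≠ 0) :
    ∃ β : Fin (d + 1) → LinearForm k R, Disjoint (Set.range χ) (center β) ∧
      ∀ j, MvPolynomial.aeval u (β j).1 = (∏ i, P i (MvPolynomial.aeval w (ℓ 0).1)) *
        MvPolynomial.aeval
          (fun i ↦ P i (MvPolynomial.aeval w (ℓ 1).1 / MvPolynomial.aeval w (ℓ 0).1))
          (MvPolynomial.esymm (Fin d) k j) := by
  classical
  -- The form `c T` takes `ℓ₁` on the factors in `T` and `ℓ₀` on the others; summing over `|T| = j`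
  -- gives the homogenized elementary symmetric function.
  choose c hc hcz using fun T : Finset (Fin d) ↦
    h.exists_linearForm fun i ↦ if i ∈ T then ℓ 1 else ℓ 0
  refine ⟨fun j ↦ ∑ T ∈ Finset.powersetCard j Finset.univ, c T, ?_, fun j ↦ ?_⟩
  · rw [Set.disjoint_left]
    rintro _ ⟨z, rfl⟩ hz
    let S : Finset (Fin d) := {i | φ ((π i).left z) ∈ nonvanishing (ℓ 1)}
    have hmem (i : Fin d) : i ∈ S ↔ φ ((π i).left z) ∈ nonvanishing (ℓ 1) := by simp [S]
    have hS : χ z ∈ nonvanishing (c S) := by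
      rw [hcz]
      intro i
      by_cases hi : i ∈ S
      · rw [if_pos hi]
        exact (hmem i).mp hi
      · rw [if_neg hi]
        have h1 : φ ((π i).left z) ∉ center ℓ := Set.disjoint_left.mp hℓ ⟨_, rfl⟩
        by_contra h2
        refine h1 fun j ↦ ?_
        fin_cases j
        · exact h2
        · exact fun h3 ↦ hi ((hmem i).mpr h3)
    -- A set `T ≠ S` of the same size contains some `i ∉ S`, where `ℓ₁` vanishes.
    have hT (T : Finset (Fin d)) (hTS : T.card = S.card) (hne : T ≠ S) :
        χ z ∉ nonvanishing (c T) := by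
      rw [hcz]
      intro h1
      refine hne (Finset.eq_of_subset_of_card_le (fun i hi ↦ ?_) hTS.ge)
      have h2 := h1 i
      rw [if_pos hi] at h2
      exact (hmem i).mpr h2
    have hcard : S.card < d + 1 := Nat.lt_succ_of_le (by simpa using S.card_le_univ)
    let I := (show ProjectiveSpectrum (grading k R) from χ z).asHomogeneousIdeal
    refine hz ⟨S.card, hcard⟩ fun hI : _ ∈ I ↦ hS ?_
    change (c S).1 ∈ I
    have hSm : S ∈ Finset.powersetCard S.card Finset.univ := by simp
    beta_reduce at hI
    -- All summands except `c S` lie in the prime of `χ z`, so vanishing of the sum would force `c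
    -- S` to vanish, contrary to `hS`.
    rw [← Finset.add_sum_erase _ _ hSm, Submodule.coe_add, Submodule.coe_sum] at hI
    refine (Ideal.add_mem_iff_left _ (sum_mem fun T hTm ↦ ?_)).mp hI
    obtain ⟨h1, h2⟩ := Finset.mem_erase.mp hTm
    exact not_not.mp (hT T (Finset.mem_powersetCard.mp h2).2 h1)
  · rw [Submodule.coe_sum, map_sum, MvPolynomial.esymm, map_sum, Finset.mul_sum]
    refine Finset.sum_congr rfl fun T _ ↦ ?_
    rw [hc, map_prod]
    simp_rw [MvPolynomial.aeval_X]
    have h1 (f : Fin d → Z.left.functionField) :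
        ∏ i ∈ T, f i = ∏ i, if i ∈ T then f i else 1 := by
      rw [Finset.prod_ite_mem, Finset.univ_inter]
    rw [h1, ← Finset.prod_mul_distrib]
    refine Finset.prod_congr rfl fun i _ ↦ ?_
    split_ifs
    · rw [← map_mul, mul_comm, div_mul_cancel₀ _ h0]
    · rw [mul_one]

end Center

end

end GaloisEmbedding

namespace GaloisEmbedding

noncomputable section

attribute [local instance] MvPolynomial.gradedAlgebra

/-! ## Powers of curves with a Galois embedding -/

section Powers

variable {k : Type u} [Field k]

/-- The field of symmetric functions in a free compositum is the base of a Galois extension with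
wreath product as Galois group. -/
lemma isGalois_symmetricField [CharZero k] {d : ℕ} {L K : Type u} [Field L] [Field K] [Algebra k L]
    [Algebra k K] {P : Fin d → L →ₐ[k] K} {t : L} {F : Subfield L} {M : Subfield K}
    (hP : IsFreeCompositum P) (hF : F = Subfield.closure (Set.range (algebraMap k L) ∪ {t}))
    [Normal F L] (hM : M = symmetricField P t) : IsGalois M K := by
  subst hM
  have := charZero_of_injective_algebraMap (algebraMap k K).injective
  have : CharZero (symmetricField P t) :=
    ⟨fun a b hab ↦ Nat.cast_injective (R := K) (congrArg Subtype.val hab)⟩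
  have := normal_symmetricField hP hF
  -- Separability comes from characteristic zero, and normality is the instance just obtained.
  exact { }

variable {C Z : Over (Spec (.of k))} [IsIntegral C.left] [IsIntegral Z.left] {N R d : ℕ}
  {π : Fin d → (Z ⟶ C)} {φ : C.left ⟶ projectiveSpace k N} {w : Fin (N + 1) → C.left.functionField}
  {P : Fin d → C.left.functionField →ₐ[k] Z.left.functionField}
  {χ : Z.left ⟶ projectiveSpace k R} {u : Fin (R + 1) → Z.left.functionField}

/-- The center is cut out by the symmetric forms. Absence of homogeneous relations among their
restrictions yields both dominance and independence, and the ratios identify the base field with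
`symmetricField P t`. -/
theorem IsSegrePower.exists_isGaloisCover [IsAlgClosed k] [CharZero k]
    (h : IsSegrePower π φ w P χ u) (hφ : IsLinearlyNormal φ w) {ℓ : Fin (1 + 1) → LinearForm k N}
    (hd : Disjoint (Set.range φ) (center ℓ)) (hℓ : LinearIndependent k ℓ) {G : Type*} [Group G]
    (hG : IsGaloisCover (projectFrom ℓ φ hd) G) :
    ∃ (β : Fin (d + 1) → LinearForm k R) (hβ : Disjoint (Set.range χ) (center β)),
      LinearIndependent k β ∧ IsGaloisCover (projectFrom β χ hβ) (WreathProduct G d) := by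
  have hinj := linearIndependent_iff_aeval.mp hφ.linearIndependent
  have h0 : MvPolynomial.aeval w (ℓ 0).1 ≠ 0 := fun h0 ↦ hℓ.ne_zero 0 (hinj _ h0)
  let t := MvPolynomial.aeval w (ℓ 1).1 / MvPolynomial.aeval w (ℓ 0).1
  -- A constant `t` would be a linear relation between `ℓ₀` and `ℓ₁` on `C`, hence between the forms
  -- themselves, as the coordinates `w` are independent.
  have ht (c : k) : algebraMap k C.left.functionField c ≠ t := by
    intro hc
    have h1 : -c • ℓ 0 + (1 : k) • ℓ 1 = 0 := by
      apply hinj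
      rw [Submodule.coe_add, Submodule.coe_smul, Submodule.coe_smul, one_smul, map_add, map_smul,
        Algebra.smul_def, map_neg, hc, neg_mul, div_mul_cancel₀ _ h0, neg_add_cancel]
    exact one_ne_zero
      (Fintype.linearIndependent_iff.mp hℓ ![-c, 1] ((Fin.sum_univ_two _).trans h1) 1)
  have htr := transcendental_of_isAlgClosed ht
  obtain ⟨β, hβ, hβu⟩ := h.exists_symmetricForms ℓ hd h0
  have hq : ∏ i, P i (MvPolynomial.aeval w (ℓ 0).1) ≠ 0 :=
    Finset.prod_ne_zero_iff.mpr fun i _ ↦ (map_ne_zero (P i)).mpr h0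
  have hrel (m : ℕ) (a : MvPolynomial (Fin (d + 1)) k) (ha : a.IsHomogeneous m)
      (h1 : MvPolynomial.aeval (fun j ↦ MvPolynomial.aeval u (β j).1) a = 0) : a = 0 := by
    simp_rw [hβu] at h1
    exact h.isFreeCompositum.eq_zero_of_aeval_esymm_eq_zero htr hq ha h1
  have hcoord := h.isLinearlyNormal.isCoordinates.projectFrom β hβ
  have hF : pulledBackFunctionField (projectFrom ℓ φ hd) =
      Subfield.closure (Set.range (algebraMap k C.left.functionField) ∪ {t}) := by
    rw [(hφ.isCoordinates.projectFrom ℓ hd).pulledBackFunctionField_eq 0 h0]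
    apply le_antisymm
    · refine Subfield.closure_le.mpr ?_
      rintro _ (hc | ⟨i, rfl⟩)
      · exact Subfield.subset_closure (Or.inl hc)
      · fin_cases i
        · simp [div_self h0]
        · exact Subfield.subset_closure (Or.inr rfl)
    · refine Subfield.closure_le.mpr ?_
      rintro _ (hc | rfl)
      · exact Subfield.subset_closure (Or.inl hc)
      · exact Subfield.subset_closure (Or.inr ⟨1, rfl⟩)
  have hu0 : MvPolynomial.aeval u (β 0).1 = ∏ i, P i (MvPolynomial.aeval w (ℓ 0).1) := by
    simp [hβu]
  -- The form of index `0` restricts to `∏ ℓ₀`, the common factor of all the others, so dividing by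
  -- it leaves exactly the elementary symmetric functions of the `P_i t`.
  have hM : pulledBackFunctionField (projectFrom β χ hβ) = symmetricField P t := by
    rw [hcoord.pulledBackFunctionField_eq 0 (hu0 ▸ hq), symmetricField]
    congr 3
    ext j
    rw [hu0, hβu, mul_div_cancel_left₀ _ hq]
  have := hG.isGalois
  obtain ⟨e⟩ := hG.galoisGroup
  refine ⟨β, hβ, ?_, hcoord.isDominant hrel, isGalois_symmetricField h.isFreeCompositum hF hM, ?_⟩
  -- Linear independence of the forms is the absence of relations in degree one.
  · refine LinearIndependent.of_comp
      ((MvPolynomial.aeval u).toLinearMap ∘ₗ (grading k R 1).subtype) ?_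
    exact linearIndependent_iff_aeval.mpr fun a ha ↦ Subtype.ext (hrel 1 a.1 a.2 ha)
  · rw [hM]
    exact nonempty_mulEquiv_symmetricField h.isFreeCompositum ht hF e

end Powers

end

end GaloisEmbedding

/-- If a smooth projective curve `C` possesses a Galois embedding with Galois group `G`, then `C^d`
possesses a Galois embedding with Galois group `G^d ⋊ S_d`. -/
theorem mainTheorem2 (k : Type u) [Field k] [IsAlgClosed k] [CharZero k]
    (C : Over (Spec (.of k))) (hC : GaloisEmbedding.IsSmoothProjectiveVariety k 1 C)
    (G : Type*) [Group G] (hG : GaloisEmbedding.HasGaloisEmbedding hC G) (d : ℕ) :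
    ∃ hCd : GaloisEmbedding.IsSmoothProjectiveVariety k d (GaloisEmbedding.power C d),
      GaloisEmbedding.HasGaloisEmbedding hCd (GaloisEmbedding.WreathProduct G d) := by
  have := hC.isIntegral
  have := hC.smooth
  obtain ⟨N, φ, ℓ, hd, hφ, hℓ, hcover⟩ := hG
  obtain ⟨w, hw⟩ := hφ.exists_isLinearlyNormal
  obtain ⟨hint, hsmooth, P, R, χ, u, hS⟩ := GaloisEmbedding.exists_isSegrePower hw d
    (GaloisEmbedding.power C d) (fun i ↦ Pi.π (fun _ : Fin d ↦ C) i) (productIsProduct _)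
  have hχ := hS.isLinearlyNormal.isVeryAmpleEmbedding
  obtain ⟨β, hβ, hli, hgal⟩ := hS.exists_isGaloisCover hw hd hℓ hcover
  exact ⟨⟨hint, hsmooth, R, χ, hχ.isClosedImmersion, hχ.comp_structureMap⟩,
    R, χ, β, hβ, hχ, hli, hgal⟩
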